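/- **Theorem 2 (Stability during Training).** Let $L\ge 2$, $d_0\ge 1$, and let $\sigma:\mathbb R\to\mathbb R$ be differentiable with $\dot\sigma$ bounded and Lipschitz. For a width $d$ consider the fully connected $L$-layer network with scalar output in standard parameterization: $x^0=x\in\mathbb R^{d_0}$, $h^{l}=x^{l-1}W^{l}$, $x^{l}=\sigma(h^{l})$ (coordinate-wise), $f(\theta,x)=h^L\in\mathbb R$, all hidden layers having the same width $d_1=\dots=d_{L-1}=d$, where $\theta=(W^1,\dots,W^L)\in\mathbb R^P$. The initial parameters $\theta_0$ are independent centred Gaussians, with variance $\sigma_w^2/d$ in the layers $2,\dots,L$ and $\sigma_w^2/d_0$ in the first layer, $\sigma_w>0$. The weight terms $a_1,\dots,a_P$ are independent of each other and of $\theta_0$; those of the parameters in layer $l$ have distribution $\rho_l$, a probability measure on $\mathbb R$ with bounded support and mean $\mu_l$ (for example, a constant $\mu_l$). Let $(x_i,y_i)_{i\le n}$, $n\ge1$, be a training set in $\mathbb R^{d_0}\times\mathbb R$ with $x_i\neq x_j$ for $i\ne j$. For $J(\theta)=\nabla_\theta f(\theta,\mathcal X)\in\mathbb R^{n\times P}$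 the WNTK in standard parameterization is $$\mathcal A(\theta)=\tfrac1d\,J(\theta)\,\mathrm{diag}(a_1,\dots,a_P)\,J(\theta)^\top\in\mathbb R^{n\times n}.$$ The analytic WNTK is the $n\times n$ matrix $\mathcal A_\infty^{(L)}$ defined by $\Sigma^{(1)}_{ij}=\frac{\sigma_w^2}{d_0}x_i^\top x_j$, $\mathcal A^{(1)}_\infty=0$ and, for $2\le l\le L$, $$Q^{(l)}_{ij}=\mathbb E_{f\sim\mathcal N(0,\Sigma^{(l-1)})}[\sigma(f_i)\sigma(f_j)],\quad \dot Q^{(l)}_{ij}=\mathbb E_{f\sim\mathcal N(0,\Sigma^{(l-1)})}[\dot\sigma(f_i)\dot\sigma(f_j)],\quad \Sigma^{(l)}=\sigma_w^2Q^{(l)},$$ $$(\mathcal A^{(l)}_\infty)_{ij}=\sigma_w^2\,(\mathcal A^{(l-1)}_\infty)_{ij}\,\dot Q^{(l)}_{ij}+\mu_l\,Q^{(l)}_{ij}.$$ Let $\lambda_{\min}\le\lambda_{\max}$ be the smallest and the largest eigenvalue of $\mathcal A_\infty^{(L)}$, assume $\lambda_{\min}>0$, and put $\eta_{\mathrm{critical}}=2/(\lambda_{\min}+\lambda_{\max})$.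 Train by full-batch gradient descent on $\mathcal L(\theta)=\frac12\sum_{i=1}^n(f(\theta,x_i)-y_i)^2$, with learning rate $\eta a_p$ on the parameter $\theta_p$, i.e. $\theta_{t+1,p}=\theta_{t,p}-\eta\,a_p\,\partial_{\theta_p}\mathcal L(\theta_t)$ with $\eta=\eta_0/d$, where $0<\eta_0<\eta_{\mathrm{critical}}$. Write $\mathcal A_t=\mathcal A(\theta_t)$ and $a_{\max}=\max_p a_p$. Then for every $\delta_0>0$ there are $R_0>0$, $N\in\mathbb N$ and $K>1$ such that for every $d\ge N$, with probability at least $1-\delta_0$ over the initialization and the weight terms, $$\|\mathcal A_0-\mathcal A_t\|_F\le\frac{6K^3R_0\,a_{\max}^2}{\lambda_{\min}\sqrt d}\qquad\text{for all } t=0,1,2,\dots\text{ simultaneously.}$$ -/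

import Mathlib

open MeasureTheory ProbabilityTheory
open scoped Matrix

/- `‖M‖` for a matrix `M` is the Frobenius norm throughout. -/
attribute [local instance] Matrix.frobeniusNormedAddCommGroup

noncomputable section

namespace WNTK

/-- Parameters of a bias-free fully connected network with `L ≥ 2` weight layers, input dimension
`d₀`, `L - 1` hidden layers of common width `d`, and one output:
* `inl (i, j)` is the entry `(i, j)` of `W¹ ∈ ℝ^{d₀ × d}`;
* `inr (inl (l, i, j))`, with `l = 0, …, L - 3`, is the entry `(i, j)` of `W^{l+2} ∈ ℝ^{d × d}`;
* `inr (inr i)` is the entry `i` of the output layer `W^L ∈ ℝ^{d × 1}`. -/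
abbrev ParamIdx (L d₀ d : ℕ) : Type :=
  (Fin d₀ × Fin d) ⊕ ((Fin (L - 2) × Fin d × Fin d) ⊕ Fin d)

variable {L d₀ d n : ℕ}

/-- The number in `{1, …, L}` of the layer that a parameter belongs to. -/
def layerOf : ParamIdx L d₀ d → ℕ
  | .inl _ => 1
  | .inr (.inl q) => q.1 + 2
  | .inr (.inr _) => L

/-- The number of inputs of a unit in the layer of the given parameter. -/
def fanIn : ParamIdx L d₀ d → ℕ
  | .inl _ => d₀
  | .inr _ => d

/-- Hidden activations in standard parameterization, `h^{l+1} = x^l W^{l+1}`,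
`x^{l+1} = σ(h^{l+1})`, `x^0 = x`. `hidden σ θ x l` is `x^{l+1}`, for `l = 0, …, L - 2`
(larger values of `l` do not occur in a network). -/
def hidden (σ : ℝ → ℝ) (θ : ParamIdx L d₀ d → ℝ) (x : Fin d₀ → ℝ) : ℕ → Fin d → ℝ
  | 0 => fun j => σ (∑ i, x i * θ (.inl (i, j)))
  | l + 1 => fun j =>
      if h : l < L - 2 then σ (∑ i, hidden σ θ x l i * θ (.inr (.inl (⟨l, h⟩, i, j)))) else 0

/-- The scalar output `f(θ, x) = h^L = x^{L-1} W^L` of the network. -/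
def network (σ : ℝ → ℝ) (θ : ParamIdx L d₀ d → ℝ) (x : Fin d₀ → ℝ) : ℝ :=
  ∑ i, hidden σ θ x (L - 2) i * θ (.inr (.inr i))

/-- The Jacobian `∇_θ f(𝒳) ∈ ℝ^{n × P}` of the outputs on the training inputs. -/
def jacobian (σ : ℝ → ℝ) (X : Fin n → Fin d₀ → ℝ) (θ : ParamIdx L d₀ d → ℝ) :
    Matrix (Fin n) (ParamIdx L d₀ d) ℝ :=
  Matrix.of fun s p => fderiv ℝ (fun θ' => network σ θ' (X s)) θ (Pi.single p 1)

/-- The WNTK on the training set in standard parameterization,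
`𝒜 = (1/d) ∇_θ f(𝒳) (a ⊙ ∇_θ f(𝒳)ᵀ)`, where `a ⊙ ·` multiplies the row of the
parameter `p` by `a p`. -/
def wntk (σ : ℝ → ℝ) (X : Fin n → Fin d₀ → ℝ) (a θ : ParamIdx L d₀ d → ℝ) :
    Matrix (Fin n) (Fin n) ℝ :=
  (d : ℝ)⁻¹ • (jacobian σ X θ * (Matrix.diagonal a * (jacobian σ X θ)ᵀ))

/-- The sum-of-squares loss on the training set. -/
def loss (σ : ℝ → ℝ) (X : Fin n → Fin d₀ → ℝ) (Y : Fin n → ℝ) (θ : ParamIdx L d₀ d → ℝ) : ℝ :=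
  (1 / 2) * ∑ s, (network σ θ (X s) - Y s) ^ 2

/-- Full-batch gradient descent from `θ₀`, with learning rate `η * a p` on the parameter `p`,
where `η = η₀ / d`; `gradDescent σ X Y η₀ a θ₀ t` is `θ_t`. -/
def gradDescent (σ : ℝ → ℝ) (X : Fin n → Fin d₀ → ℝ) (Y : Fin n → ℝ) (η₀ : ℝ)
    (a θ₀ : ParamIdx L d₀ d → ℝ) : ℕ → ParamIdx L d₀ d → ℝ
  | 0 => θ₀
  | t + 1 => fun p =>
      gradDescent σ X Y η₀ a θ₀ t p -
        η₀ / d * a p * fderiv ℝ (loss σ X Y) (gradDescent σ X Y η₀ a θ₀ t) (Pi.single p 1)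

/-- Standard random initialization: independent centred Gaussian weights with variance
`σ_w² / (fan-in)`, that is `σ_w² / d` in the layers `2, …, L` and `σ_w² / d₀` in the first. -/
def initMeasure (L d₀ d : ℕ) (σw : ℝ) : Measure (ParamIdx L d₀ d → ℝ) :=
  Measure.pi fun p => gaussianReal 0 (Real.toNNReal (σw ^ 2 / fanIn p))

/-- Independent weight terms `a p`, the ones of the `l`-th layer with distribution `ρ l`. -/
def weightMeasure (L d₀ d : ℕ) (ρ : ℕ → Measure ℝ) : Measure (ParamIdx L d₀ d → ℝ) :=
  Measure.pi fun p => ρ (layerOf p)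

/-- The joint law of the initial parameters and of the weight terms (independent). -/
def jointMeasure (L d₀ d : ℕ) (σw : ℝ) (ρ : ℕ → Measure ℝ) :
    Measure ((ParamIdx L d₀ d → ℝ) × (ParamIdx L d₀ d → ℝ)) :=
  (initMeasure L d₀ d σw).prod (weightMeasure L d₀ d ρ)

/-- The matrix `E_{f ∼ 𝒩(0, S)} [φ(f_i) φ(f_j)]`. -/
def gaussMoment (φ : ℝ → ℝ) (S : Matrix (Fin n) (Fin n) ℝ) : Matrix (Fin n) (Fin n) ℝ :=
  Matrix.of fun i j => ∫ f, φ (f i) * φ (f j) ∂(multivariateGaussian 0 S)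

/-- `preCov σ σw X l` is the limiting covariance, on the training inputs, of the
pre-activations `h^{l+1}`: the matrix `(σ_w² / d₀) x_iᵀ x_j` for `h¹`, and then
`σ_w² E_{f ∼ 𝒩(0, S)} [σ(f_i) σ(f_j)]` with `S` the covariance of the layer below. -/
def preCov (σ : ℝ → ℝ) (σw : ℝ) (X : Fin n → Fin d₀ → ℝ) : ℕ → Matrix (Fin n) (Fin n) ℝ
  | 0 => Matrix.of fun i j => σw ^ 2 / d₀ * (X i ⬝ᵥ X j)
  | l + 1 => σw ^ 2 • gaussMoment σ (preCov σ σw X l)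

/-- `analyticKernel σ σw ρ X l` is the analytic (infinite-width) WNTK on the training inputs of the
network truncated after the layer `l + 1`. With `S` the covariance of the layer below and `μ_{l+2}`
the mean of `ρ (l + 2)`, the layer `l + 2` propagates the kernel by the factor
`σ_w² E_{f ∼ 𝒩(0, S)} [σ'(f_i) σ'(f_j)]` and adds `μ_{l+2} E_{f ∼ 𝒩(0, S)} [σ(f_i) σ(f_j)]`.

The recursion starts from `0` and not from `μ_1 x_iᵀ x_j / d₀`: in standard parameterization, with
the common factor `1/d`, the contribution of `W¹` to the kernel is that of the usual
(`1/√fan-in`) parameterization times `d₀ / (σ_w² d)`, so it vanishes as `d → ∞`, whereas the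
contributions of the other layers get the factor `1 / σ_w²`. -/
def analyticKernel (σ : ℝ → ℝ) (σw : ℝ) (ρ : ℕ → Measure ℝ) (X : Fin n → Fin d₀ → ℝ) :
    ℕ → Matrix (Fin n) (Fin n) ℝ
  | 0 => 0
  | l + 1 =>
      analyticKernel σ σw ρ X l ⊙ (σw ^ 2 • gaussMoment (deriv σ) (preCov σ σw X l)) +
        (∫ a, a ∂(ρ (l + 2))) • gaussMoment σ (preCov σ σw X l)

/-- The analytic WNTK of the `L`-layer network on the training inputs. -/
def analyticWNTK (L : ℕ) (σ : ℝ → ℝ) (σw : ℝ) (ρ : ℕ → Measure ℝ) (X : Fin n → Fin d₀ → ℝ) :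
    Matrix (Fin n) (Fin n) ℝ :=
  analyticKernel σ σw ρ X (L - 1)

end WNTK

end

/-! Write ε = d^(-1/4). At initialization an output gradient has norm O(√d) = O(ε⁻²). If training
moves every output gradient only by O(1), the prefactor 1/d = ε⁴ of the kernel gives a change of
order ε⁴ · ε⁻² = 1/√d (`abs_wntk_sub_le`), which is the claimed rate.

The delicate point is to get O(1) for the gradients. The change of σ'(h) is at most c|h' - h| and it
multiplies a backward vector v. The product must have norm O(ε²), because the gradient pairs it with
an activation vector of norm O(ε⁻²); Euclidean bounds on the two factors do not give this. Hölder's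
inequality does, provided both factors are spread over the coordinates, with ℓ⁴ norm O(ε). For v
this comes from the Gaussian output layer. For h' - h it comes from the direction of the motion: up
to an ℓ² error O(ε³), gradient descent moves along a combination of the weighted gradients at
initialization (`Near`), and along such a combination the pre-activations move to first order by a
layer kernel applied to the initial backward vectors (`dpre_lin`), which are spread out for the same
reason. The remainder is O(ε) already in ℓ². This is carried by `exists_pre_bound`,
`exists_vee_bound` and `exists_grad_sub_bound`.

An induction on time closes the loop (`exists_stability`). As long as the gradients stay within O(1)
of their initial values, the residual contracts by a fixed factor (`residual_step`). Hence the
coefficients of the initial gradients sum like a geometric series, and the drift of the gradients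
only accumulates an error O(ε⁴), below the permitted ε³.

The probabilistic input is `exists_init_bound` and `whp_wntk`. Operator norms are bounded by a net
argument; layer averages concentrate because the units of a layer are independent given the layers
below; fourth moments of backward quantities are computed given the hidden layers. The kernel at
initialization converges layer by layer: given the layers below, a diagonal entry of the next
layer's kernel is a quadratic form in one fresh weight column plus an average of fresh weight terms.
Conditioning is always expressed by resampling one layer (`whp_of_resample`). Closeness to the
analytic kernel yields the initial contraction.

The argument produces a bound C/√d, whereas the statement has the factor a_max². This factor is
bounded below: a positive smallest eigenvalue forces some layer to have positive mean weight
(`exists_integral_pos`), and the maximum dominates the average over that layer (`whp_le_iSup`). -/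

noncomputable section

namespace WNTK

/-! ### Euclidean norms, fourth-power sums and operator norm bounds. -/

variable {ι κ : Type*} [Fintype ι] [Fintype κ]

/-- The Euclidean norm of a finite family of reals. -/
def l2 (v : ι → ℝ) : ℝ := √(∑ i, v i ^ 2)

lemma l2_nonneg (v : ι → ℝ) : 0 ≤ l2 v := Real.sqrt_nonneg _

lemma l2_sq (v : ι → ℝ) : l2 v ^ 2 = ∑ i, v i ^ 2 :=
  Real.sq_sqrt (Finset.sum_nonneg fun _ _ => sq_nonneg _)

lemma l2_eq_norm (v : ι → ℝ) : l2 v = ‖(WithLp.toLp 2 v : EuclideanSpace ℝ ι)‖ := by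
  simp [l2, EuclideanSpace.norm_eq]

@[simp] lemma l2_zero : l2 (0 : ι → ℝ) = 0 := by simp [l2]

lemma l2_add_le (u v : ι → ℝ) : l2 (u + v) ≤ l2 u + l2 v := by
  simp only [l2_eq_norm, WithLp.toLp_add]; exact norm_add_le _ _

lemma l2_sub_le (u v : ι → ℝ) : l2 (u - v) ≤ l2 u + l2 v := by
  simp only [l2_eq_norm, WithLp.toLp_sub]; exact norm_sub_le _ _

lemma l2_smul (c : ℝ) (v : ι → ℝ) : l2 (c • v) = |c| * l2 v := by
  simp only [l2_eq_norm, WithLp.toLp_smul, norm_smul, Real.norm_eq_abs]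

lemma l2_sum_le {κ : Type*} {s : Finset κ} (v : κ → ι → ℝ) : l2 (∑ k ∈ s, v k) ≤ ∑ k ∈ s, l2 (v k) := by
  simp only [l2_eq_norm, WithLp.toLp_sum]; exact norm_sum_le _ _

lemma abs_sum_mul_le (u v : ι → ℝ) : |∑ i, u i * v i| ≤ l2 u * l2 v := by
  rw [← Real.sqrt_sq_eq_abs, l2, l2, ← Real.sqrt_mul (Finset.sum_nonneg fun _ _ => sq_nonneg _)]
  exact Real.sqrt_le_sqrt (Finset.sum_mul_sq_le_sq_mul_sq _ _ _)

lemma l2_le_of_sum_sq_le {v : ι → ℝ} {c : ℝ} (hc : 0 ≤ c) (h : ∑ i, v i ^ 2 ≤ c ^ 2) :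
    l2 v ≤ c := Real.sqrt_le_iff.2 ⟨hc, h⟩

lemma l2_le_of_abs_le {u v : ι → ℝ} {c : ℝ} (hc : 0 ≤ c) (h : ∀ i, |u i| ≤ c * |v i|) :
    l2 u ≤ c * l2 v := by
  refine l2_le_of_sum_sq_le (mul_nonneg hc (l2_nonneg _)) ?_
  rw [mul_pow, l2_sq, Finset.mul_sum]
  refine Finset.sum_le_sum fun i _ => ?_
  rw [← sq_abs (u i), ← sq_abs (v i), ← mul_pow]
  exact pow_le_pow_left₀ (abs_nonneg _) (h i) 2

lemma abs_le_l2 (v : ι → ℝ) (i : ι) : |v i| ≤ l2 v := by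
  rw [← Real.sqrt_sq_eq_abs]
  exact Real.sqrt_le_sqrt (Finset.single_le_sum (f := fun i => v i ^ 2)
    (fun _ _ => sq_nonneg _) (Finset.mem_univ i))

lemma l2_le_sum_abs (v : ι → ℝ) : l2 v ≤ ∑ i, |v i| := by
  refine l2_le_of_sum_sq_le (Finset.sum_nonneg fun _ _ => abs_nonneg _) ?_
  simp only [← sq_abs (v _)]
  exact Finset.sum_sq_le_sq_sum_of_nonneg fun _ _ => abs_nonneg _

/-- The ℓ⁴ norm is below the ℓ² norm. This is how remainders that are small in ℓ² enter the
fourth-power estimates. -/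
lemma sum_pow_four_le (v : ι → ℝ) : ∑ i, v i ^ 4 ≤ l2 v ^ 4 := by
  have h := Finset.sum_sq_le_sq_sum_of_nonneg (s := Finset.univ) (f := fun i => v i ^ 2)
    fun i _ => sq_nonneg (v i)
  calc ∑ i, v i ^ 4 = ∑ i, (v i ^ 2) ^ 2 := by simp only [← pow_mul]
    _ ≤ (∑ i, v i ^ 2) ^ 2 := h
    _ = l2 v ^ 4 := by rw [← l2_sq, ← pow_mul]

/-- Hölder's inequality for the product of two families bounded in `ℓ⁴`. -/
lemma l2_mul_le {u v : ι → ℝ} {a b : ℝ} (ha : 0 ≤ a) (hb : 0 ≤ b) (hu : ∑ i, u i ^ 4 ≤ a ^ 4)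
    (hv : ∑ i, v i ^ 4 ≤ b ^ 4) : l2 (fun i => u i * v i) ≤ a * b := by
  refine l2_le_of_sum_sq_le (mul_nonneg ha hb) ?_
  have h := Finset.sum_mul_sq_le_sq_mul_sq Finset.univ (fun i => u i ^ 2) fun i => v i ^ 2
  simp only [← pow_mul, ← mul_pow] at h
  norm_num at h
  refine abs_le_of_sq_le_sq' (h.trans ?_) (by positivity) |>.2
  calc _ ≤ a ^ 4 * b ^ 4 := by gcongr
    _ = _ := by ring

lemma l2_sq_le_of_sum_pow_four {u : ι → ℝ} {a : ℝ} (ha : 0 ≤ a) (hu : ∑ i, u i ^ 4 ≤ a ^ 4) :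
    l2 (fun i => u i ^ 2) ≤ a ^ 2 := by
  simpa [sq] using l2_mul_le ha ha hu hu

lemma sum_add_pow_four_le (u v : ι → ℝ) :
    ∑ i, (u i + v i) ^ 4 ≤ 8 * (∑ i, u i ^ 4 + ∑ i, v i ^ 4) := by
  rw [← Finset.sum_add_distrib, Finset.mul_sum]
  refine Finset.sum_le_sum fun i _ => ?_
  nlinarith [sq_nonneg (u i - v i), sq_nonneg (u i + v i), sq_nonneg (u i ^ 2 - v i ^ 2),
    sq_nonneg ((u i - v i) ^ 2), mul_nonneg (sq_nonneg (u i - v i)) (sq_nonneg (u i + v i)),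
    mul_nonneg (sq_nonneg (u i - v i)) (sq_nonneg (u i)),
    mul_nonneg (sq_nonneg (u i - v i)) (sq_nonneg (v i))]

/-- Cauchy–Schwarz against the constant vector. With `a` of order d^(-1/4) the right-hand side is of
order one. -/
lemma l2_le_of_sum_pow_four {u : ι → ℝ} {a : ℝ} (ha : 0 ≤ a) (hu : ∑ i, u i ^ 4 ≤ a ^ 4) :
    l2 u ^ 2 ≤ √(Fintype.card ι) * a ^ 2 := by
  have h := abs_sum_mul_le (fun _ : ι => (1 : ℝ)) fun i => u i ^ 2
  have h1 : l2 (fun _ : ι => (1 : ℝ)) = √(Fintype.card ι) := by simp [l2]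
  simp only [one_mul, h1] at h
  rw [l2_sq]
  exact (le_abs_self _).trans
    (h.trans (mul_le_mul_of_nonneg_left (l2_sq_le_of_sum_pow_four ha hu) (Real.sqrt_nonneg _)))

/-- `OpB W K` says that the `ℓ²` operator norm of `W` is at most `K`. -/
def OpB (W : Matrix ι κ ℝ) (K : ℝ) : Prop := 0 ≤ K ∧ ∀ v : κ → ℝ, l2 (W *ᵥ v) ≤ K * l2 v

lemma OpB.mono {W : Matrix ι κ ℝ} {K K' : ℝ} (h : OpB W K) (hK : K ≤ K') : OpB W K' :=
  ⟨h.1.trans hK, fun v => (h.2 v).trans (mul_le_mul_of_nonneg_right hK (l2_nonneg _))⟩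

/-- The adjoint has the same norm: ‖vW‖² = ⟨v, W(vW)⟩ ≤ ‖v‖ · K‖vW‖, and one factor cancels unless
it vanishes. -/
lemma OpB.vecMul {W : Matrix ι κ ℝ} {K : ℝ} (h : OpB W K) (v : ι → ℝ) :
    l2 (v ᵥ* W) ≤ K * l2 v := by
  rcases (l2_nonneg (v ᵥ* W)).eq_or_lt with h0 | hpos
  · rw [← h0]; exact mul_nonneg h.1 (l2_nonneg _)
  have h1 : l2 (v ᵥ* W) ^ 2 = ∑ i, v i * (W *ᵥ (v ᵥ* W)) i := by
    have := Matrix.dotProduct_mulVec v W (v ᵥ* W)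
    simp only [dotProduct] at this
    rw [this, l2_sq]; simp [sq]
  have h2 := (le_abs_self _).trans (abs_sum_mul_le v (W *ᵥ (v ᵥ* W)))
  rw [← h1] at h2
  have h3 := h2.trans (mul_le_mul_of_nonneg_left (h.2 _) (l2_nonneg v))
  nlinarith

lemma OpB.transpose {W : Matrix ι κ ℝ} {K : ℝ} (h : OpB W K) : OpB Wᵀ K :=
  ⟨h.1, fun v => by rw [Matrix.mulVec_transpose]; exact h.vecMul v⟩

lemma OpB.mul {τ : Type*} [Fintype τ] {W : Matrix ι κ ℝ} {V : Matrix κ τ ℝ} {K M : ℝ}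
    (h : OpB W K) (h' : OpB V M) : OpB (W * V) (K * M) :=
  ⟨mul_nonneg h.1 h'.1, fun v => by
    rw [← Matrix.mulVec_mulVec, mul_assoc]
    exact (h.2 _).trans (mul_le_mul_of_nonneg_left (h'.2 v) h.1)⟩

lemma OpB.add {W V : Matrix ι κ ℝ} {K M : ℝ} (h : OpB W K) (h' : OpB V M) :
    OpB (W + V) (K + M) :=
  ⟨add_nonneg h.1 h'.1, fun v => by
    rw [Matrix.add_mulVec, add_mul]
    exact (l2_add_le _ _).trans (add_le_add (h.2 v) (h'.2 v))⟩

lemma opB_diagonal [DecidableEq ι] {u : ι → ℝ} {K : ℝ} (hK : 0 ≤ K) (h : ∀ i, |u i| ≤ K) :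
    OpB (Matrix.diagonal u) K :=
  ⟨hK, fun v => l2_le_of_abs_le hK fun i => by
    rw [Matrix.mulVec_diagonal, abs_mul]
    exact mul_le_mul_of_nonneg_right (h i) (abs_nonneg _)⟩

lemma opB_of_sum_sq_le {W : Matrix ι κ ℝ} {K : ℝ} (hK : 0 ≤ K)
    (h : ∑ i, ∑ j, W i j ^ 2 ≤ K ^ 2) : OpB W K := by
  refine ⟨hK, fun v => l2_le_of_sum_sq_le (mul_nonneg hK (l2_nonneg _)) ?_⟩
  rw [mul_pow, l2_sq]
  refine le_trans ?_ (mul_le_mul_of_nonneg_right h (Finset.sum_nonneg fun _ _ => sq_nonneg _))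
  rw [Finset.sum_mul]
  exact Finset.sum_le_sum fun i _ => Finset.sum_mul_sq_le_sq_mul_sq _ _ _

/-- A row is the image of a basis vector under the transpose. Row bounds turn operator norms into
the second moments of linear forms in the output weights. -/
lemma OpB.sum_row_sq_le {W : Matrix ι κ ℝ} {K : ℝ} (h : OpB W K) (i : ι) :
    ∑ j, W i j ^ 2 ≤ K ^ 2 := by
  classical
  have h1 := h.vecMul (Pi.single i 1)
  have h2 : l2 (Pi.single i (1 : ℝ)) = 1 := by
    simp [l2, Pi.single_apply, ite_pow]
  rw [h2, mul_one] at h1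
  have h3 := pow_le_pow_left₀ (l2_nonneg _) h1 2
  simpa [l2_sq] using h3

lemma OpB.sum_sq_le {W : Matrix ι κ ℝ} {K : ℝ} (h : OpB W K) :
    ∑ i, ∑ j, W i j ^ 2 ≤ Fintype.card ι * K ^ 2 := by
  refine (Finset.sum_le_sum fun i _ => h.sum_row_sq_le i).trans ?_
  simp

/-! ### Forward and backward passes and the kernels of the layers. -/

variable {L d₀ d n : ℕ}

/-- The first weight matrix. -/
def first (θ : ParamIdx L d₀ d → ℝ) : Matrix (Fin d₀) (Fin d) ℝ :=
  Matrix.of fun i j => θ (.inl (i, j))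

/-- The weight matrix between the hidden layers `l` and `l + 1` (counted from `0`). -/
def mid (θ : ParamIdx L d₀ d → ℝ) (l : ℕ) : Matrix (Fin d) (Fin d) ℝ :=
  Matrix.of fun i j => if h : l < L - 2 then θ (.inr (.inl (⟨l, h⟩, i, j))) else 0

/-- The output weights. -/
def last (θ : ParamIdx L d₀ d → ℝ) : Fin d → ℝ := fun i => θ (.inr (.inr i))

/-- The pre-activations of the hidden layers. -/
def pre (σ : ℝ → ℝ) (θ : ParamIdx L d₀ d → ℝ) (x : Fin d₀ → ℝ) : ℕ → Fin d → ℝ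
  | 0 => x ᵥ* first θ
  | l + 1 => (fun i => σ (pre σ θ x l i)) ᵥ* mid θ l

/-- The activations of the hidden layers. -/
def act (σ : ℝ → ℝ) (θ : ParamIdx L d₀ d → ℝ) (x : Fin d₀ → ℝ) (l : ℕ) (i : Fin d) : ℝ :=
  σ (pre σ θ x l i)

/-- The derivative of the output with respect to the activations `k` layers below the top one. -/
def bwd (σ : ℝ → ℝ) (θ : ParamIdx L d₀ d → ℝ) (x : Fin d₀ → ℝ) : ℕ → Fin d → ℝ
  | 0 => last θ
  | k + 1 => mid θ (L - 2 - (k + 1)) *ᵥ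
      fun j => deriv σ (pre σ θ x (L - 2 - k) j) * bwd σ θ x k j

/-- The derivative of the output with respect to the activations of the hidden layer `l`. -/
def vee (σ : ℝ → ℝ) (θ : ParamIdx L d₀ d → ℝ) (x : Fin d₀ → ℝ) (l : ℕ) : Fin d → ℝ :=
  bwd σ θ x (L - 2 - l)

/-- The derivative of the output with respect to the pre-activations of the hidden layer `l`. -/
def dlt (σ : ℝ → ℝ) (θ : ParamIdx L d₀ d → ℝ) (x : Fin d₀ → ℝ) (l : ℕ) (j : Fin d) : ℝ :=
  deriv σ (pre σ θ x l j) * vee σ θ x l j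

/-- The gradient of the output in the parameters. -/
def grad (σ : ℝ → ℝ) (θ : ParamIdx L d₀ d → ℝ) (x : Fin d₀ → ℝ) : ParamIdx L d₀ d → ℝ
  | .inl (i, j) => x i * dlt σ θ x 0 j
  | .inr (.inl (l, i, j)) => act σ θ x l i * dlt σ θ x (l + 1) j
  | .inr (.inr i) => act σ θ x (L - 2) i

/-- The derivative of the pre-activations at `θ` in the direction `Δ`. -/
def dpre (σ : ℝ → ℝ) (θ Δ : ParamIdx L d₀ d → ℝ) (x : Fin d₀ → ℝ) : ℕ → Fin d → ℝ
  | 0 => x ᵥ* first Δ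
  | l + 1 => (fun i => deriv σ (pre σ θ x l i) * dpre σ θ Δ x l i) ᵥ* mid θ l +
      act σ θ x l ᵥ* mid Δ l

/-- The weighted tangent kernel of the units of a hidden layer. -/
def kern (σ : ℝ → ℝ) (a θ : ParamIdx L d₀ d → ℝ) (x x' : Fin d₀ → ℝ) :
    ℕ → Matrix (Fin d) (Fin d) ℝ
  | 0 => Matrix.diagonal fun j => (d : ℝ)⁻¹ * ∑ i, first a i j * (x i * x' i)
  | l + 1 => (mid θ l)ᵀ * (Matrix.diagonal (fun i => deriv σ (pre σ θ x l i)) *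
        kern σ a θ x x' l * Matrix.diagonal (fun i => deriv σ (pre σ θ x' l i))) * mid θ l +
      Matrix.diagonal fun j => (d : ℝ)⁻¹ * ∑ i, mid a l i j * (act σ θ x l i * act σ θ x' l i)

lemma mid_apply {θ : ParamIdx L d₀ d → ℝ} {l : ℕ} (h : l < L - 2) (i j : Fin d) :
    mid θ l i j = θ (.inr (.inl (⟨l, h⟩, i, j))) := by simp [mid, h]

lemma first_add (θ Δ : ParamIdx L d₀ d → ℝ) : first (θ + Δ) = first θ + first Δ := rfl

lemma mid_add (θ Δ : ParamIdx L d₀ d → ℝ) (l : ℕ) : mid (θ + Δ) l = mid θ l + mid Δ l := by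
  ext i j; by_cases h : l < L - 2 <;> simp [mid, h]

lemma mid_smul (c : ℝ) (θ : ParamIdx L d₀ d → ℝ) (l : ℕ) : mid (c • θ) l = c • mid θ l := by
  ext i j; by_cases h : l < L - 2 <;> simp [mid, h]

lemma last_add (θ Δ : ParamIdx L d₀ d → ℝ) : last (θ + Δ) = last θ + last Δ := rfl

lemma pre_succ (σ : ℝ → ℝ) (θ : ParamIdx L d₀ d → ℝ) (x : Fin d₀ → ℝ) (l : ℕ) :
    pre σ θ x (l + 1) = act σ θ x l ᵥ* mid θ l := rfl

lemma hidden_eq_act (σ : ℝ → ℝ) (θ : ParamIdx L d₀ d → ℝ) (x : Fin d₀ → ℝ) :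
    ∀ l ≤ L - 2, hidden σ θ x l = act σ θ x l
  | 0, _ => by
    ext j; simp [hidden, act, pre, first, Matrix.vecMul, dotProduct]
  | l + 1, h => by
    ext j
    have hl : l < L - 2 := h
    simp [hidden, hl, hidden_eq_act σ θ x l hl.le, act, pre, mid, Matrix.vecMul, dotProduct]

lemma network_eq (σ : ℝ → ℝ) (θ : ParamIdx L d₀ d → ℝ) (x : Fin d₀ → ℝ) :
    network σ θ x = ∑ i, act σ θ x (L - 2) i * last θ i := by
  simp [network, hidden_eq_act, last]

lemma vee_top (σ : ℝ → ℝ) (θ : ParamIdx L d₀ d → ℝ) (x : Fin d₀ → ℝ) :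
    vee σ θ x (L - 2) = last θ := by simp [vee, bwd]

/-- Backpropagation indexed by the layer: `bwd` recurses on the distance from the top, so the three
subtractions have to be matched. -/
lemma vee_of_lt (σ : ℝ → ℝ) (θ : ParamIdx L d₀ d → ℝ) (x : Fin d₀ → ℝ) {l : ℕ}
    (h : l < L - 2) : vee σ θ x l = mid θ l *ᵥ dlt σ θ x (l + 1) := by
  obtain ⟨k, hk⟩ : ∃ k, L - 2 - l = k + 1 := ⟨L - 2 - l - 1, by omega⟩
  have h1 : L - 2 - (l + 1) = k := by omega
  have h2 : L - 2 - (k + 1) = l := by omega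
  have h3 : L - 2 - k = l + 1 := by omega
  unfold vee dlt vee
  rw [hk, h1, bwd, h2, h3]

/-! ### Derivatives of the network, its gradient and the loss. -/

section Derivative
variable {σ : ℝ → ℝ} (hσ : Differentiable ℝ σ)
include hσ

lemma differentiable_pre (x : Fin d₀ → ℝ) (l : ℕ) (j : Fin d) :
    Differentiable ℝ fun θ : ParamIdx L d₀ d → ℝ => pre σ θ x l j := by
  induction l generalizing j with
  | zero => simp only [pre, Matrix.vecMul, dotProduct, first, Matrix.of_apply]; fun_prop
  | succ l ih =>
    simp only [pre, Matrix.vecMul, dotProduct, mid, Matrix.of_apply]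
    refine Differentiable.fun_sum fun i _ => (hσ.comp (ih i)).mul ?_
    split_ifs <;> fun_prop

lemma differentiable_network (x : Fin d₀ → ℝ) :
    Differentiable ℝ fun θ : ParamIdx L d₀ d → ℝ => network σ θ x := by
  simp only [network_eq, act, last]
  exact Differentiable.fun_sum fun i _ => (hσ.comp (differentiable_pre hσ x _ i)).mul (by fun_prop)

/-- Derivatives along lines are enough: since the network is differentiable, they determine the
Fréchet derivative in `fderiv_network`. -/
lemma hasDerivAt_pre (θ Δ : ParamIdx L d₀ d → ℝ) (x : Fin d₀ → ℝ) (l : ℕ) (j : Fin d) :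
    HasDerivAt (fun τ : ℝ => pre σ (θ + τ • Δ) x l j) (dpre σ θ Δ x l j) 0 := by
  induction l generalizing j with
  | zero =>
    simp only [pre, dpre, Matrix.vecMul, dotProduct, first, Matrix.of_apply, Pi.add_apply,
      Pi.smul_apply, smul_eq_mul]
    refine HasDerivAt.fun_sum fun i _ => ?_
    have := (((hasDerivAt_id (0 : ℝ)).mul_const (Δ (.inl (i, j)))).const_add
      (θ (.inl (i, j)))).const_mul (x i)
    simpa using this
  | succ l ih =>
    simp only [pre, dpre, Matrix.vecMul, dotProduct, mid_add, mid_smul, Pi.add_apply,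
      ← Finset.sum_add_distrib]
    refine HasDerivAt.fun_sum fun i _ => ?_
    have h1 : HasDerivAt (fun τ : ℝ => (mid θ l + τ • mid Δ l) i j) (mid Δ l i j) 0 := by
      simpa using ((hasDerivAt_id (0 : ℝ)).mul_const (mid Δ l i j)).const_add (mid θ l i j)
    have h2 : HasDerivAt (fun τ : ℝ => σ (pre σ (θ + τ • Δ) x l i))
        (deriv σ (pre σ θ x l i) * dpre σ θ Δ x l i) 0 := by
      have h3 := (hσ (pre σ (θ + (0 : ℝ) • Δ) x l i)).hasDerivAt
      simpa [Function.comp_def] using h3.comp (0 : ℝ) (ih i)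
    simpa [act] using h2.fun_mul h1

lemma hasDerivAt_network (θ Δ : ParamIdx L d₀ d → ℝ) (x : Fin d₀ → ℝ) :
    HasDerivAt (fun τ : ℝ => network σ (θ + τ • Δ) x)
      (∑ i, (dlt σ θ x (L - 2) i * dpre σ θ Δ x (L - 2) i + act σ θ x (L - 2) i * last Δ i)) 0 := by
  simp only [network_eq, act]
  refine HasDerivAt.fun_sum fun i _ => ?_
  have h1 : HasDerivAt (fun τ : ℝ => last (θ + τ • Δ) i) (last Δ i) 0 := by
    simpa [last] using
      ((hasDerivAt_id (0 : ℝ)).mul_const (last Δ i)).const_add (last θ i)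
  have h2 : HasDerivAt (fun τ : ℝ => σ (pre σ (θ + τ • Δ) x (L - 2) i))
      (deriv σ (pre σ θ x (L - 2) i) * dpre σ θ Δ x (L - 2) i) 0 := by
    have h3 := (hσ (pre σ (θ + (0 : ℝ) • Δ) x (L - 2) i)).hasDerivAt
    simpa [Function.comp_def] using h3.comp (0 : ℝ) (hasDerivAt_pre hσ θ Δ x _ i)
  refine (h2.fun_mul h1).congr_deriv ?_
  simp only [dlt, vee_top, zero_smul, add_zero]; ring

-- Reverse-mode differentiation. Pairing with `dlt` moves the recursion of `dpre` down one layer at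
-- a time, and each step releases the direct contribution of the weights of that layer.
omit hσ in
lemma sum_dlt_mul_dpre (θ Δ : ParamIdx L d₀ d → ℝ) (x : Fin d₀ → ℝ) (l : ℕ) (hl : l ≤ L - 2) :
    ∑ j, dlt σ θ x l j * dpre σ θ Δ x l j =
      ∑ i, ∑ j, first Δ i j * (x i * dlt σ θ x 0 j) +
        ∑ m ∈ Finset.range l, ∑ i, ∑ j, mid Δ m i j * (act σ θ x m i * dlt σ θ x (m + 1) j) := by
  induction l with
  | zero =>
    simp only [dpre, Matrix.vecMul, dotProduct, Finset.range_zero, Finset.sum_empty, add_zero,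
      Finset.mul_sum]
    rw [Finset.sum_comm]
    exact Finset.sum_congr rfl fun i _ => Finset.sum_congr rfl fun j _ => by ring
  | succ l ih =>
    rw [Finset.sum_range_succ, ← add_assoc, ← ih (by omega)]
    simp only [dpre, Pi.add_apply, mul_add, Finset.sum_add_distrib]
    congr 1
    · simp only [dlt, vee_of_lt σ θ x (show l < L - 2 by omega), Matrix.vecMul, Matrix.mulVec,
        dotProduct, Finset.mul_sum, Finset.sum_mul]
      rw [Finset.sum_comm]
      exact Finset.sum_congr rfl fun i _ => Finset.sum_congr rfl fun j _ => by ring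
    · simp only [Matrix.vecMul, dotProduct, Finset.mul_sum]
      rw [Finset.sum_comm]
      exact Finset.sum_congr rfl fun i _ => Finset.sum_congr rfl fun j _ => by ring

-- The middle layers are indexed by `Fin (L - 2)`, but the recursions run over ℕ; `G` is an
-- extension of the middle blocks to all natural indices.
omit hσ in
lemma sum_paramIdx (F : ParamIdx L d₀ d → ℝ) (G : ℕ → Fin d → Fin d → ℝ)
    (hG : ∀ l (h : l < L - 2) i j, F (.inr (.inl (⟨l, h⟩, i, j))) = G l i j) :
    ∑ p, F p = ∑ i, ∑ j, F (.inl (i, j)) + (∑ m ∈ Finset.range (L - 2), ∑ i, ∑ j, G m i j +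
      ∑ i, F (.inr (.inr i))) := by
  rw [Fintype.sum_sum_type, Fintype.sum_sum_type, Fintype.sum_prod_type, Fintype.sum_prod_type,
    Finset.sum_range]
  congr 2
  refine Finset.sum_congr rfl fun l _ => ?_
  rw [Fintype.sum_prod_type]
  exact Finset.sum_congr rfl fun i _ => Finset.sum_congr rfl fun j _ => hG _ l.2 i j

omit hσ in
lemma sum_mul_grad (θ Δ : ParamIdx L d₀ d → ℝ) (x : Fin d₀ → ℝ) :
    ∑ i, (dlt σ θ x (L - 2) i * dpre σ θ Δ x (L - 2) i + act σ θ x (L - 2) i * last Δ i) =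
      ∑ p, Δ p * grad σ θ x p := by
  rw [sum_paramIdx (fun p => Δ p * grad σ θ x p)
    (fun m i j => mid Δ m i j * (act σ θ x m i * dlt σ θ x (m + 1) j))
    (fun l h i j => by simp [mid_apply h, grad]), Finset.sum_add_distrib,
    sum_dlt_mul_dpre _ _ _ _ le_rfl, add_assoc]
  simp [grad, first, last, mul_comm]

lemma fderiv_network (θ Δ : ParamIdx L d₀ d → ℝ) (x : Fin d₀ → ℝ) :
    fderiv ℝ (fun θ' => network σ θ' x) θ Δ = ∑ p, Δ p * grad σ θ x p := by
  rw [← sum_mul_grad, ← (hasDerivAt_network hσ θ Δ x).deriv]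
  exact ((differentiable_network hσ x) θ).lineDeriv_eq_fderiv.symm

lemma jacobian_eq (X : Fin n → Fin d₀ → ℝ) (θ : ParamIdx L d₀ d → ℝ) :
    jacobian σ X θ = Matrix.of fun s p => grad σ θ (X s) p := by
  ext s p
  simp only [jacobian, Matrix.of_apply, fderiv_network hσ]
  simp [Pi.single_apply]

lemma wntk_apply (X : Fin n → Fin d₀ → ℝ) (a θ : ParamIdx L d₀ d → ℝ) (s t : Fin n) :
    wntk σ X a θ s t = (d : ℝ)⁻¹ * ∑ p, a p * (grad σ θ (X s) p * grad σ θ (X t) p) := by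
  simp only [wntk, jacobian_eq hσ, Matrix.smul_apply, smul_eq_mul, Matrix.mul_apply,
    Matrix.diagonal_apply, Matrix.transpose_apply, Matrix.of_apply]
  congr 1
  refine Finset.sum_congr rfl fun p _ => ?_
  simp; ring

lemma fderiv_loss (X : Fin n → Fin d₀ → ℝ) (Y : Fin n → ℝ) (θ : ParamIdx L d₀ d → ℝ)
    (p : ParamIdx L d₀ d) : fderiv ℝ (loss σ X Y) θ (Pi.single p 1) =
      ∑ s, (network σ θ (X s) - Y s) * grad σ θ (X s) p := by
  have h : HasFDerivAt (loss σ X Y) ((1 / 2 : ℝ) • ∑ s, ((2 : ℝ) * (network σ θ (X s) - Y s)) •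
      fderiv ℝ (fun θ' => network σ θ' (X s)) θ) θ := by
    unfold loss
    refine (HasFDerivAt.fun_sum fun s _ => ?_).const_mul (1 / 2 : ℝ)
    have := (((differentiable_network hσ (X s)) θ).hasFDerivAt.sub_const (Y s)).pow 2
    simpa using this
  rw [h.fderiv]
  simp only [smul_apply, sum_apply, fderiv_network hσ,
    smul_eq_mul, Finset.mul_sum]
  refine Finset.sum_congr rfl fun s _ => ?_
  simp [Pi.single_apply]
  ring

end Derivative

/-! ### Layerwise decomposition of the tangent kernel. -/

/-- The kernel of the units of a layer, contracted with the backward vectors, is the part of the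
tangent kernel that comes from the layers up to this one. -/
lemma dlt_kern_dlt (σ : ℝ → ℝ) (a θ : ParamIdx L d₀ d → ℝ) (x x' : Fin d₀ → ℝ) (l : ℕ)
    (hl : l ≤ L - 2) :
    ∑ j, dlt σ θ x l j * (kern σ a θ x x' l *ᵥ dlt σ θ x' l) j = (d : ℝ)⁻¹ *
      (∑ i, ∑ j, first a i j * ((x i * dlt σ θ x 0 j) * (x' i * dlt σ θ x' 0 j)) +
        ∑ m ∈ Finset.range l, ∑ i, ∑ j, mid a m i j *
          ((act σ θ x m i * dlt σ θ x (m + 1) j) * (act σ θ x' m i * dlt σ θ x' (m + 1) j))) := by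
  induction l with
  | zero =>
    simp only [kern, Matrix.mulVec_diagonal, Finset.range_zero, Finset.sum_empty, add_zero,
      Finset.mul_sum, Finset.sum_mul]
    rw [Finset.sum_comm]
    exact Finset.sum_congr rfl fun i _ => Finset.sum_congr rfl fun j _ => by ring
  | succ l ih =>
    rw [Finset.sum_range_succ, ← add_assoc, mul_add, ← ih (by omega)]
    simp only [kern, Matrix.add_mulVec, Pi.add_apply, mul_add, Finset.sum_add_distrib]
    congr 1
    -- The propagated summand of `kern`: both factors `mid θ l` are absorbed into the backward
    -- vectors, which descend from layer l + 1 to layer l.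
    · simp only [← Matrix.mulVec_mulVec, ← vee_of_lt σ θ x' (show l < L - 2 by omega)]
      have h1 : (Matrix.diagonal fun i => deriv σ (pre σ θ x' l i)) *ᵥ vee σ θ x' l =
          dlt σ θ x' l := by
        ext i; rw [Matrix.mulVec_diagonal, dlt]
      rw [h1]
      have h2 := Matrix.dotProduct_mulVec (dlt σ θ x (l + 1)) (mid θ l)ᵀ
        ((Matrix.diagonal fun i => deriv σ (pre σ θ x l i)) *ᵥ (kern σ a θ x x' l *ᵥ dlt σ θ x' l))
      rw [Matrix.vecMul_transpose, ← vee_of_lt σ θ x (show l < L - 2 by omega)] at h2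
      simp only [dotProduct] at h2
      rw [h2]
      refine Finset.sum_congr rfl fun i _ => ?_
      rw [Matrix.mulVec_diagonal, dlt]; ring
    · simp only [Matrix.mulVec_diagonal, Finset.mul_sum, Finset.sum_mul]
      rw [Finset.sum_comm]
      exact Finset.sum_congr rfl fun i _ => Finset.sum_congr rfl fun j _ => by ring

lemma wntk_eq {σ : ℝ → ℝ} (hσ : Differentiable ℝ σ) (X : Fin n → Fin d₀ → ℝ)
    (a θ : ParamIdx L d₀ d → ℝ) (s t : Fin n) :
    wntk σ X a θ s t = ∑ j, dlt σ θ (X s) (L - 2) j *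
        (kern σ a θ (X s) (X t) (L - 2) *ᵥ dlt σ θ (X t) (L - 2)) j +
      (d : ℝ)⁻¹ * ∑ i, last a i * (act σ θ (X s) (L - 2) i * act σ θ (X t) (L - 2) i) := by
  rw [wntk_apply hσ, dlt_kern_dlt _ _ _ _ _ _ le_rfl, ← mul_add, sum_paramIdx
    (fun p => a p * (grad σ θ (X s) p * grad σ θ (X t) p))
    (fun m i j => mid a m i j * ((act σ θ (X s) m i * dlt σ θ (X s) (m + 1) j) *
      (act σ θ (X t) m i * dlt σ θ (X t) (m + 1) j)))
    (fun l h i j => by simp [mid_apply h, grad]), add_assoc]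
  simp [grad, first, last]

/-! ### Hypotheses of the perturbation argument and first size estimates. -/

variable {L d₀ d n : ℕ}

/-- The activation function has a derivative bounded by `c` and Lipschitz with constant `c`. -/
structure Smooth (σ : ℝ → ℝ) (c : ℝ) : Prop where
  nonneg : 0 ≤ c
  diff : Differentiable ℝ σ
  bound : ∀ u, |deriv σ u| ≤ c
  lip : ∀ u v, |deriv σ u - deriv σ v| ≤ c * |u - v|

namespace Smooth
variable {σ : ℝ → ℝ} {c : ℝ} (hσ : Smooth σ c)
include hσ

lemma abs_sub_le (u v : ℝ) : |σ u - σ v| ≤ c * |u - v| := by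
  have := Convex.norm_image_sub_le_of_norm_deriv_le (f := σ) (s := Set.univ) (C := c)
    (fun x _ => hσ.diff x) (fun x _ => hσ.bound x) convex_univ (Set.mem_univ v) (Set.mem_univ u)
  simpa using this

/-- The difference quotient is the derivative at some point between u and v, and the derivative is
Lipschitz. The optimal constant c / 2 is not needed. -/
lemma abs_sub_sub_le (u v : ℝ) : |σ u - σ v - deriv σ v * (u - v)| ≤ c * (u - v) ^ 2 := by
  rcases eq_or_ne u v with rfl | huv
  · simp
  have key : ∃ w, |w - v| ≤ |u - v| ∧ σ u - σ v = deriv σ w * (u - v) := by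
    rcases lt_or_gt_of_ne huv with h | h
    · obtain ⟨w, hw, hw'⟩ := exists_deriv_eq_slope σ h hσ.diff.continuous.continuousOn
        hσ.diff.differentiableOn
      refine ⟨w, ?_, ?_⟩
      · rw [abs_of_nonpos (by linarith [hw.2]), abs_of_nonpos (by linarith)]; linarith [hw.1]
      · have : v - u ≠ 0 := by linarith [sub_pos.2 h] |> fun h' : v - u ≠ 0 => h'
        rw [hw']; field_simp; ring
    · obtain ⟨w, hw, hw'⟩ := exists_deriv_eq_slope σ h hσ.diff.continuous.continuousOn
        hσ.diff.differentiableOn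
      refine ⟨w, ?_, ?_⟩
      · rw [abs_of_nonneg (by linarith [hw.1]), abs_of_nonneg (by linarith)]; linarith [hw.2]
      · have : u - v ≠ 0 := sub_ne_zero.2 huv
        rw [hw']; field_simp
  obtain ⟨w, hw, hw'⟩ := key
  rw [hw', ← sub_mul, abs_mul]
  calc |deriv σ w - deriv σ v| * |u - v| ≤ (c * |w - v|) * |u - v| := by
        gcongr; exact hσ.lip _ _
    _ ≤ (c * |u - v|) * |u - v| := by gcongr; exact hσ.nonneg
    _ = c * (u - v) ^ 2 := by rw [← sq_abs]; ring

end Smooth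

/-- The change of the parameters in a combination of the weighted gradients at `θ`. -/
def lin (σ : ℝ → ℝ) (X : Fin n → Fin d₀ → ℝ) (a θ : ParamIdx L d₀ d → ℝ) (G : Fin n → ℝ)
    (p : ParamIdx L d₀ d) : ℝ :=
  (d : ℝ)⁻¹ * (a p * ∑ s, G s * grad σ θ (X s) p)

/-- The bounds at initialization on which the perturbation argument is based, `ε = d ^ (-1/4)`. -/
structure Init (σ : ℝ → ℝ) (X : Fin n → Fin d₀ → ℝ) (B K ε : ℝ)
    (a θ : ParamIdx L d₀ d → ℝ) : Prop where
  pos : 0 < ε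
  le_one : ε ≤ 1
  width : (d : ℝ) * ε ^ 4 = 1
  weight : ∀ p, |a p| ≤ B
  one_le : 1 ≤ K
  input : ∀ s, l2 (X s) ≤ K
  opB : ∀ l < L - 2, OpB (mid θ l) K
  act_le : ∀ s, ∀ l ≤ L - 2, ε ^ 2 * l2 (act σ θ (X s) l) ≤ K
  vee_le : ∀ s, ∀ l ≤ L - 2, ∑ j, vee σ θ (X s) l j ^ 4 ≤ (K * ε) ^ 4
  kern_le : ∀ s t, ∀ l ≤ L - 2,
    ∑ j, (kern σ a θ (X s) (X t) l *ᵥ dlt σ θ (X t) l) j ^ 4 ≤ (K * ε) ^ 4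

/-- The displacement `Δ` is a combination of the weighted gradients up to a small error. -/
structure Near (σ : ℝ → ℝ) (X : Fin n → Fin d₀ → ℝ) (B K Γ ε : ℝ)
    (a θ Δ : ParamIdx L d₀ d → ℝ) (G : Fin n → ℝ) (e : ParamIdx L d₀ d → ℝ) : Prop
    extends Init σ X B K ε a θ where
  eq : Δ = lin σ X a θ G + e
  err : l2 e ≤ ε ^ 3
  coeff : ∀ s, |G s| ≤ Γ

lemma l2_mul_outer {ι κ : Type*} [Fintype ι] [Fintype κ] (x : ι → ℝ) (y : κ → ℝ) :
    ∑ i, ∑ j, (x i * y j) ^ 2 = (l2 x * l2 y) ^ 2 := by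
  rw [mul_pow, l2_sq, l2_sq, Finset.sum_mul_sum]
  simp [mul_pow]

lemma l2_paramIdx_le (F : ParamIdx L d₀ d → ℝ) (G : ℕ → Fin d → Fin d → ℝ)
    (hG : ∀ l (h : l < L - 2) i j, F (.inr (.inl (⟨l, h⟩, i, j))) = G l i j)
    {b₀ b₁ b₂ : ℝ} (h0 : 0 ≤ b₀) (h1 : 0 ≤ b₁) (h2 : 0 ≤ b₂)
    (hb₀ : ∑ i, ∑ j, F (.inl (i, j)) ^ 2 ≤ b₀ ^ 2)
    (hb₁ : ∀ m < L - 2, ∑ i, ∑ j, G m i j ^ 2 ≤ b₁ ^ 2)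
    (hb₂ : ∑ i, F (.inr (.inr i)) ^ 2 ≤ b₂ ^ 2) : l2 F ≤ b₀ + L * b₁ + b₂ := by
  refine l2_le_of_sum_sq_le (by positivity) ?_
  rw [sum_paramIdx (fun p => F p ^ 2) (fun l i j => G l i j ^ 2) fun l h i j => by simp [hG l h]]
  have h3 : ∑ m ∈ Finset.range (L - 2), ∑ i, ∑ j, G m i j ^ 2 ≤ L * b₁ ^ 2 := by
    refine (Finset.sum_le_card_nsmul _ _ (b₁ ^ 2) fun m hm => hb₁ m (Finset.mem_range.1 hm)).trans ?_
    rw [Finset.card_range, nsmul_eq_mul]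
    gcongr; omega
  -- Crude, with L in place of √L, so that the final bound is a plain sum.
  have h4 : (L : ℝ) * b₁ ^ 2 ≤ (L * b₁) ^ 2 := by
    rcases Nat.eq_zero_or_pos L with h | h
    · simp [h]
    · have : (1 : ℝ) ≤ L := by exact_mod_cast h
      rw [mul_pow]
      nlinarith [sq_nonneg b₁, mul_nonneg (sub_nonneg.2 this) (sq_nonneg b₁)]
  have h5 : 0 ≤ (L : ℝ) * b₁ := by positivity
  nlinarith [mul_nonneg h0 h5, mul_nonneg h0 h2, mul_nonneg h5 h2]

lemma sum_mid_sq_le (φ : ParamIdx L d₀ d → ℝ) (l : ℕ) :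
    ∑ i, ∑ j, mid φ l i j ^ 2 ≤ l2 φ ^ 2 := by
  by_cases h : l < L - 2
  · rw [l2_sq, sum_paramIdx (fun p => φ p ^ 2) (fun m i j => mid φ m i j ^ 2)
      fun l h i j => by simp [mid_apply h]]
    have h1 := Finset.single_le_sum (f := fun m => ∑ i, ∑ j, mid φ m i j ^ 2)
      (fun m _ => Finset.sum_nonneg fun i _ => Finset.sum_nonneg fun j _ => sq_nonneg _)
      (Finset.mem_range.2 h)
    have h2 : 0 ≤ ∑ i, ∑ j, φ (.inl (i, j)) ^ 2 := by positivity
    have h3 : 0 ≤ ∑ i, φ (.inr (.inr i)) ^ 2 := by positivity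
    beta_reduce at h1
    linarith
  · have h0 : mid φ l = 0 := by ext i j; simp [mid, h]
    simp [h0, sq_nonneg]

lemma opB_mid (φ : ParamIdx L d₀ d → ℝ) (l : ℕ) : OpB (mid φ l) (l2 φ) :=
  opB_of_sum_sq_le (l2_nonneg _) (sum_mid_sq_le φ l)

lemma opB_first (φ : ParamIdx L d₀ d → ℝ) : OpB (first φ) (l2 φ) := by
  refine opB_of_sum_sq_le (l2_nonneg _) ?_
  rw [l2_sq, sum_paramIdx (fun p => φ p ^ 2) (fun m i j => mid φ m i j ^ 2)
    fun l h i j => by simp [mid_apply h]]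
  have h2 : 0 ≤ ∑ m ∈ Finset.range (L - 2), ∑ i, ∑ j, mid φ m i j ^ 2 := by positivity
  have h3 : 0 ≤ ∑ i, φ (.inr (.inr i)) ^ 2 := by positivity
  simp only [first, Matrix.of_apply]
  linarith

lemma l2_last_le (φ : ParamIdx L d₀ d → ℝ) : l2 (last φ) ≤ l2 φ := by
  refine l2_le_of_sum_sq_le (l2_nonneg _) ?_
  rw [l2_sq, sum_paramIdx (fun p => φ p ^ 2) (fun m i j => mid φ m i j ^ 2)
    fun l h i j => by simp [mid_apply h]]
  have h2 : 0 ≤ ∑ m ∈ Finset.range (L - 2), ∑ i, ∑ j, mid φ m i j ^ 2 := by positivity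
  have h3 : 0 ≤ ∑ i, ∑ j, φ (.inl (i, j)) ^ 2 := by positivity
  simp only [last]
  linarith

/-- Along a combination of the weighted gradients the pre-activations move by the kernels of
their layer applied to the backward vectors. -/
lemma dpre_lin (σ : ℝ → ℝ) (X : Fin n → Fin d₀ → ℝ) (a θ : ParamIdx L d₀ d → ℝ) (G : Fin n → ℝ)
    (x : Fin d₀ → ℝ) (l : ℕ) (hl : l ≤ L - 2) :
    dpre σ θ (lin σ X a θ G) x l =
      ∑ s, G s • (kern σ a θ x (X s) l *ᵥ dlt σ θ (X s) l) := by
  induction l with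
  | zero =>
    ext j
    simp only [dpre, kern, Matrix.mulVec_diagonal, Finset.sum_apply, Pi.smul_apply, smul_eq_mul,
      Matrix.vecMul, dotProduct, first, Matrix.of_apply, lin, grad, Finset.mul_sum, Finset.sum_mul]
    rw [Finset.sum_comm]
    exact Finset.sum_congr rfl fun s _ => Finset.sum_congr rfl fun i _ => by ring
  | succ l ih =>
    have hl' : l < L - 2 := by omega
    rw [dpre, ih (by omega)]
    -- The propagated summand of `kern` at layer l + 1: applied to `dlt` it first forms `mid θ l *ᵥ
    -- dlt`, which is `vee` one layer below, and the inductive hypothesis takes over. The diagonal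
    -- summand is the direct effect of the weights of this layer.
    have h1 : (fun i => deriv σ (pre σ θ x l i) *
        (∑ s, G s • (kern σ a θ x (X s) l *ᵥ dlt σ θ (X s) l)) i) ᵥ* mid θ l =
        ∑ s, G s • (((mid θ l)ᵀ * (Matrix.diagonal (fun i => deriv σ (pre σ θ x l i)) *
        kern σ a θ x (X s) l * Matrix.diagonal (fun i => deriv σ (pre σ θ (X s) l i))) * mid θ l) *ᵥ
          dlt σ θ (X s) (l + 1)) := by
      have h2 : ∀ s, (Matrix.diagonal fun i => deriv σ (pre σ θ (X s) l i)) *ᵥ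
          vee σ θ (X s) l = dlt σ θ (X s) l := fun s => by
        ext i; rw [Matrix.mulVec_diagonal, dlt]
      simp only [← Matrix.mulVec_mulVec, ← vee_of_lt σ θ _ hl', h2, ← Matrix.mulVec_smul,
        ← Matrix.mulVec_sum]
      rw [Matrix.mulVec_transpose]
      congr 1
      ext i
      rw [Matrix.mulVec_diagonal]
    rw [h1]
    simp only [kern, Matrix.add_mulVec, smul_add, Finset.sum_add_distrib]
    congr 1
    ext j
    simp only [Matrix.mulVec_diagonal, Finset.sum_apply, Pi.smul_apply, smul_eq_mul,
      Matrix.vecMul, dotProduct, mid_apply hl', lin, grad, Finset.mul_sum, Finset.sum_mul]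
    rw [Finset.sum_comm]
    exact Finset.sum_congr rfl fun s _ => Finset.sum_congr rfl fun i _ => by ring

lemma sum_pow_four_le_card {ι : Type*} (s : Finset ι) (f : ι → ℝ) :
    (∑ i ∈ s, f i) ^ 4 ≤ (s.card : ℝ) ^ 3 * ∑ i ∈ s, f i ^ 4 := by
  have h1 := sq_sum_le_card_mul_sum_sq (s := s) (f := f)
  have h2 := sq_sum_le_card_mul_sum_sq (s := s) (f := fun i => f i ^ 2)
  calc (∑ i ∈ s, f i) ^ 4 = ((∑ i ∈ s, f i) ^ 2) ^ 2 := by ring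
    _ ≤ (s.card * ∑ i ∈ s, f i ^ 2) ^ 2 := by gcongr
    _ = s.card ^ 2 * (∑ i ∈ s, f i ^ 2) ^ 2 := by ring
    _ ≤ s.card ^ 2 * (s.card * ∑ i ∈ s, (f i ^ 2) ^ 2) := by gcongr
    _ = _ := by simp only [← pow_mul]; ring

namespace Init
variable {σ : ℝ → ℝ} {c : ℝ} {X : Fin n → Fin d₀ → ℝ} {B K ε : ℝ}
  {a θ : ParamIdx L d₀ d → ℝ}

lemma sqrt_width (h : Init σ X B K ε a θ) : √(d : ℝ) * ε ^ 2 = 1 := by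
  have h1 : (d : ℝ) = (1 / ε ^ 2) ^ 2 := by
    have := h.width; have := h.pos; field_simp; linarith
  rw [h1, Real.sqrt_sq (by positivity)]
  have := h.pos; field_simp

/-- Spread-out vectors of ℓ⁴ size ε have Euclidean norm O(1), since √d · ε² = 1. -/
lemma l2_le (h : Init σ X B K ε a θ) {v : Fin d → ℝ} {C : ℝ} (hC : 0 ≤ C)
    (hv : ∑ j, v j ^ 4 ≤ (C * ε) ^ 4) : l2 v ≤ C := by
  have h1 := l2_le_of_sum_pow_four (mul_nonneg hC h.pos.le) hv
  rw [Fintype.card_fin, mul_pow, mul_left_comm, h.sqrt_width, mul_one] at h1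
  exact abs_le_of_sq_le_sq' h1 hC |>.2

lemma l2_vee_le (h : Init σ X B K ε a θ) (s : Fin n) {l : ℕ} (hl : l ≤ L - 2) :
    l2 (vee σ θ (X s) l) ≤ K := h.l2_le (by linarith [h.one_le]) (h.vee_le s l hl)

lemma l2_dlt_le (hσ : Smooth σ c) (h : Init σ X B K ε a θ) (s : Fin n) {l : ℕ} (hl : l ≤ L - 2) :
    l2 (dlt σ θ (X s) l) ≤ c * K := by
  refine (l2_le_of_abs_le (v := vee σ θ (X s) l) hσ.nonneg fun i => ?_).trans
    (mul_le_mul_of_nonneg_left (h.l2_vee_le s hl) hσ.nonneg)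
  rw [dlt, abs_mul]
  exact mul_le_mul_of_nonneg_right (hσ.bound _) (abs_nonneg _)

end Init

/-- The hidden blocks of the gradient are outer products of an activation vector, of norm O(ε⁻²),
and a backward vector, of norm O(1). The output block is an activation vector, and the first block
has an input in place of the activations. -/
lemma exists_grad_bound {σ : ℝ → ℝ} {c : ℝ} (hσ : Smooth σ c) (L : ℕ) (K : ℝ) (hK : 1 ≤ K) :
    ∃ C, 0 ≤ C ∧ ∀ {d₀ d n : ℕ} {X : Fin n → Fin d₀ → ℝ} {B ε : ℝ} {a θ : ParamIdx L d₀ d → ℝ},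
      Init σ X B K ε a θ → ∀ s, ε ^ 2 * l2 (grad σ θ (X s)) ≤ C := by
  have hc := hσ.nonneg
  refine ⟨K * (c * K) + L * (K * (c * K)) + K, by positivity, ?_⟩
  intro d₀ d n X B ε a θ h s
  have he : 0 ≤ ε ^ 2 := by have := h.pos; positivity
  have he1 : ε ^ 2 ≤ 1 := pow_le_one₀ h.pos.le h.le_one
  have h1 : ε ^ 2 * l2 (grad σ θ (X s)) = l2 (ε ^ 2 • grad σ θ (X s)) := by
    rw [l2_smul, abs_of_nonneg he]
  rw [h1]
  refine l2_paramIdx_le _ (fun l i j => (ε ^ 2 * act σ θ (X s) l i) * dlt σ θ (X s) (l + 1) j)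
    (fun l hl i j => by simp [grad, mul_assoc]) (by positivity) (by positivity) (by positivity)
    ?_ ?_ ?_
  · have : ∀ i j, (ε ^ 2 • grad σ θ (X s)) (.inl (i, j)) =
        X s i * (ε ^ 2 • dlt σ θ (X s) 0) j := fun i j => by simp [grad]; ring
    simp only [this, l2_mul_outer, l2_smul, abs_of_nonneg he]
    refine pow_le_pow_left₀ (mul_nonneg (l2_nonneg _) (mul_nonneg he (l2_nonneg _)))
      (mul_le_mul (h.input s) ?_ (mul_nonneg he (l2_nonneg _)) (by linarith)) 2
    exact (mul_le_of_le_one_left (l2_nonneg _) he1).trans (h.l2_dlt_le hσ s (Nat.zero_le _))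
  · intro m hm
    have : ∀ i, ε ^ 2 * act σ θ (X s) m i = (ε ^ 2 • act σ θ (X s) m) i := fun i => by simp
    simp only [this, l2_mul_outer, l2_smul, abs_of_nonneg he]
    gcongr
    · exact mul_nonneg (mul_nonneg he (l2_nonneg _)) (l2_nonneg _)
    · exact l2_nonneg _
    · exact h.act_le s m hm.le
    · exact h.l2_dlt_le hσ s hm
  · have := pow_le_pow_left₀ (mul_nonneg he (l2_nonneg _)) (h.act_le s (L - 2) le_rfl) 2
    rw [mul_pow, l2_sq, Finset.mul_sum] at this
    simpa [grad, mul_pow] using this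

/-- The prefactor 1/d = ε⁴ of `lin` meets gradients of norm O(ε⁻²), and the error ε³ is of lower
order. -/
lemma exists_near_bound {σ : ℝ → ℝ} {c : ℝ} (hσ : Smooth σ c) (L n : ℕ) (B K Γ : ℝ) (hK : 1 ≤ K)
    (hB : 0 ≤ B) (hΓ : 0 ≤ Γ) : ∃ C, 0 ≤ C ∧ ∀ {d₀ d : ℕ} {X : Fin n → Fin d₀ → ℝ} {ε : ℝ}
      {a θ Δ e : ParamIdx L d₀ d → ℝ} {G : Fin n → ℝ}, Near σ X B K Γ ε a θ Δ G e →
      l2 Δ ≤ C * ε ^ 2 := by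
  obtain ⟨C, hC, hC'⟩ := exists_grad_bound hσ L K hK
  refine ⟨B * (n * (Γ * C)) + 1, by positivity, ?_⟩
  intro d₀ d X ε a θ Δ e G h
  have he := h.pos
  have hd : (d : ℝ)⁻¹ = ε ^ 4 := by
    have := h.width
    have hd0 : (d : ℝ) ≠ 0 := fun h0 => by simp [h0] at this
    field_simp; linarith
  have h1 : l2 (lin σ X a θ G) ≤ (ε ^ 4 * B) * l2 (∑ s, G s • grad σ θ (X s)) := by
    refine l2_le_of_abs_le (by positivity) fun p => ?_
    simp only [lin, hd, Finset.sum_apply, Pi.smul_apply, smul_eq_mul, abs_mul,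
      abs_of_pos (pow_pos he 4), ← mul_assoc]
    gcongr
    exact h.weight p
  have h2 : ε ^ 2 * l2 (∑ s, G s • grad σ θ (X s)) ≤ n * (Γ * C) := by
    calc _ ≤ ε ^ 2 * ∑ s, l2 (G s • grad σ θ (X s)) := by gcongr; exact l2_sum_le _
      _ = ∑ s, |G s| * (ε ^ 2 * l2 (grad σ θ (X s))) := by
        rw [Finset.mul_sum]; exact Finset.sum_congr rfl fun s _ => by rw [l2_smul]; ring
      _ ≤ ∑ _s : Fin n, Γ * C := by
        refine Finset.sum_le_sum fun s _ => mul_le_mul (h.coeff s) (hC' h.toInit s) ?_ hΓ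
        exact mul_nonneg (by positivity) (l2_nonneg _)
      _ = _ := by simp
  rw [h.eq]
  calc l2 (lin σ X a θ G + e) ≤ l2 (lin σ X a θ G) + l2 e := l2_add_le _ _
    _ ≤ ε ^ 2 * B * (ε ^ 2 * l2 (∑ s, G s • grad σ θ (X s))) + ε ^ 3 :=
      add_le_add (h1.trans (by ring_nf; rfl)) h.err
    _ ≤ ε ^ 2 * B * (n * (Γ * C)) + ε ^ 2 := by
      gcongr ?_ + ?_
      · gcongr
      · exact pow_le_pow_of_le_one he.le h.le_one (by norm_num)
    _ = _ := by ring

/-! ### Stability of pre-activations, backward vectors and gradients near initialization. -/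

variable {L d₀ d n : ℕ}

lemma sum_pow_four_smul_le {n d : ℕ} (G : Fin n → ℝ) (u : Fin n → Fin d → ℝ) {Γ M : ℝ}
    (hG : ∀ s, |G s| ≤ Γ) (hu : ∀ s, ∑ j, u s j ^ 4 ≤ M ^ 4) :
    ∑ j, (∑ s, G s • u s) j ^ 4 ≤ (n * Γ * M) ^ 4 := by
  calc ∑ j, (∑ s, G s • u s) j ^ 4 ≤ ∑ j, (n : ℝ) ^ 3 * ∑ s, (G s * u s j) ^ 4 := by
        refine Finset.sum_le_sum fun j _ => ?_
        simpa using sum_pow_four_le_card Finset.univ fun s => G s * u s j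
    _ = (n : ℝ) ^ 3 * ∑ s, G s ^ 4 * ∑ j, u s j ^ 4 := by
        simp only [← Finset.mul_sum, mul_pow]
        rw [Finset.sum_comm]
        simp only [← Finset.mul_sum]
    _ ≤ (n : ℝ) ^ 3 * ∑ _s : Fin n, Γ ^ 4 * M ^ 4 := by
        refine mul_le_mul_of_nonneg_left (Finset.sum_le_sum fun s _ => ?_) (by positivity)
        have : G s ^ 4 = |G s| ^ 4 := (Even.pow_abs (by decide) _).symm
        rw [this]
        exact mul_le_mul (pow_le_pow_left₀ (abs_nonneg _) (hG s) 4) (hu s) (by positivity)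
          (pow_nonneg ((abs_nonneg _).trans (hG s)) 4)
    _ = _ := by simp; ring

lemma act_sub_bound {σ : ℝ → ℝ} {c : ℝ} (hσ : Smooth σ c) (θ θ' : ParamIdx L d₀ d → ℝ)
    (x : Fin d₀ → ℝ) (l : ℕ) :
    l2 (act σ θ' x l - act σ θ x l) ≤ c * l2 (pre σ θ' x l - pre σ θ x l) :=
  l2_le_of_abs_le hσ.nonneg fun _ => hσ.abs_sub_le _ _

/-- The linear part is a combination of the vectors whose fourth powers are controlled by `kern_le`;
the remainder is O(ε) in ℓ², hence in ℓ⁴. Thus the whole displacement is spread out. -/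
lemma Near.sum_pre_pow_four_le {σ : ℝ → ℝ} {B K Γ ε C : ℝ} {X : Fin n → Fin d₀ → ℝ}
    {a θ Δ e : ParamIdx L d₀ d → ℝ} {G : Fin n → ℝ} (hn : Near σ X B K Γ ε a θ Δ G e)
    (hΓ : 0 ≤ Γ) (hC : 0 ≤ C) {l : ℕ} (hl : l ≤ L - 2) (s : Fin n)
    (h : l2 (pre σ (θ + Δ) (X s) l - pre σ θ (X s) l - dpre σ θ (lin σ X a θ G) (X s) l) ≤ C * ε) :
    ∑ j, (pre σ (θ + Δ) (X s) l - pre σ θ (X s) l) j ^ 4 ≤ (2 * (n * Γ * K + C) * ε) ^ 4 := by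
  have he := hn.pos
  have hK := hn.one_le
  set T := dpre σ θ (lin σ X a θ G) (X s) l with hT
  set Z := pre σ (θ + Δ) (X s) l - pre σ θ (X s) l
  have h1 : ∑ j, T j ^ 4 ≤ (n * Γ * (K * ε)) ^ 4 := by
    rw [hT, dpre_lin σ X a θ G _ l hl]
    exact sum_pow_four_smul_le G _ hn.coeff fun t => hn.kern_le s t l hl
  have h2 : ∑ j, (Z - T) j ^ 4 ≤ (C * ε) ^ 4 :=
    (sum_pow_four_le _).trans (pow_le_pow_left₀ (l2_nonneg _) h 4)
  have h3 := sum_add_pow_four_le T (Z - T)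
  have h4 : 0 ≤ n * Γ * K := by positivity
  calc ∑ j, Z j ^ 4 = ∑ j, (T j + (Z - T) j) ^ 4 := by simp
    _ ≤ 8 * ((n * Γ * (K * ε)) ^ 4 + (C * ε) ^ 4) := by linarith
    -- 16 = 2⁴ accounts for the factor 2 in the constant.
    _ ≤ 16 * ((n * Γ * K + C) * ε) ^ 4 := by
      have e1 : (n * Γ * (K * ε)) ^ 4 ≤ ((n * Γ * K + C) * ε) ^ 4 :=
        pow_le_pow_left₀ (by positivity) (by nlinarith [mul_nonneg hC he.le]) 4
      have e2 : (C * ε) ^ 4 ≤ ((n * Γ * K + C) * ε) ^ 4 :=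
        pow_le_pow_left₀ (by positivity) (by gcongr; linarith) 4
      linarith
    _ = _ := by ring

/-- In the product rule the change of σ' meets the initial backward vector. Both have ℓ⁴ norm O(ε),
so Hölder gives the order ε² that the gradient estimate requires. -/
lemma Near.dlt_sub_le {σ : ℝ → ℝ} {c B K Γ ε C C₂ : ℝ} (hσ : Smooth σ c)
    {X : Fin n → Fin d₀ → ℝ} {a θ Δ e : ParamIdx L d₀ d → ℝ} {G : Fin n → ℝ}
    (hn : Near σ X B K Γ ε a θ Δ G e) (hC₂ : 0 ≤ C₂) {l : ℕ} (hl : l ≤ L - 2) (s : Fin n)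
    (hv : l2 (vee σ (θ + Δ) (X s) l - vee σ θ (X s) l) ≤ C * ε ^ 2)
    (hz : ∑ j, (pre σ (θ + Δ) (X s) l - pre σ θ (X s) l) j ^ 4 ≤ (C₂ * ε) ^ 4) :
    l2 (dlt σ (θ + Δ) (X s) l - dlt σ θ (X s) l) ≤ (c * C + c * (C₂ * K)) * ε ^ 2 := by
  have he := hn.pos
  have hc := hσ.nonneg
  have hK := hn.one_le
  set Z := pre σ (θ + Δ) (X s) l - pre σ θ (X s) l with hZ
  have e1 : dlt σ (θ + Δ) (X s) l - dlt σ θ (X s) l =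
      (fun i => deriv σ (pre σ (θ + Δ) (X s) l i) *
        (vee σ (θ + Δ) (X s) l - vee σ θ (X s) l) i) +
      fun i => (deriv σ (pre σ (θ + Δ) (X s) l i) - deriv σ (pre σ θ (X s) l i)) *
        vee σ θ (X s) l i := by
    ext i; simp [dlt]; ring
  have e2 : l2 (fun i => deriv σ (pre σ (θ + Δ) (X s) l i) *
        (vee σ (θ + Δ) (X s) l - vee σ θ (X s) l) i) ≤
        c * l2 (vee σ (θ + Δ) (X s) l - vee σ θ (X s) l) :=
    l2_le_of_abs_le hc fun i => by
      rw [abs_mul]; exact mul_le_mul_of_nonneg_right (hσ.bound _) (abs_nonneg _)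
  have e3 : l2 (fun i => (deriv σ (pre σ (θ + Δ) (X s) l i) -
      deriv σ (pre σ θ (X s) l i)) * vee σ θ (X s) l i) ≤
      c * l2 (fun i => Z i * vee σ θ (X s) l i) :=
    l2_le_of_abs_le hc fun i => by
      rw [abs_mul, abs_mul, ← mul_assoc]
      exact mul_le_mul_of_nonneg_right (hσ.lip _ _) (abs_nonneg _)
  have e4 : l2 (fun i => Z i * vee σ θ (X s) l i) ≤ (C₂ * ε) * (K * ε) :=
    l2_mul_le (by positivity) (by positivity) hz (hn.vee_le s l hl)
  rw [e1]
  calc _ ≤ c * (C * ε ^ 2) + c * ((C₂ * ε) * (K * ε)) := (l2_add_le _ _).trans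
        (add_le_add (e2.trans (mul_le_mul_of_nonneg_left hv hc))
          (e3.trans (mul_le_mul_of_nonneg_left e4 hc)))
    _ = _ := by ring

/-- The pre-activations near initialization are described by the linearization at initialization,
up to an error of Euclidean norm `O(ε)`. -/
lemma exists_pre_bound {σ : ℝ → ℝ} {c : ℝ} (hσ : Smooth σ c) (L n : ℕ) (B K Γ : ℝ) (hK : 1 ≤ K)
    (hB : 0 ≤ B) (hΓ : 0 ≤ Γ) (l : ℕ) (hl : l ≤ L - 2) :
    ∃ C, 0 ≤ C ∧ ∀ {d₀ d : ℕ} {X : Fin n → Fin d₀ → ℝ} {ε : ℝ}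
      {a θ Δ e : ParamIdx L d₀ d → ℝ} {G : Fin n → ℝ}, Near σ X B K Γ ε a θ Δ G e → ∀ s,
      l2 (pre σ (θ + Δ) (X s) l - pre σ θ (X s) l - dpre σ θ (lin σ X a θ G) (X s) l) ≤ C * ε ∧
      ∑ j, (pre σ (θ + Δ) (X s) l - pre σ θ (X s) l) j ^ 4 ≤ (C * ε) ^ 4 := by
  have hc := hσ.nonneg
  -- The fourth-power bound follows from the linearization error, so only the latter needs
  -- induction.
  suffices h : ∃ C, 0 ≤ C ∧ ∀ {d₀ d : ℕ} {X : Fin n → Fin d₀ → ℝ} {ε : ℝ}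
      {a θ Δ e : ParamIdx L d₀ d → ℝ} {G : Fin n → ℝ}, Near σ X B K Γ ε a θ Δ G e → ∀ s,
      l2 (pre σ (θ + Δ) (X s) l - pre σ θ (X s) l - dpre σ θ (lin σ X a θ G) (X s) l) ≤ C * ε by
    obtain ⟨C, hC, h⟩ := h
    refine ⟨2 * (n * Γ * K + C), by positivity, fun {d₀ d X ε a θ Δ e G} hn s => ⟨?_, ?_⟩⟩
    · refine (h hn s).trans (mul_le_mul_of_nonneg_right ?_ hn.pos.le)
      have : 0 ≤ n * Γ * K := by positivity
      linarith
    · exact hn.sum_pre_pow_four_le hΓ hC hl s (h hn s)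
  obtain ⟨C₁, hC₁, hΔ⟩ := exists_near_bound hσ L n B K Γ hK hB hΓ
  induction l with
  | zero =>
    refine ⟨K, by linarith, fun {d₀ d X ε a θ Δ e G} hn s => ?_⟩
    have he := hn.pos
    have h1 : pre σ (θ + Δ) (X s) 0 - pre σ θ (X s) 0 - dpre σ θ (lin σ X a θ G) (X s) 0 =
        X s ᵥ* first e := by
      simp only [pre, dpre, first_add, hn.eq, Matrix.vecMul_add]; abel
    rw [h1]
    calc l2 (X s ᵥ* first e) ≤ l2 e * l2 (X s) := (opB_first e).vecMul _
      _ ≤ ε ^ 3 * K := mul_le_mul hn.err (hn.input s) (l2_nonneg _) (by positivity)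
      _ ≤ K * ε := by
        rw [mul_comm]; gcongr; exact pow_le_of_le_one he.le hn.le_one (by norm_num)
  | succ l ih =>
    obtain ⟨C, hC, ih⟩ := ih (by omega)
    have hl' : l < L - 2 := by omega
    set M := 2 * (n * Γ * K + C) with hM
    have hM0 : 0 ≤ M := by positivity
    refine ⟨K * (c * M ^ 2 + c * C) + K + C₁ * (c * M), by positivity,
      fun {d₀ d X ε a θ Δ e G} hn s => ?_⟩
    have he := hn.pos
    have he1 := hn.le_one
    have hlin := ih hn s
    set h' := pre σ (θ + Δ) (X s) l with hh'
    set h₀ := pre σ θ (X s) l with hh₀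
    set T := dpre σ θ (lin σ X a θ G) (X s) l with hT
    have h4 : ∑ j, (h' - h₀) j ^ 4 ≤ (M * ε) ^ 4 :=
      hn.sum_pre_pow_four_le hΓ hC (by omega) s hlin
    set A := act σ (θ + Δ) (X s) l - act σ θ (X s) l with hA
    set DT : Fin d → ℝ := fun i => deriv σ (h₀ i) * T i with hDT
    -- Three errors: the nonlinearity and the inherited error sent through the initial weights; the
    -- error e acting on activations of norm O(ε⁻²); and a second-order term, the change of the
    -- activations times the change of the weights.
    have key : pre σ (θ + Δ) (X s) (l + 1) - pre σ θ (X s) (l + 1) -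
        dpre σ θ (lin σ X a θ G) (X s) (l + 1) =
        (A - DT) ᵥ* mid θ l + act σ θ (X s) l ᵥ* mid e l + A ᵥ* mid Δ l := by
      rw [pre_succ, pre_succ, dpre]
      have e1 : mid Δ l = mid (lin σ X a θ G) l + mid e l := by rw [hn.eq, mid_add]
      have e2 : act σ (θ + Δ) (X s) l = A + act σ θ (X s) l := by rw [hA]; abel
      rw [e2, mid_add]
      change _ - (DT ᵥ* mid θ l + _) = _
      simp only [e1, Matrix.add_vecMul, Matrix.vecMul_add, Matrix.sub_vecMul]
      abel
    have hAbound : l2 A ≤ c * M := by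
      refine (act_sub_bound hσ θ (θ + Δ) (X s) l).trans (mul_le_mul_of_nonneg_left ?_ hc)
      exact hn.l2_le hM0 h4
    have hADT : l2 (A - DT) ≤ (c * M ^ 2 + c * C) * ε := by
      have e1 : A - DT = (fun i => A i - deriv σ (h₀ i) * (h' - h₀) i) +
          fun i => deriv σ (h₀ i) * (h' - h₀ - T) i := by
        ext i; simp [hDT]; ring
      have e2 : l2 (fun i => A i - deriv σ (h₀ i) * (h' - h₀) i) ≤
          c * l2 (fun i => (h' - h₀) i ^ 2) :=
        l2_le_of_abs_le hc fun i => by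
          rw [abs_of_nonneg (sq_nonneg ((h' - h₀) i))]; exact hσ.abs_sub_sub_le (h' i) (h₀ i)
      have e3 : l2 (fun i => (h' - h₀) i ^ 2) ≤ (M * ε) ^ 2 :=
        l2_sq_le_of_sum_pow_four (by positivity) h4
      have e4 : l2 (fun i => deriv σ (h₀ i) * (h' - h₀ - T) i) ≤ c * l2 (h' - h₀ - T) :=
        l2_le_of_abs_le hc fun i => by
          rw [abs_mul]; exact mul_le_mul_of_nonneg_right (hσ.bound _) (abs_nonneg _)
      rw [e1]
      calc _ ≤ c * (M * ε) ^ 2 + c * (C * ε) := (l2_add_le _ _).trans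
            (add_le_add (e2.trans (by gcongr)) (e4.trans (by gcongr)))
        _ ≤ c * (M ^ 2 * ε) + c * (C * ε) := by
            rw [mul_pow]; gcongr; exact pow_le_of_le_one he.le he1 (by norm_num)
        _ = _ := by ring
    rw [key]
    have t1 : l2 ((A - DT) ᵥ* mid θ l) ≤ K * ((c * M ^ 2 + c * C) * ε) :=
      ((hn.opB l hl').vecMul _).trans (by gcongr)
    have t2 : l2 (act σ θ (X s) l ᵥ* mid e l) ≤ K * ε := by
      calc _ ≤ l2 e * l2 (act σ θ (X s) l) := (opB_mid e l).vecMul _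
        _ ≤ ε ^ 3 * l2 (act σ θ (X s) l) := mul_le_mul_of_nonneg_right hn.err (l2_nonneg _)
        _ = ε * (ε ^ 2 * l2 (act σ θ (X s) l)) := by ring
        _ ≤ ε * K := mul_le_mul_of_nonneg_left (hn.act_le s l hl'.le) he.le
        _ = _ := mul_comm _ _
    have t3 : l2 (A ᵥ* mid Δ l) ≤ C₁ * (c * M) * ε := by
      calc _ ≤ l2 Δ * l2 A := (opB_mid Δ l).vecMul _
        _ ≤ (C₁ * ε ^ 2) * (c * M) := mul_le_mul (hΔ hn) hAbound (l2_nonneg _) (by positivity)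
        _ ≤ (C₁ * ε) * (c * M) := by
          gcongr; exact pow_le_of_le_one he.le he1 (by norm_num)
        _ = _ := by ring
    calc _ ≤ K * ((c * M ^ 2 + c * C) * ε) + K * ε + C₁ * (c * M) * ε :=
          (l2_add_le _ _).trans (add_le_add ((l2_add_le _ _).trans (add_le_add t1 t2)) t3)
      _ = _ := by ring

/-- Induction downwards from the output, `k` being the number of layers above `l`. At the top the
change is that of the output weights, O(ε²), and each layer preserves this order by
`Near.dlt_sub_le`. -/
lemma exists_vee_bound {σ : ℝ → ℝ} {c : ℝ} (hσ : Smooth σ c) (L n : ℕ) (B K Γ : ℝ) (hK : 1 ≤ K)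
    (hB : 0 ≤ B) (hΓ : 0 ≤ Γ) (k l : ℕ) (hl : l + k = L - 2) :
    ∃ C, 0 ≤ C ∧ ∀ {d₀ d : ℕ} {X : Fin n → Fin d₀ → ℝ} {ε : ℝ}
      {a θ Δ e : ParamIdx L d₀ d → ℝ} {G : Fin n → ℝ}, Near σ X B K Γ ε a θ Δ G e → ∀ s,
      l2 (vee σ (θ + Δ) (X s) l - vee σ θ (X s) l) ≤ C * ε ^ 2 ∧
      l2 (dlt σ (θ + Δ) (X s) l - dlt σ θ (X s) l) ≤ C * ε ^ 2 := by
  have hc := hσ.nonneg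
  obtain ⟨C₂, hC₂, hpre⟩ := exists_pre_bound hσ L n B K Γ hK hB hΓ l (by omega)
  suffices h : ∃ C, 0 ≤ C ∧ ∀ {d₀ d : ℕ} {X : Fin n → Fin d₀ → ℝ} {ε : ℝ}
      {a θ Δ e : ParamIdx L d₀ d → ℝ} {G : Fin n → ℝ}, Near σ X B K Γ ε a θ Δ G e → ∀ s,
      l2 (vee σ (θ + Δ) (X s) l - vee σ θ (X s) l) ≤ C * ε ^ 2 by
    obtain ⟨C, hC, h⟩ := h
    refine ⟨C + (c * C + c * (C₂ * K)), by positivity, fun {d₀ d X ε a θ Δ e G} hn s => ⟨?_, ?_⟩⟩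
    · refine (h hn s).trans ?_
      gcongr
      have : 0 ≤ c * C + c * (C₂ * K) := by positivity
      linarith
    · refine (hn.dlt_sub_le hσ hC₂ (by omega) s (h hn s) (hpre hn s).2).trans ?_
      exact mul_le_mul_of_nonneg_right (by linarith) (by positivity)
  obtain ⟨C₁, hC₁, hΔ⟩ := exists_near_bound hσ L n B K Γ hK hB hΓ
  clear hpre
  induction k generalizing l with
  | zero =>
    obtain rfl : l = L - 2 := by omega
    refine ⟨C₁, hC₁, fun {d₀ d X ε a θ Δ e G} hn s => ?_⟩
    rw [vee_top, vee_top, last_add, add_sub_cancel_left]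
    exact (l2_last_le Δ).trans (hΔ hn)
  | succ k ih =>
    have hl' : l < L - 2 := by omega
    obtain ⟨C₂', hC₂', hpre⟩ := exists_pre_bound hσ L n B K Γ hK hB hΓ (l + 1) (by omega)
    obtain ⟨C, hC, ih⟩ := ih (l + 1) (by omega)
    set M := c * C + c * (C₂' * K) with hM
    have hM0 : 0 ≤ M := by positivity
    refine ⟨K * M + C₁ * (c * K) + C₁ * M, by positivity, fun {d₀ d X ε a θ Δ e G} hn s => ?_⟩
    have he := hn.pos
    have he1 := hn.le_one
    have hV := ih hn s
    have hD : l2 (dlt σ (θ + Δ) (X s) (l + 1) - dlt σ θ (X s) (l + 1)) ≤ M * ε ^ 2 :=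
      hn.dlt_sub_le hσ hC₂' (by omega) s hV (hpre hn s).2
    rw [vee_of_lt σ _ _ hl', vee_of_lt σ _ _ hl']
    set D := dlt σ (θ + Δ) (X s) (l + 1) - dlt σ θ (X s) (l + 1) with hDdef
    have key : mid (θ + Δ) l *ᵥ dlt σ (θ + Δ) (X s) (l + 1) - mid θ l *ᵥ dlt σ θ (X s) (l + 1) =
        mid θ l *ᵥ D + mid Δ l *ᵥ dlt σ θ (X s) (l + 1) + mid Δ l *ᵥ D := by
      have e2 : dlt σ (θ + Δ) (X s) (l + 1) = D + dlt σ θ (X s) (l + 1) := by rw [hDdef]; abel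
      rw [e2, mid_add]
      simp only [Matrix.add_mulVec, Matrix.mulVec_add]
      abel
    rw [key]
    have t1 : l2 (mid θ l *ᵥ D) ≤ K * (M * ε ^ 2) := ((hn.opB l hl').2 _).trans (by gcongr)
    have t2 : l2 (mid Δ l *ᵥ dlt σ θ (X s) (l + 1)) ≤ C₁ * (c * K) * ε ^ 2 := by
      calc _ ≤ l2 Δ * l2 (dlt σ θ (X s) (l + 1)) := (opB_mid Δ l).2 _
        _ ≤ (C₁ * ε ^ 2) * (c * K) :=
          mul_le_mul (hΔ hn) (hn.l2_dlt_le hσ s hl') (l2_nonneg _) (by positivity)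
        _ = _ := by ring
    have t3 : l2 (mid Δ l *ᵥ D) ≤ C₁ * M * ε ^ 2 := by
      calc _ ≤ l2 Δ * l2 D := (opB_mid Δ l).2 _
        _ ≤ (C₁ * ε ^ 2) * (M * ε ^ 2) := mul_le_mul (hΔ hn) hD (l2_nonneg _) (by positivity)
        _ ≤ (C₁ * 1) * (M * ε ^ 2) := by
          gcongr; exact pow_le_one₀ he.le he1
        _ = _ := by ring
    calc _ ≤ K * (M * ε ^ 2) + C₁ * (c * K) * ε ^ 2 + C₁ * M * ε ^ 2 :=
          (l2_add_le _ _).trans (add_le_add ((l2_add_le _ _).trans (add_le_add t1 t2)) t3)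
      _ = _ := by ring

/-- Near initialization the gradients of the outputs move by a bounded amount, while their norm
is of the order `√d`. -/
lemma exists_grad_sub_bound {σ : ℝ → ℝ} {c : ℝ} (hσ : Smooth σ c) (L n : ℕ) (B K Γ : ℝ)
    (hK : 1 ≤ K) (hB : 0 ≤ B) (hΓ : 0 ≤ Γ) :
    ∃ C, 0 ≤ C ∧ ∀ {d₀ d : ℕ} {X : Fin n → Fin d₀ → ℝ} {ε : ℝ}
      {a θ Δ e : ParamIdx L d₀ d → ℝ} {G : Fin n → ℝ}, Near σ X B K Γ ε a θ Δ G e → ∀ s,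
      l2 (grad σ (θ + Δ) (X s) - grad σ θ (X s)) ≤ C := by
  have hc := hσ.nonneg
  obtain ⟨C₁, hC₁, hpre⟩ : ∃ C, 0 ≤ C ∧ ∀ l ≤ L - 2, ∀ {d₀ d : ℕ} {X : Fin n → Fin d₀ → ℝ} {ε : ℝ}
      {a θ Δ e : ParamIdx L d₀ d → ℝ} {G : Fin n → ℝ}, Near σ X B K Γ ε a θ Δ G e → ∀ s,
      l2 (act σ (θ + Δ) (X s) l - act σ θ (X s) l) ≤ C := by
    -- There are finitely many layers, so the sum of their constants serves for all of them.
    choose! C hC h using exists_pre_bound hσ L n B K Γ hK hB hΓ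
    refine ⟨∑ l ∈ Finset.range (L - 2 + 1), c * C l, Finset.sum_nonneg fun l hl =>
      mul_nonneg hc (hC l (by have := Finset.mem_range.1 hl; omega)),
      fun l hl d₀ d X ε a θ Δ e G hn s => ?_⟩
    have h1 := (act_sub_bound hσ θ (θ + Δ) (X s) l).trans (mul_le_mul_of_nonneg_left
      (hn.l2_le (hC l hl) (h l hl hn s).2) hc)
    exact h1.trans (Finset.single_le_sum (f := fun l => c * C l) (fun l hl =>
      mul_nonneg hc (hC l (by have := Finset.mem_range.1 hl; omega)))
      (Finset.mem_range.2 (by omega)))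
  obtain ⟨C₂, hC₂, hdlt⟩ : ∃ C, 0 ≤ C ∧ ∀ l ≤ L - 2, ∀ {d₀ d : ℕ} {X : Fin n → Fin d₀ → ℝ} {ε : ℝ}
      {a θ Δ e : ParamIdx L d₀ d → ℝ} {G : Fin n → ℝ}, Near σ X B K Γ ε a θ Δ G e → ∀ s,
      l2 (dlt σ (θ + Δ) (X s) l - dlt σ θ (X s) l) ≤ C * ε ^ 2 := by
    choose! C hC h using fun l (hl : l ≤ L - 2) =>
      exists_vee_bound hσ L n B K Γ hK hB hΓ (L - 2 - l) l (by omega)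
    refine ⟨∑ l ∈ Finset.range (L - 2 + 1), C l, Finset.sum_nonneg fun l hl =>
      hC l (by have := Finset.mem_range.1 hl; omega),
      fun l hl d₀ d X ε a θ Δ e G hn s => ?_⟩
    refine (h l hl hn s).2.trans (mul_le_mul_of_nonneg_right ?_ (sq_nonneg _))
    exact Finset.single_le_sum (f := C) (fun l hl =>
      hC l (by have := Finset.mem_range.1 hl; omega)) (Finset.mem_range.2 (by omega))
  refine ⟨K * C₂ + L * (C₁ * (c * K + C₂) + K * C₂) + C₁, by positivity,
    fun {d₀ d X ε a θ Δ e G} hn s => ?_⟩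
  have he := hn.pos
  have he1 : ε ^ 2 ≤ 1 := pow_le_one₀ he.le hn.le_one
  refine l2_paramIdx_le _ (fun l i j => act σ (θ + Δ) (X s) l i * dlt σ (θ + Δ) (X s) (l + 1) j -
    act σ θ (X s) l i * dlt σ θ (X s) (l + 1) j) (fun l hl i j => by simp [grad])
    (by positivity) (by positivity) hC₁ ?_ ?_ ?_
  · have : ∀ i j, (grad σ (θ + Δ) (X s) - grad σ θ (X s)) (.inl (i, j)) =
        X s i * (dlt σ (θ + Δ) (X s) 0 - dlt σ θ (X s) 0) j := fun i j => by simp [grad]; ring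
    simp only [this, l2_mul_outer]
    refine pow_le_pow_left₀ (mul_nonneg (l2_nonneg _) (l2_nonneg _))
      (mul_le_mul (hn.input s) ?_ (l2_nonneg _) (by linarith)) 2
    exact (hdlt 0 (Nat.zero_le _) hn s).trans (mul_le_of_le_one_right hC₂ he1)
  · intro m hm
    set A := act σ (θ + Δ) (X s) m - act σ θ (X s) m with hA
    set D := dlt σ (θ + Δ) (X s) (m + 1) - dlt σ θ (X s) (m + 1) with hD
    have hAb : l2 A ≤ C₁ := hpre m hm.le hn s
    have hDb : l2 D ≤ C₂ * ε ^ 2 := hdlt (m + 1) hm hn s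
    have hδ : l2 (dlt σ (θ + Δ) (X s) (m + 1)) ≤ c * K + C₂ := by
      have e1 : dlt σ (θ + Δ) (X s) (m + 1) = dlt σ θ (X s) (m + 1) + D := by rw [hD]; abel
      rw [e1]
      exact (l2_add_le _ _).trans (add_le_add (hn.l2_dlt_le hσ s hm)
        (hDb.trans (mul_le_of_le_one_right hC₂ he1)))
    -- The change of an outer product as a sum of two outer products: O(1) · O(1) for the moved
    -- activations, and O(ε⁻²) · O(ε²) for the moved backward vector.
    have h1 : ∑ i, ∑ j, (act σ (θ + Δ) (X s) m i * dlt σ (θ + Δ) (X s) (m + 1) j -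
        act σ θ (X s) m i * dlt σ θ (X s) (m + 1) j) ^ 2 =
        l2 ((fun p : Fin d × Fin d => A p.1 * dlt σ (θ + Δ) (X s) (m + 1) p.2) +
          fun p : Fin d × Fin d => act σ θ (X s) m p.1 * D p.2) ^ 2 := by
      rw [l2_sq, Fintype.sum_prod_type]
      refine Finset.sum_congr rfl fun i _ => Finset.sum_congr rfl fun j _ => ?_
      simp only [hA, hD, Pi.add_apply, Pi.sub_apply]; ring
    have hprod : ∀ u v : Fin d → ℝ, l2 (fun p : Fin d × Fin d => u p.1 * v p.2) = l2 u * l2 v :=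
      fun u v => by
        have h2 := l2_mul_outer u v
        rw [← Fintype.sum_prod_type', ← l2_sq (fun p : Fin d × Fin d => u p.1 * v p.2)] at h2
        exact (pow_left_inj₀ (l2_nonneg _) (mul_nonneg (l2_nonneg _) (l2_nonneg _))
          two_ne_zero).1 h2
    rw [h1]
    refine pow_le_pow_left₀ (l2_nonneg _) ((l2_add_le _ _).trans ?_) 2
    rw [hprod, hprod]
    refine add_le_add (mul_le_mul hAb hδ (l2_nonneg _) hC₁) ?_
    calc l2 (act σ θ (X s) m) * l2 D ≤ l2 (act σ θ (X s) m) * (C₂ * ε ^ 2) :=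
          mul_le_mul_of_nonneg_left hDb (l2_nonneg _)
      _ = (ε ^ 2 * l2 (act σ θ (X s) m)) * C₂ := by ring
      _ ≤ K * C₂ := mul_le_mul_of_nonneg_right (hn.act_le s m hm.le) hC₂
  · have h1 := pow_le_pow_left₀ (l2_nonneg _) (hpre (L - 2) le_rfl hn s) 2
    rw [l2_sq] at h1
    simpa [grad] using h1

/-! ### The dynamics of gradient descent. -/

variable {L d₀ d n : ℕ}

lemma Init.inv_width {σ : ℝ → ℝ} {X : Fin n → Fin d₀ → ℝ} {B K ε : ℝ}
    {a θ : ParamIdx L d₀ d → ℝ} (h : Init σ X B K ε a θ) : (d : ℝ)⁻¹ = ε ^ 4 := by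
  have := h.width
  have hd0 : (d : ℝ) ≠ 0 := fun h0 => by simp [h0] at this
  field_simp; linarith

/-- Mean value theorem on the segment of a step. This is why later gradient bounds are needed on
whole segments and not only at the iterates. -/
lemma exists_network_sub_eq {σ : ℝ → ℝ} (hσ : Differentiable ℝ σ) (θ Δ : ParamIdx L d₀ d → ℝ)
    (x : Fin d₀ → ℝ) : ∃ τ ∈ Set.Ioo (0 : ℝ) 1, network σ (θ + Δ) x - network σ θ x =
      ∑ p, Δ p * grad σ (θ + τ • Δ) x p := by
  have hd : ∀ τ : ℝ, HasDerivAt (fun τ : ℝ => network σ (θ + τ • Δ) x)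
      (∑ p, Δ p * grad σ (θ + τ • Δ) x p) τ := fun τ => by
    have h1 := (differentiable_network hσ x (θ + τ • Δ)).hasFDerivAt
    have h2 : HasDerivAt (fun τ : ℝ => θ + τ • Δ) Δ τ := by
      simpa using ((hasDerivAt_id τ).smul_const Δ).const_add θ
    have h3 := h1.comp_hasDerivAt τ h2
    rwa [fderiv_network hσ] at h3
  obtain ⟨τ, hτ, h⟩ := exists_hasDerivAt_eq_slope (fun τ : ℝ => network σ (θ + τ • Δ) x) _
    zero_lt_one (fun τ _ => (hd τ).continuousAt.continuousWithinAt) (fun τ _ => hd τ)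
  exact ⟨τ, hτ, by rw [h]; simp⟩

/-- The kernel is ε⁴ times a bilinear form in gradients of size ε⁻²; a change O(1) of the gradients
changes it by O(ε²). -/
lemma abs_wntk_sub_le {σ : ℝ → ℝ} (hσ : Differentiable ℝ σ) {X : Fin n → Fin d₀ → ℝ}
    {B K ε C₀ C₁ : ℝ} {a θ θ' : ParamIdx L d₀ d → ℝ} (h : Init σ X B K ε a θ) (hB : 0 ≤ B)
    (hC₁ : 0 ≤ C₁) (h0 : ∀ s, ε ^ 2 * l2 (grad σ θ (X s)) ≤ C₀)
    (h1 : ∀ s, l2 (grad σ θ' (X s) - grad σ θ (X s)) ≤ C₁) (s t : Fin n) :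
    |wntk σ X a θ' s t - wntk σ X a θ s t| ≤ B * (C₁ * (2 * C₀ + C₁)) * ε ^ 2 := by
  have he := h.pos
  have he1 : ε ^ 2 ≤ 1 := pow_le_one₀ he.le h.le_one
  rw [wntk_apply hσ, wntk_apply hσ, h.inv_width, ← mul_sub, ← Finset.sum_sub_distrib, abs_mul,
    abs_of_pos (pow_pos he 4)]
  set g := fun s => grad σ θ (X s)
  set g' := fun s => grad σ θ' (X s)
  have e1 : ∑ p, (a p * (g' s p * g' t p) - a p * (g s p * g t p)) =
      ∑ p, (g' s - g s) p * (a p * g' t p) + ∑ p, (a p * g s p) * (g' t - g t) p := by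
    rw [← Finset.sum_add_distrib]
    exact Finset.sum_congr rfl fun p _ => by simp only [Pi.sub_apply]; ring
  have ha : ∀ v : ParamIdx L d₀ d → ℝ, l2 (fun p => a p * v p) ≤ B * l2 v := fun v =>
    l2_le_of_abs_le hB fun p => by
      rw [abs_mul]; exact mul_le_mul_of_nonneg_right (h.weight p) (abs_nonneg _)
  have hg' : ε ^ 2 * l2 (g' t) ≤ C₀ + C₁ := by
    have e2 : g' t = g t + (g' t - g t) := by abel
    rw [e2]
    calc ε ^ 2 * l2 (g t + (g' t - g t)) ≤ ε ^ 2 * (l2 (g t) + l2 (g' t - g t)) := by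
          gcongr; exact l2_add_le _ _
      _ ≤ C₀ + C₁ := by
          rw [mul_add]
          exact add_le_add (h0 t) ((mul_le_of_le_one_left (l2_nonneg _) he1).trans (h1 t))
  rw [e1]
  calc _ ≤ ε ^ 4 * (C₁ * (B * l2 (g' t)) + (B * l2 (g s)) * C₁) := by
        gcongr
        refine (abs_add_le _ _).trans (add_le_add ((abs_sum_mul_le _ _).trans ?_)
          ((abs_sum_mul_le _ _).trans ?_))
        · exact mul_le_mul (h1 s) (ha _) (l2_nonneg _) hC₁
        · exact mul_le_mul (ha _) (h1 t) (l2_nonneg _) (mul_nonneg hB (l2_nonneg _))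
    _ = B * C₁ * ε ^ 2 * (ε ^ 2 * l2 (g' t) + ε ^ 2 * l2 (g s)) := by ring
    _ ≤ B * C₁ * ε ^ 2 * ((C₀ + C₁) + C₀) := by
        gcongr
        exact h0 s
    _ = _ := by ring

lemma l2_le_of_forall_abs_le {u : Fin n → ℝ} {b : ℝ} (h : ∀ s, |u s| ≤ b) : l2 u ≤ n * b := by
  refine (l2_le_sum_abs u).trans ((Finset.sum_le_sum fun s _ => h s).trans ?_)
  simp

lemma l2_sum_smul_le {ι : Type*} [Fintype ι] {r : Fin n → ℝ} {v : Fin n → ι → ℝ} {C : ℝ}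
    (hv : ∀ s, l2 (v s) ≤ C) : l2 (∑ s, r s • v s) ≤ n * C * l2 r := by
  refine (l2_sum_le _).trans ?_
  calc ∑ s, l2 (r s • v s) ≤ ∑ _s : Fin n, l2 r * C := by
        refine Finset.sum_le_sum fun s _ => ?_
        rw [l2_smul]
        exact mul_le_mul (abs_le_l2 r s) (hv s) (l2_nonneg _) (l2_nonneg _)
    _ = _ := by simp; ring

lemma gradDescent_succ {σ : ℝ → ℝ} (hσ : Differentiable ℝ σ) (X : Fin n → Fin d₀ → ℝ)
    (Y : Fin n → ℝ) (η₀ : ℝ) (a θ₀ : ParamIdx L d₀ d → ℝ) (t : ℕ) :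
    gradDescent σ X Y η₀ a θ₀ (t + 1) = gradDescent σ X Y η₀ a θ₀ t +
      lin σ X a (gradDescent σ X Y η₀ a θ₀ t)
        (fun s => -η₀ * (network σ (gradDescent σ X Y η₀ a θ₀ t) (X s) - Y s)) := by
  ext p
  rw [gradDescent]
  beta_reduce
  rw [fderiv_loss hσ]
  simp only [Pi.add_apply, lin, mul_assoc, ← Finset.mul_sum]
  ring

/-- One step of gradient descent contracts the residual as long as the kernel is close to its
initial value. -/
lemma residual_step {σ : ℝ → ℝ} (hσ : Differentiable ℝ σ) {X : Fin n → Fin d₀ → ℝ}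
    {B K ε C₀ C₁ q η : ℝ} {a θ₀ θ : ParamIdx L d₀ d → ℝ} (h : Init σ X B K ε a θ₀) (hB : 0 ≤ B)
    (hη : 0 ≤ η) (hC₀ : 0 ≤ C₀) (hC₁ : 0 ≤ C₁) (h0 : ∀ s, ε ^ 2 * l2 (grad σ θ₀ (X s)) ≤ C₀)
    (hq : ∀ v, l2 (v - η • (wntk σ X a θ₀ *ᵥ v)) ≤ q * l2 v) (Y r : Fin n → ℝ)
    (hr : r = fun s => network σ θ (X s) - Y s)
    (h1 : ∀ τ ∈ Set.Icc (0 : ℝ) 1, ∀ s,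
      l2 (grad σ (θ + τ • lin σ X a θ (-η • r)) (X s) - grad σ θ₀ (X s)) ≤ C₁) :
    l2 (fun s => network σ (θ + lin σ X a θ (-η • r)) (X s) - Y s) ≤
      (q + (n * (η * (n * (B * (C₁ * (2 * C₀ + C₁))))) +
        n * (2 * C₁ * (η * B * (n * (C₀ + C₁))))) * ε ^ 2) * l2 r := by
  have he := h.pos
  have he1 : ε ^ 2 ≤ 1 := pow_le_one₀ he.le h.le_one
  set Δ := lin σ X a θ (-η • r) with hΔ
  have h10 : ∀ s, l2 (grad σ θ (X s) - grad σ θ₀ (X s)) ≤ C₁ := fun s => by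
    simpa using h1 0 (by simp) s
  have hgθ : ∀ s, ε ^ 2 * l2 (grad σ θ (X s)) ≤ C₀ + C₁ := fun s => by
    have e2 : grad σ θ (X s) = grad σ θ₀ (X s) + (grad σ θ (X s) - grad σ θ₀ (X s)) := by abel
    rw [e2]
    calc _ ≤ ε ^ 2 * (l2 (grad σ θ₀ (X s)) + l2 (grad σ θ (X s) - grad σ θ₀ (X s))) := by
          gcongr; exact l2_add_le _ _
      _ ≤ C₀ + C₁ := by
          rw [mul_add]
          exact add_le_add (h0 s) ((mul_le_of_le_one_left (l2_nonneg _) he1).trans (h10 s))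
  have hΔb : l2 Δ ≤ η * B * (n * (C₀ + C₁)) * ε ^ 2 * l2 r := by
    have e1 : l2 Δ ≤ (ε ^ 2 * (η * B)) * l2 (∑ s, r s • (ε ^ 2 • grad σ θ (X s))) := by
      refine l2_le_of_abs_le (by positivity) fun p => le_of_eq ?_ |>.trans
        (mul_le_mul_of_nonneg_right (mul_le_mul_of_nonneg_left
          (mul_le_mul_of_nonneg_left (h.weight p) hη) (by positivity)) (abs_nonneg _))
      have e2 : Δ p = -(ε ^ 2 * η * a p * (∑ s, r s • (ε ^ 2 • grad σ θ (X s))) p) := by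
        simp only [hΔ, lin, h.inv_width, Finset.sum_apply, Pi.smul_apply, smul_eq_mul,
          Finset.mul_sum, ← Finset.sum_neg_distrib]
        exact Finset.sum_congr rfl fun s _ => by ring
      rw [e2, abs_neg, abs_mul, abs_mul, abs_mul, abs_of_nonneg hη, abs_of_pos (pow_pos he 2)]
      ring
    refine e1.trans ?_
    have e3 := l2_sum_smul_le (r := r) (v := fun s => ε ^ 2 • grad σ θ (X s)) (C := C₀ + C₁)
      fun s => by rw [l2_smul, abs_of_pos (pow_pos he 2)]; exact hgθ s
    calc _ ≤ ε ^ 2 * (η * B) * (n * (C₀ + C₁) * l2 r) := by gcongr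
      _ = _ := by ring
  have hAdiff := abs_wntk_sub_le hσ h hB hC₁ h0 h10
  set E := wntk σ X a θ - wntk σ X a θ₀ with hE
  have hEr : l2 (E *ᵥ r) ≤ n * (n * (B * (C₁ * (2 * C₀ + C₁)))) * ε ^ 2 * l2 r := by
    have : ∀ s, |(E *ᵥ r) s| ≤ n * (B * (C₁ * (2 * C₀ + C₁)) * ε ^ 2 * l2 r) := fun s => by
      refine (Finset.abs_sum_le_sum_abs (fun t => E s t * r t) Finset.univ).trans ?_
      calc _ ≤ ∑ _t : Fin n, B * (C₁ * (2 * C₀ + C₁)) * ε ^ 2 * l2 r := by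
            refine Finset.sum_le_sum fun t _ => ?_
            rw [abs_mul]
            exact mul_le_mul (hAdiff s t) (abs_le_l2 r t) (abs_nonneg _) (by positivity)
        _ = _ := by simp
    calc _ ≤ n * (n * (B * (C₁ * (2 * C₀ + C₁)) * ε ^ 2 * l2 r)) := l2_le_of_forall_abs_le this
      _ = _ := by ring
  have hdot : ∀ s, ∑ p, Δ p * grad σ θ (X s) p = -η * (wntk σ X a θ *ᵥ r) s := fun s => by
    simp only [Matrix.mulVec, dotProduct, wntk_apply hσ, Finset.mul_sum, Finset.sum_mul, hΔ, lin,
      Pi.smul_apply, smul_eq_mul]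
    rw [Finset.sum_comm]
    exact Finset.sum_congr rfl fun t _ => Finset.sum_congr rfl fun p _ => by ring
  -- The error of linearizing the outputs at the current parameters. Gradients on the segment differ
  -- by at most 2C₁ and the step has norm O(ε²) times the residual, so the error is O(ε²) times the
  -- residual.
  set w : Fin n → ℝ := fun s => network σ (θ + Δ) (X s) - network σ θ (X s) -
    ∑ p, Δ p * grad σ θ (X s) p with hw
  have hwb : l2 w ≤ n * (2 * C₁ * (η * B * (n * (C₀ + C₁)) * ε ^ 2 * l2 r)) := by
    refine l2_le_of_forall_abs_le fun s => ?_
    obtain ⟨τ, hτ, hτ'⟩ := exists_network_sub_eq hσ θ Δ (X s)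
    have e1 : w s = ∑ p, (grad σ (θ + τ • Δ) (X s) - grad σ θ (X s)) p * Δ p := by
      rw [hw]; beta_reduce; rw [hτ', ← Finset.sum_sub_distrib]
      exact Finset.sum_congr rfl fun p _ => by simp only [Pi.sub_apply]; ring
    rw [e1]
    refine (abs_sum_mul_le _ _).trans (mul_le_mul ?_ hΔb (l2_nonneg _) (by positivity))
    have e2 : grad σ (θ + τ • Δ) (X s) - grad σ θ (X s) =
      (grad σ (θ + τ • Δ) (X s) - grad σ θ₀ (X s)) - (grad σ θ (X s) - grad σ θ₀ (X s)) := by abel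
    rw [e2]
    have := h1 τ ⟨hτ.1.le, hτ.2.le⟩ s
    linarith [l2_sub_le (grad σ (θ + τ • Δ) (X s) - grad σ θ₀ (X s))
      (grad σ θ (X s) - grad σ θ₀ (X s)), h10 s]
  -- A step with the kernel frozen at initialization, the drift of the kernel, and the linearization
  -- error.
  have key : (fun s => network σ (θ + Δ) (X s) - Y s) =
      (r - η • (wntk σ X a θ₀ *ᵥ r)) + (-η) • (E *ᵥ r) + w := by
    ext s
    simp only [hw, hdot, hE, Matrix.sub_mulVec, Pi.add_apply, Pi.sub_apply, Pi.smul_apply,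
      smul_eq_mul]
    rw [hr]; ring
  rw [key]
  calc _ ≤ q * l2 r + η * (n * (n * (B * (C₁ * (2 * C₀ + C₁)))) * ε ^ 2 * l2 r) +
        n * (2 * C₁ * (η * B * (n * (C₀ + C₁)) * ε ^ 2 * l2 r)) := by
        refine (l2_add_le _ _).trans (add_le_add ((l2_add_le _ _).trans
          (add_le_add (hq r) ?_)) hwb)
        rw [l2_smul, abs_neg, abs_of_nonneg hη]
        gcongr
    _ = _ := by ring

/-- **Stability of the kernel along gradient descent**, under bounds at initialization. -/
lemma exists_stability {σ : ℝ → ℝ} {c : ℝ} (hσ : Smooth σ c) (L n : ℕ) (B K R η q : ℝ)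
    (hK : 1 ≤ K) (hB : 0 ≤ B) (hR : 0 ≤ R) (hη : 0 ≤ η) (hq0 : 0 ≤ q) (hq1 : q < 1) :
    ∃ C, 0 ≤ C ∧ ∃ ε₀, 0 < ε₀ ∧ ∀ {d₀ d : ℕ} {X : Fin n → Fin d₀ → ℝ} {Y : Fin n → ℝ} {ε : ℝ}
      {a θ : ParamIdx L d₀ d → ℝ}, Init σ X B K ε a θ → ε ≤ ε₀ →
      l2 (fun s => network σ θ (X s) - Y s) ≤ R →
      (∀ v, l2 (v - η • (wntk σ X a θ *ᵥ v)) ≤ q * l2 v) → ∀ t s s',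
      |wntk σ X a θ s s' - wntk σ X a (gradDescent σ X Y η a θ t) s s'| ≤ C * ε ^ 2 := by
  -- Half of the gap 1 - q is given up to absorb the O(ε²) errors of each step.
  set q₁ := (1 + q) / 2 with hq₁
  have hq₁1 : 0 < 1 - q₁ := by linarith
  have hq₁0 : 0 ≤ q₁ := by linarith
  -- The total of the geometric series η R q₁^t, which bounds the accumulated coefficients.
  set Γ := η * R / (1 - q₁) with hΓ
  have hΓ0 : 0 ≤ Γ := by positivity
  obtain ⟨C₀, hC₀, hg0⟩ := exists_grad_bound hσ L K hK
  obtain ⟨C₁, hC₁, hg1⟩ := exists_grad_sub_bound hσ L n B K Γ hK hB hΓ0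
  set M := n * C₁ * B * Γ with hM
  have hM0 : 0 ≤ M := by positivity
  set Q := n * (η * (n * (B * (C₁ * (2 * C₀ + C₁))))) +
        n * (2 * C₁ * (η * B * (n * (C₀ + C₁)))) with hQ
  have hQ0 : 0 ≤ Q := by positivity
  -- The first threshold gives M ε⁴ ≤ ε³, as `Near` demands; the second gives q + Q ε² ≤ q₁.
  refine ⟨B * (C₁ * (2 * C₀ + C₁)), by positivity, min (1 / (M + 1)) ((1 - q) / 2 / (Q + 1)),
    lt_min (by positivity) (by have : 0 < 1 - q := by linarith
                               positivity), ?_⟩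
  intro d₀ d X Y ε a θ hI hε hR' hcontr
  have he := hI.pos
  have hεM : M * ε ≤ 1 := by
    have h1 : ε ≤ 1 / (M + 1) := hε.trans (min_le_left _ _)
    rw [le_div_iff₀ (by positivity)] at h1
    nlinarith
  have hεQ : Q * ε ^ 2 ≤ (1 - q) / 2 := by
    have h1 : ε ≤ (1 - q) / 2 / (Q + 1) := hε.trans (min_le_right _ _)
    rw [le_div_iff₀ (by positivity)] at h1
    have h2 : ε ^ 2 ≤ ε := pow_le_of_le_one he.le hI.le_one (by norm_num)
    nlinarith [mul_le_mul_of_nonneg_left h2 hQ0]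
  set θt := gradDescent σ X Y η a θ with hθt
  set r : ℕ → Fin n → ℝ := fun t s => network σ (θt t) (X s) - Y s with hr
  have hnear : ∀ (G : Fin n → ℝ) (e : ParamIdx L d₀ d → ℝ), (∀ s, |G s| ≤ Γ) →
      l2 e ≤ M * ε ^ 4 → ∀ s,
      l2 (grad σ (θ + (lin σ X a θ G + e)) (X s) - grad σ θ (X s)) ≤ C₁ := by
    intro G e hG he' s
    refine hg1 (Δ := lin σ X a θ G + e) (G := G) (e := e) ⟨hI, rfl, he'.trans ?_, hG⟩ s
    calc M * ε ^ 4 = (M * ε) * ε ^ 3 := by ring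
      _ ≤ 1 * ε ^ 3 := by gcongr
      _ = _ := one_mul _
  -- Induction invariant. The factors 1 - q₁^t are normalized partial geometric sums, so the bounds
  -- never exceed Γ and M ε⁴.
  have main : ∀ t, ∃ (G : Fin n → ℝ) (e : ParamIdx L d₀ d → ℝ),
      θt t = θ + (lin σ X a θ G + e) ∧ (∀ s, |G s| ≤ Γ * (1 - q₁ ^ t)) ∧
      l2 e ≤ M * (1 - q₁ ^ t) * ε ^ 4 ∧ l2 (r t) ≤ R * q₁ ^ t := by
    intro t
    induction t with
    | zero =>
      refine ⟨0, 0, ?_, by simp, by simp, by simpa [hr, hθt, gradDescent] using hR'⟩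
      have : lin σ X a θ 0 = 0 := by ext p; simp [lin]
      simp [this, hθt, gradDescent]
    | succ t ih =>
      obtain ⟨G, e, h1, h2, h3, h4⟩ := ih
      have hpow : 0 ≤ q₁ ^ t := by positivity
      have hpow1 : q₁ ^ (t + 1) ≤ 1 := pow_le_one₀ hq₁0 (by linarith)
      have hpow' : 0 ≤ q₁ ^ (t + 1) := by positivity
      set G' : Fin n → ℝ := -η • r t with hG'
      -- The step uses current gradients, whereas `Near` wants initial ones. The difference is O(1)
      -- per gradient times ε⁴ and goes into the error.
      set e' : ParamIdx L d₀ d → ℝ := lin σ X a (θt t) G' - lin σ X a θ G' with he'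
      have hstep : θt (t + 1) = θt t + lin σ X a (θt t) G' := gradDescent_succ hσ.diff X Y η a θ t
      have hΓη : Γ * (1 - q₁) = η * R := by rw [hΓ]; field_simp
      have hGτ : ∀ τ ∈ Set.Icc (0 : ℝ) 1, ∀ s, |(G + τ • G') s| ≤ Γ * (1 - q₁ ^ (t + 1)) := by
        intro τ hτ s
        have e1 : |(τ • G') s| ≤ η * R * q₁ ^ t := by
          simp only [hG', Pi.smul_apply, smul_eq_mul, abs_mul, abs_neg, abs_of_nonneg hη,
            abs_of_nonneg hτ.1]
          calc τ * (η * |r t s|) ≤ 1 * (η * (R * q₁ ^ t)) := by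
                gcongr
                · exact hτ.2
                · exact (abs_le_l2 _ s).trans h4
            _ = _ := by ring
        calc _ ≤ |G s| + |(τ • G') s| := abs_add_le _ _
          _ ≤ Γ * (1 - q₁ ^ t) + η * R * q₁ ^ t := add_le_add (h2 s) e1
          _ = _ := by rw [← hΓη]; ring
      have he'b : l2 e' ≤ M * (1 - q₁) * q₁ ^ t * ε ^ 4 := by
        have e0 : ∀ s, l2 (grad σ (θt t) (X s) - grad σ θ (X s)) ≤ C₁ := by
          rw [h1]
          refine hnear G e (fun s => (h2 s).trans ?_) (h3.trans ?_)
          · exact mul_le_of_le_one_right hΓ0 (by linarith)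
          · gcongr; exact mul_le_of_le_one_right hM0 (by linarith)
        have e1 : l2 e' ≤ (ε ^ 4 * B) *
            l2 (∑ s, G' s • (grad σ (θt t) (X s) - grad σ θ (X s))) := by
          refine l2_le_of_abs_le (by positivity) fun p => ?_
          have e2 : e' p = ε ^ 4 * a p *
              (∑ s, G' s • (grad σ (θt t) (X s) - grad σ θ (X s))) p := by
            simp only [he', lin, hI.inv_width, Finset.sum_apply, Pi.smul_apply, smul_eq_mul,
              Pi.sub_apply, mul_sub, Finset.sum_sub_distrib]
            ring
          rw [e2, abs_mul, abs_mul, abs_of_pos (pow_pos he 4)]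
          gcongr
          exact hI.weight p
        have e3 : l2 G' ≤ η * (R * q₁ ^ t) := by
          rw [hG', l2_smul, abs_neg, abs_of_nonneg hη]; gcongr
        calc l2 e' ≤ (ε ^ 4 * B) * (n * C₁ * (η * (R * q₁ ^ t))) := e1.trans (by
              gcongr
              exact (l2_sum_smul_le e0).trans (by gcongr))
          _ = (n * C₁ * B * (η * R)) * q₁ ^ t * ε ^ 4 := by ring
          _ = _ := by rw [← hΓη, hM]; ring
      have heτ : ∀ τ ∈ Set.Icc (0 : ℝ) 1, l2 (e + τ • e') ≤ M * (1 - q₁ ^ (t + 1)) * ε ^ 4 := by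
        intro τ hτ
        calc l2 (e + τ • e') ≤ l2 e + τ * l2 e' := by
              refine (l2_add_le _ _).trans ?_
              rw [l2_smul, abs_of_nonneg hτ.1]
          _ ≤ l2 e + 1 * l2 e' := by gcongr; exacts [l2_nonneg _, hτ.2]
          _ ≤ M * (1 - q₁ ^ t) * ε ^ 4 + 1 * (M * (1 - q₁) * q₁ ^ t * ε ^ 4) := by gcongr
          _ = _ := by ring
      have hdec : ∀ τ : ℝ, θt t + τ • lin σ X a (θt t) G' =
          θ + (lin σ X a θ (G + τ • G') + (e + τ • e')) := by
        intro τ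
        have e1 : lin σ X a θ (G + τ • G') = lin σ X a θ G + τ • lin σ X a θ G' := by
          ext p
          simp only [lin, Pi.add_apply, Pi.smul_apply, smul_eq_mul, add_mul,
            Finset.sum_add_distrib, mul_add, mul_assoc, ← Finset.mul_sum]
          ring
        rw [e1, he', smul_sub, h1]; abel
      refine ⟨G + (1 : ℝ) • G', e + (1 : ℝ) • e', ?_, hGτ 1 (by simp), heτ 1 (by simp), ?_⟩
      · rw [hstep, ← hdec 1, one_smul]
      · have h5 := residual_step hσ.diff (C₀ := C₀) (C₁ := C₁) hI hB hη hC₀ hC₁ (hg0 hI) hcontr Y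
          (r t) (θ := θt t) rfl (fun τ hτ s => by
            rw [hdec τ]
            refine hnear _ _ (fun s => (hGτ τ hτ s).trans ?_) ((heτ τ hτ).trans ?_) s
            · exact mul_le_of_le_one_right hΓ0 (by linarith)
            · gcongr; exact mul_le_of_le_one_right hM0 (by linarith))
        have h6 : r (t + 1) = fun s =>
          network σ (θt t + lin σ X a (θt t) (-η • r t)) (X s) - Y s := by
          rw [hr]; beta_reduce; rw [hstep]
        rw [h6]
        refine h5.trans ?_
        calc _ ≤ q₁ * l2 (r t) := by
              refine mul_le_mul_of_nonneg_right ?_ (l2_nonneg _)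
              linarith
          _ ≤ q₁ * (R * q₁ ^ t) := by gcongr
          _ = _ := by ring
  intro t s s'
  obtain ⟨G, e, h1, h2, h3, -⟩ := main t
  have hpow : 0 ≤ q₁ ^ t := by positivity
  rw [abs_sub_comm]
  refine abs_wntk_sub_le hσ.diff hI hB hC₁ (hg0 hI) (fun s => ?_) s s'
  rw [h1]
  refine hnear G e (fun s => (h2 s).trans ?_) (h3.trans ?_) s
  · exact mul_le_of_le_one_right hΓ0 (by linarith)
  · gcongr; exact mul_le_of_le_one_right hM0 (by linarith)

/-! ### Independence expressed by resampling coordinates. -/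

section Resample
open Classical in
/-- Replacing the coordinates in `S` of a vector with independent coordinates by those of an
independent copy does not change its law. -/
lemma measurePreserving_piecewise {ι : Type*} [Fintype ι] (m : ι → Measure ℝ)
    [∀ i, IsProbabilityMeasure (m i)] (S : Set ι) :
    MeasurePreserving (fun z : (ι → ℝ) × (ι → ℝ) => S.piecewise z.2 z.1)
      ((Measure.pi m).prod (Measure.pi m)) (Measure.pi m) := by
  have hmeas : Measurable fun z : (ι → ℝ) × (ι → ℝ) => S.piecewise z.2 z.1 := by
    refine measurable_pi_lambda _ fun p => ?_
    by_cases hp : p ∈ S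
    · simp only [Set.piecewise_eq_of_mem _ _ _ hp]; fun_prop
    · simp only [Set.piecewise_eq_of_notMem _ _ _ hp]; fun_prop
  refine ⟨hmeas, (Measure.pi_eq fun s hs => ?_).symm⟩
  rw [Measure.map_apply hmeas (MeasurableSet.univ_pi hs)]
  have h1 : (fun z : (ι → ℝ) × (ι → ℝ) => S.piecewise z.2 z.1) ⁻¹' Set.univ.pi s =
      (Set.univ.pi fun i => if i ∈ S then Set.univ else s i) ×ˢ
        (Set.univ.pi fun i => if i ∈ S then s i else Set.univ) := by
    ext z
    simp only [Set.mem_preimage, Set.mem_univ_pi, Set.mem_prod, ← forall_and]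
    refine forall_congr' fun i => ?_
    by_cases hi : i ∈ S <;> simp [hi]
  rw [h1, Measure.prod_prod, Measure.pi_pi, Measure.pi_pi, ← Finset.prod_mul_distrib]
  refine Finset.prod_congr rfl fun i _ => ?_
  by_cases hi : i ∈ S <;> simp [hi]

variable {ι κ : Type*} [Fintype ι] [Fintype κ] (m : ι → Measure ℝ) (m' : κ → Measure ℝ)
  [∀ i, IsProbabilityMeasure (m i)] [∀ i, IsProbabilityMeasure (m' i)]

open Classical in
/-- A conditional union bound: if, for every outcome in `G`, the event `A` has probability at most
`c` after resampling the coordinates in `S` and `T`, then `G ∩ A` has probability at most `c`. -/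
lemma measureReal_inter_le_of_resample (S : Set ι) (T : Set κ) {G A : Set ((ι → ℝ) × (κ → ℝ))}
    (hm : MeasurableSet (G ∩ A)) {c : ℝ} (hc : 0 ≤ c)
    (hG : ∀ x x' y y', (S.piecewise x' x, T.piecewise y' y) ∈ G → (x, y) ∈ G)
    (h : ∀ x y, (x, y) ∈ G → ((Measure.pi m).prod (Measure.pi m')).real
      {z | (S.piecewise z.1 x, T.piecewise z.2 y) ∈ A} ≤ c) :
    ((Measure.pi m).prod (Measure.pi m')).real (G ∩ A) ≤ c := by
  have hmp := (measurePreserving_piecewise m S).prod (measurePreserving_piecewise m' T)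
  set μ := Measure.pi m
  set ν := Measure.pi m'
  set f : ((ι → ℝ) × (ι → ℝ)) × ((κ → ℝ) × (κ → ℝ)) → ENNReal :=
    (Prod.map (fun z : (ι → ℝ) × (ι → ℝ) => S.piecewise z.2 z.1)
      (fun z : (κ → ℝ) × (κ → ℝ) => T.piecewise z.2 z.1) ⁻¹' (G ∩ A)).indicator 1 with hf
  have hpre := hmp.measurable hm
  have hfm : Measurable f := measurable_one.indicator hpre
  have h1 : (μ.prod ν) (G ∩ A) = ∫⁻ x, ∫⁻ x', ∫⁻ y, ∫⁻ y', f ((x, x'), (y, y')) ∂ν ∂ν ∂μ ∂μ := by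
    rw [← hmp.measure_preimage hm.nullMeasurableSet, ← lintegral_indicator_one hpre,
      lintegral_prod _ hfm.aemeasurable, lintegral_prod _ (by fun_prop)]
    refine lintegral_congr fun x => lintegral_congr fun x' => ?_
    rw [lintegral_prod _ (by fun_prop)]
  have h2 : (μ.prod ν) (G ∩ A) ≤ ENNReal.ofReal c := by
    rw [h1]
    -- With the fresh copies innermost, the inner integral is the conditional probability for a
    -- fixed (x, y); it vanishes when (x, y) is outside `G`.
    calc _ = ∫⁻ x, ∫⁻ y, ∫⁻ x', ∫⁻ y', f ((x, x'), (y, y')) ∂ν ∂μ ∂ν ∂μ := by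
          refine lintegral_congr fun x => ?_
          rw [lintegral_lintegral_swap]
          fun_prop
      _ ≤ ∫⁻ _, ∫⁻ _, ENNReal.ofReal c ∂ν ∂μ := by
          refine lintegral_mono fun x => lintegral_mono fun y => ?_
          have h3 : ∫⁻ x', ∫⁻ y', f ((x, x'), (y, y')) ∂ν ∂μ =
              ∫⁻ z, f ((x, z.1), (y, z.2)) ∂(μ.prod ν) := by
            rw [lintegral_prod _ (by fun_prop)]
          beta_reduce
          rw [h3]
          by_cases hxy : (x, y) ∈ G
          · have h4 := h x y hxy
            rw [measureReal_def] at h4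
            refine le_trans ?_ (ENNReal.le_ofReal_iff_toReal_le (measure_ne_top _ _) hc |>.2 h4)
            set D : Set ((ι → ℝ) × (κ → ℝ)) := (fun z => ((x, z.1), (y, z.2))) ⁻¹'
              (Prod.map (fun z : (ι → ℝ) × (ι → ℝ) => S.piecewise z.2 z.1)
                (fun z : (κ → ℝ) × (κ → ℝ) => T.piecewise z.2 z.1) ⁻¹' (G ∩ A)) with hD
            have hms : MeasurableSet D :=
              (by fun_prop : Measurable fun z : (ι → ℝ) × (κ → ℝ) => ((x, z.1), (y, z.2))) hpre
            calc _ = ∫⁻ z, D.indicator 1 z ∂(μ.prod ν) := rfl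
              _ ≤ _ := by
                rw [lintegral_indicator_one hms]
                exact measure_mono fun z hz => hz.2
          · have h4 : ∀ z : (ι → ℝ) × (κ → ℝ), f ((x, z.1), (y, z.2)) = 0 := fun z => by
              rw [hf, Set.indicator_of_notMem]
              intro hz
              exact hxy (hG _ _ _ _ hz.1)
            simp [h4]
      _ = _ := by simp
  exact ENNReal.toReal_le_of_le_ofReal hc h2

open Classical in
/-- Functions of disjoint sets of coordinates are independent. -/
lemma integral_mul_of_disjoint (S : Set ι) {F G : (ι → ℝ) → ℝ} (hF : Measurable F)
    (hG : Measurable G) (hFS : ∀ x x', F (S.piecewise x' x) = F x')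
    (hGS : ∀ x x', G (S.piecewise x' x) = G x) :
    ∫ x, F x * G x ∂(Measure.pi m) = (∫ x, F x ∂(Measure.pi m)) * ∫ x, G x ∂(Measure.pi m) := by
  have hmp := measurePreserving_piecewise m S
  conv_lhs => rw [← hmp.map_eq]
  rw [integral_map hmp.measurable.aemeasurable (by fun_prop)]
  simp only [hFS, hGS]
  rw [mul_comm, ← integral_prod_mul]
  exact integral_congr_ae (Filter.Eventually.of_forall fun z => mul_comm _ _)

open Classical in
/-- The second moment of a sum of centred functions of disjoint sets of coordinates. -/
lemma integral_sum_sq {τ : Type*} [Fintype τ] (Y : τ → (ι → ℝ) → ℝ)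
    (S : τ → Set ι) (hY : ∀ j, MemLp (Y j) 2 (Measure.pi m)) (hYm : ∀ j, Measurable (Y j))
    (hS : ∀ j x x', Y j ((S j).piecewise x' x) = Y j x')
    (hS' : ∀ j k, j ≠ k → ∀ x x', Y k ((S j).piecewise x' x) = Y k x)
    (h0 : ∀ j, ∫ x, Y j x ∂(Measure.pi m) = 0) :
    ∫ x, (∑ j, Y j x) ^ 2 ∂(Measure.pi m) = ∑ j, ∫ x, Y j x ^ 2 ∂(Measure.pi m) := by
  have hint : ∀ j k, Integrable (fun x => Y j x * Y k x) (Measure.pi m) := fun j k =>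
    (hY j).integrable_mul (hY k)
  simp only [sq, Finset.sum_mul_sum]
  rw [integral_finsetSum _ fun j _ => integrable_finsetSum _ fun k _ => hint j k]
  refine Finset.sum_congr rfl fun j _ => ?_
  rw [integral_finsetSum _ fun k _ => hint j k, Finset.sum_eq_single j _ (by simp)]
  intro k _ hk
  rw [integral_mul_of_disjoint m (S j) (hYm j) (hYm k) (hS j) (hS' j k hk.symm), h0, zero_mul]

end Resample

/-! ### Linear forms in independent Gaussians and Wick's formula. -/

section GaussianTools
variable {ι κ : Type*} [Fintype ι] [Fintype κ] [DecidableEq κ] (v : ι → NNReal)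

omit [DecidableEq κ] in
lemma posSemidef_gram (C : κ → ι → ℝ) :
    (Matrix.of fun s t => ∑ p, v p * (C s p * C t p) : Matrix κ κ ℝ).PosSemidef := by
  have : (Matrix.of fun s t => ∑ p, v p * (C s p * C t p) : Matrix κ κ ℝ) =
      (Matrix.of fun s p => √(v p) * C s p) * (Matrix.of fun s p => √(v p) * C s p)ᴴ := by
    ext s t
    simp only [Matrix.of_apply, Matrix.mul_apply, Matrix.conjTranspose_apply, star_trivial]
    refine Finset.sum_congr rfl fun p _ => ?_
    have := Real.mul_self_sqrt (NNReal.coe_nonneg (v p))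
    calc (v p : ℝ) * (C s p * C t p) = (√(v p) * √(v p)) * (C s p * C t p) := by rw [this]
      _ = _ := by ring
  rw [this]
  exact Matrix.posSemidef_self_mul_conjTranspose _

/-- Linear forms in independent centred Gaussians are jointly Gaussian. -/
lemma map_linear_eq_multivariateGaussian (C : κ → ι → ℝ) :
    (Measure.pi fun p => gaussianReal 0 (v p)).map
      (fun x => (WithLp.toLp 2 fun s => ∑ p, C s p * x p : EuclideanSpace ℝ κ)) =
      multivariateGaussian 0 (Matrix.of fun s t => ∑ p, v p * (C s p * C t p)) := by
  have hm : Measurable fun x : ι → ℝ =>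
      (WithLp.toLp 2 fun s => ∑ p, C s p * x p : EuclideanSpace ℝ κ) := by fun_prop
  have : IsProbabilityMeasure ((Measure.pi fun p => gaussianReal 0 (v p)).map
      (fun x => (WithLp.toLp 2 fun s => ∑ p, C s p * x p : EuclideanSpace ℝ κ))) :=
    Measure.isProbabilityMeasure_map hm.aemeasurable
  refine Measure.ext_of_charFun ?_
  ext t
  rw [charFun_multivariateGaussian (posSemidef_gram v C), charFun_apply,
    integral_map hm.aemeasurable (by fun_prop)]
  have h1 : ∀ x : ι → ℝ, Complex.exp (inner ℝ (WithLp.toLp 2 fun s => ∑ p, C s p * x p :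
      EuclideanSpace ℝ κ) t * Complex.I) =
      ∏ p, Complex.exp ((∑ s, C s p * t s : ℝ) * (x p : ℂ) * Complex.I) := fun x => by
    rw [← Complex.exp_sum, ← Finset.sum_mul]
    congr 2
    have h2 : (inner ℝ (WithLp.toLp 2 fun s => ∑ p, C s p * x p : EuclideanSpace ℝ κ) t : ℝ) =
        ∑ p, (∑ s, C s p * t s) * x p := by
      simp only [PiLp.inner_apply, RCLike.inner_apply, conj_trivial, Finset.mul_sum, Finset.sum_mul]
      rw [Finset.sum_comm]
      exact Finset.sum_congr rfl fun p _ => Finset.sum_congr rfl fun s _ => by ring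
    rw [h2]; push_cast; rfl
  simp only [h1]
  rw [integral_fintype_prod_eq_prod (f := fun p (y : ℝ) =>
    Complex.exp ((∑ s, C s p * t s : ℝ) * (y : ℂ) * Complex.I))]
  simp only [← charFun_apply_real, charFun_gaussianReal]
  rw [← Complex.exp_sum]
  congr 1
  simp only [inner_zero_right, mul_zero, zero_mul, Complex.ofReal_zero, zero_sub]
  have h3 : (t.ofLp ⬝ᵥ (Matrix.of fun s u => ∑ p, (v p : ℝ) * (C s p * C u p)) *ᵥ t.ofLp : ℝ) =
      ∑ p, (v p : ℝ) * (∑ s, C s p * t.ofLp s) ^ 2 := by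
    simp only [dotProduct, Matrix.mulVec, Matrix.of_apply, sq, Finset.mul_sum,
      Finset.sum_mul]
    rw [Finset.sum_comm]
    conv_lhs => enter [2, s]; rw [Finset.sum_comm]
    rw [Finset.sum_comm]
    exact Finset.sum_congr rfl fun p _ => Finset.sum_comm.trans (Finset.sum_congr rfl fun s _ =>
      Finset.sum_congr rfl fun u _ => by ring)
  rw [h3]
  push_cast
  rw [Finset.sum_div, Finset.sum_neg_distrib]

/-- A linear form in independent centred Gaussians is Gaussian. -/
lemma map_linear_eq_gaussianReal (c : ι → ℝ) :
    (Measure.pi fun p => gaussianReal 0 (v p)).map (fun x => ∑ p, c p * x p) =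
      gaussianReal 0 (∑ p, v p * c p ^ 2).toNNReal := by
  have h1 := map_linear_eq_multivariateGaussian v fun (_ : Unit) => c
  have h2 := measurePreserving_eval_multivariateGaussian (μ := 0)
    (posSemidef_gram v fun (_ : Unit) => c) (i := ())
  rw [← h1] at h2
  have h3 := h2.map_eq
  rw [Measure.map_map h2.measurable (by fun_prop)] at h3
  simpa [Function.comp_def, sq] using h3

lemma measurable_linear (c : ι → ℝ) : Measurable fun x : ι → ℝ => ∑ p, c p * x p := by fun_prop

lemma memLp_linear (c : ι → ℝ) (q : NNReal) :
    MemLp (fun x => ∑ p, c p * x p) q (Measure.pi fun p => gaussianReal 0 (v p)) := by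
  have h := memLp_id_gaussianReal (μ := 0) (v := (∑ p, v p * c p ^ 2 : ℝ).toNNReal) q
  rw [← map_linear_eq_gaussianReal, memLp_map_measure_iff (by fun_prop)
    (measurable_linear c).aemeasurable] at h
  exact h

lemma integrable_linear_pow (c : ι → ℝ) (k : ℕ) :
    Integrable (fun x => (∑ p, c p * x p) ^ k) (Measure.pi fun p => gaussianReal 0 (v p)) := by
  have h := (memLp_linear v c k).integrable_norm_pow'
  refine (integrable_norm_iff ((measurable_linear c).pow_const k).aestronglyMeasurable).1 ?_
  simpa using h

/-- The moment is the fourth derivative at 0 of the moment generating function exp(w t² / 2). Each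
derivative has the form P(t) exp(w t² / 2), with P replaced by P' + w t P. -/
lemma integral_pow_four_gaussianReal (w : NNReal) :
    ∫ x, x ^ 4 ∂(gaussianReal 0 w) = 3 * (w : ℝ) ^ 2 := by
  have h := iteratedDeriv_mgf_zero (X := id) (μ := gaussianReal 0 w) (by simp) 4
  rw [mgf_id_gaussianReal] at h
  simp only [zero_mul, zero_add] at h
  have hd : ∀ (P P' : ℝ → ℝ), (∀ t, HasDerivAt P (P' t) t) → (deriv fun t : ℝ =>
      P t * Real.exp (w * t ^ 2 / 2)) = fun t => (P' t + P t * (w * t)) *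
        Real.exp (w * t ^ 2 / 2) := by
    intro P P' hP
    ext t
    have h1 : HasDerivAt (fun t : ℝ => (w : ℝ) * t ^ 2 / 2) (w * t) t := by
      have := (((hasDerivAt_id' t).fun_mul (hasDerivAt_id' t)).const_mul (w : ℝ)).div_const 2
      exact (this.congr_of_eventuallyEq (Filter.Eventually.of_forall fun y => by ring)).congr_deriv
        (by ring)
    rw [((hP t).fun_mul h1.exp).deriv]; ring
  have h0 : (fun t : ℝ => Real.exp (w * t ^ 2 / 2)) =
      fun t => (1 : ℝ) * Real.exp (w * t ^ 2 / 2) := by simp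
  have e1 := hd (fun _ => 1) (fun _ => 0) fun t => hasDerivAt_const t 1
  have e2 := hd (fun t => 0 + 1 * (w * t)) (fun _ => w) fun t => by
    simpa using (hasDerivAt_id t).const_mul (w : ℝ)
  have e3 := hd (fun t => w + (0 + 1 * (w * t)) * (w * t)) (fun t => 2 * w ^ 2 * t) fun t => by
    have := (((hasDerivAt_id' t).fun_mul (hasDerivAt_id' t)).const_mul ((w : ℝ) ^ 2)).const_add
      (w : ℝ)
    exact (this.congr_of_eventuallyEq (Filter.Eventually.of_forall fun y => by ring)).congr_deriv
      (by ring)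
  have e4 := hd (fun t => 2 * w ^ 2 * t + (w + (0 + 1 * (w * t)) * (w * t)) * (w * t))
    (fun t => 3 * w ^ 2 + 3 * w ^ 3 * t ^ 2) fun t => by
    have := ((hasDerivAt_id' t).const_mul (3 * (w : ℝ) ^ 2)).fun_add
      (((hasDerivAt_id' t).fun_mul ((hasDerivAt_id' t).fun_mul (hasDerivAt_id' t))).const_mul
        ((w : ℝ) ^ 3))
    exact (this.congr_of_eventuallyEq (Filter.Eventually.of_forall fun y => by ring)).congr_deriv
      (by ring)
  rw [h0, iteratedDeriv_eq_iterate] at h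
  simp only [Function.iterate_succ, Function.iterate_zero, Function.comp_apply, id_eq] at h
  rw [e1, e2, e3, e4] at h
  simpa using h.symm

lemma integral_linear_pow_four (c : ι → ℝ) :
    ∫ x, (∑ p, c p * x p) ^ 4 ∂(Measure.pi fun p => gaussianReal 0 (v p)) =
      3 * (∑ p, v p * c p ^ 2) ^ 2 := by
  have h := integral_pow_four_gaussianReal (∑ p, v p * c p ^ 2 : ℝ).toNNReal
  rw [← map_linear_eq_gaussianReal, integral_map (measurable_linear c).aemeasurable (by fun_prop)] at h
  rw [h, Real.coe_toNNReal _ (Finset.sum_nonneg fun p _ => by positivity)]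

lemma integral_linear_sq (c : ι → ℝ) :
    ∫ x, (∑ p, c p * x p) ^ 2 ∂(Measure.pi fun p => gaussianReal 0 (v p)) =
      ∑ p, v p * c p ^ 2 := by
  have h := variance_id_gaussianReal (μ := 0) (v := (∑ p, v p * c p ^ 2 : ℝ).toNNReal)
  rw [variance_eq_integral (by fun_prop)] at h
  simp only [id_eq, integral_id_gaussianReal, sub_zero] at h
  rw [← map_linear_eq_gaussianReal, integral_map (measurable_linear c).aemeasurable (by fun_prop)] at h
  rw [h, Real.coe_toNNReal _ (Finset.sum_nonneg fun p _ => by positivity)]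

/-- **Wick's formula** for four linear forms. -/
lemma integral_linear_mul_four (a b c e : ι → ℝ) :
    ∫ x, (∑ p, a p * x p) * (∑ p, b p * x p) * (∑ p, c p * x p) * (∑ p, e p * x p)
        ∂(Measure.pi fun p => gaussianReal 0 (v p)) =
      (∑ p, v p * (a p * b p)) * (∑ p, v p * (c p * e p)) +
      (∑ p, v p * (a p * c p)) * (∑ p, v p * (b p * e p)) +
      (∑ p, v p * (a p * e p)) * (∑ p, v p * (b p * c p)) := by
  set T : Finset ℝ := {1, -1} with hT
  have hsum : ∀ f : ℝ → ℝ, ∑ s ∈ T, f s = f 1 + f (-1) := fun f =>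
    Finset.sum_pair (by norm_num)
  -- Polarization over the signs of the last three forms: of a fourth power only the mixed monomial
  -- survives, with coefficient 4! from the multinomial and 8 from the signs, so 192.
  have h1 : ∀ x : ι → ℝ, (∑ p, a p * x p) * (∑ p, b p * x p) * (∑ p, c p * x p) *
      (∑ p, e p * x p) = 1 / 192 * ∑ s ∈ T, ∑ t ∈ T, ∑ u ∈ T, s * t * u *
        (∑ p, (a + s • b + t • c + u • e) p * x p) ^ 4 := fun x => by
    simp only [Pi.add_apply, Pi.smul_apply, smul_eq_mul, add_mul, Finset.sum_add_distrib, mul_assoc,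
      ← Finset.mul_sum, hsum]
    ring
  have h2 : ∀ s t u : ℝ, ∑ p, (v p : ℝ) * (a + s • b + t • c + u • e) p ^ 2 =
      ∑ p, v p * (a p * a p) + s ^ 2 * ∑ p, v p * (b p * b p) + t ^ 2 * ∑ p, v p * (c p * c p) +
      u ^ 2 * ∑ p, v p * (e p * e p) + 2 * s * ∑ p, v p * (a p * b p) +
      2 * t * ∑ p, v p * (a p * c p) + 2 * u * ∑ p, v p * (a p * e p) +
      2 * s * t * ∑ p, v p * (b p * c p) + 2 * s * u * ∑ p, v p * (b p * e p) +
      2 * t * u * ∑ p, v p * (c p * e p) := fun s t u => by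
    simp only [Finset.mul_sum, ← Finset.sum_add_distrib, Pi.add_apply, Pi.smul_apply, smul_eq_mul]
    exact Finset.sum_congr rfl fun p _ => by ring
  simp only [h1]
  rw [integral_const_mul]
  rw [integral_finsetSum _ fun s _ => integrable_finsetSum _ fun t _ => integrable_finsetSum _
    fun u _ => (integrable_linear_pow v _ 4).const_mul _]
  simp_rw [integral_finsetSum _ fun t _ => integrable_finsetSum _
    fun u _ => (integrable_linear_pow v _ 4).const_mul _]
  simp_rw [integral_finsetSum _ fun u _ => (integrable_linear_pow v _ 4).const_mul _,
    integral_const_mul, integral_linear_pow_four, h2, hsum]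
  ring


end GaussianTools

/-! ### Quadratic forms in independent Gaussians. -/

section GaussianTools
variable {ι κ : Type*} [Fintype ι] [Fintype κ] (v : ι → NNReal)

lemma linear_single [DecidableEq ι] (p : ι) (x : ι → ℝ) :
    ∑ q, (Pi.single p 1 : ι → ℝ) q * x q = x p := by
  simp [Pi.single_apply]

lemma memLp_eval (p : ι) (q : NNReal) :
    MemLp (fun x : ι → ℝ => x p) q (Measure.pi fun p => gaussianReal 0 (v p)) := by
  classical
  have h := memLp_linear v (Pi.single p 1) q
  simpa only [linear_single] using h

lemma holderTriple_four : ENNReal.HolderTriple ((4 : NNReal) : ENNReal) ((4 : NNReal) : ENNReal) 2 := by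
  refine ⟨?_⟩
  have h : ((4 : NNReal) : ENNReal)⁻¹ = ((4⁻¹ : NNReal) : ENNReal) := by
    rw [ENNReal.coe_inv (by norm_num)]
  have h2 : (2 : ENNReal)⁻¹ = ((2⁻¹ : NNReal) : ENNReal) := by
    rw [ENNReal.coe_inv (by norm_num)]; rfl
  rw [h, h2, ← ENNReal.coe_add]
  norm_num

lemma integrable_mul_four (p q r s : ι) : Integrable (fun x : ι → ℝ => x p * x q * x r * x s)
    (Measure.pi fun p => gaussianReal 0 (v p)) := by
  have h : MemLp (fun x : ι → ℝ => x p * x q) 2 (Measure.pi fun p => gaussianReal 0 (v p)) :=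
    (memLp_eval v q 4).mul' (memLp_eval v p 4) (hpqr := holderTriple_four)
  have h' : MemLp (fun x : ι → ℝ => x r * x s) 2 (Measure.pi fun p => gaussianReal 0 (v p)) :=
    (memLp_eval v s 4).mul' (memLp_eval v r 4) (hpqr := holderTriple_four)
  refine (h.integrable_mul h').congr (Filter.Eventually.of_forall fun x => ?_)
  simp only [Pi.mul_apply, mul_assoc]

lemma integral_eval_mul_four [DecidableEq ι] (p q r s : ι) :
    ∫ x, x p * x q * x r * x s ∂(Measure.pi fun p => gaussianReal 0 (v p)) =
      (if p = q then (v p : ℝ) else 0) * (if r = s then (v r : ℝ) else 0) +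
      (if p = r then (v p : ℝ) else 0) * (if q = s then (v q : ℝ) else 0) +
      (if p = s then (v p : ℝ) else 0) * (if q = r then (v q : ℝ) else 0) := by
  have h := integral_linear_mul_four v (Pi.single p 1) (Pi.single q 1) (Pi.single r 1)
    (Pi.single s 1)
  simp only [linear_single] at h
  rw [h]
  simp only [Pi.single_apply, mul_ite, mul_one, mul_zero, ite_mul, zero_mul, Finset.sum_ite_eq',
    Finset.mem_univ, if_true]
  by_cases h1 : p = q <;> by_cases h2 : r = s <;> by_cases h3 : p = r <;> by_cases h4 : q = s <;>
    by_cases h5 : p = s <;> by_cases h6 : q = r <;> simp_all [eq_comm]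

lemma integral_eval_mul [DecidableEq ι] (p q : ι) :
    ∫ x, x p * x q ∂(Measure.pi fun p => gaussianReal 0 (v p)) =
      if p = q then (v p : ℝ) else 0 := by
  have e1 := integral_linear_sq v (Pi.single p 1 + Pi.single q 1)
  have e2 := integral_linear_sq v (Pi.single p 1 - Pi.single q 1)
  have i1 := integrable_linear_pow v (Pi.single p 1 + Pi.single q 1) 2
  have i2 := integrable_linear_pow v (Pi.single p 1 - Pi.single q 1) 2
  have h : ∀ x : ι → ℝ, x p * x q = 1 / 4 * ((∑ r, (Pi.single p 1 + Pi.single q 1 : ι → ℝ) r * x r) ^ 2 -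
      (∑ r, (Pi.single p 1 - Pi.single q 1 : ι → ℝ) r * x r) ^ 2) := fun x => by
    simp only [Pi.add_apply, Pi.sub_apply, add_mul, sub_mul, Finset.sum_add_distrib,
      Finset.sum_sub_distrib, linear_single]
    ring
  simp only [h]
  rw [integral_const_mul, integral_sub i1 i2, e1, e2, ← Finset.sum_sub_distrib]
  have h2 : ∀ r, (v r : ℝ) * (Pi.single p (1 : ℝ) + Pi.single q 1 : ι → ℝ) r ^ 2 -
      v r * (Pi.single p (1 : ℝ) - Pi.single q 1 : ι → ℝ) r ^ 2 =
      4 * (v r * (Pi.single p 1 : ι → ℝ) r * (Pi.single q 1 : ι → ℝ) r) := fun r => by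
    simp only [Pi.add_apply, Pi.sub_apply]; ring
  simp only [h2, ← Finset.mul_sum]
  rcases eq_or_ne p q with rfl | hpq
  · simp [Pi.single_apply]
  · simp [Pi.single_apply, hpq, hpq.symm]

/-- The variance of a quadratic form in independent Gaussians of the same variance. -/
lemma integral_quadratic_sub_sq_le {d : ℕ} {e : Fin d → ι} (he : Function.Injective e) {s : ℝ}
    (hs : ∀ i, (v (e i) : ℝ) = s) (M : Matrix (Fin d) (Fin d) ℝ) :
    Integrable (fun x => (∑ i, ∑ j, M i j * (x (e i) * x (e j)) - s * ∑ i, M i i) ^ 2)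
      (Measure.pi fun p => gaussianReal 0 (v p)) ∧
    ∫ x, (∑ i, ∑ j, M i j * (x (e i) * x (e j)) - s * ∑ i, M i i) ^ 2
      ∂(Measure.pi fun p => gaussianReal 0 (v p)) ≤ 2 * s ^ 2 * ∑ i, ∑ j, M i j ^ 2 := by
  classical
  set μ := Measure.pi fun p => gaussianReal 0 (v p)
  set t := ∑ i, M i i with ht
  have i4 : Integrable (fun x : ι → ℝ => ∑ i, ∑ j, ∑ k, ∑ l, M i j * M k l *
      (x (e i) * x (e j) * x (e k) * x (e l))) μ :=
    integrable_finsetSum _ fun i _ => integrable_finsetSum _ fun j _ => integrable_finsetSum _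
      fun k _ => integrable_finsetSum _ fun l _ => (integrable_mul_four v _ _ _ _).const_mul _
  have i2' : ∀ i j, Integrable (fun x : ι → ℝ => x (e i) * x (e j)) μ := fun i j =>
    (show MemLp (fun x : ι → ℝ => x (e i)) 2 μ from memLp_eval v (e i) 2).integrable_mul
      (show MemLp (fun x : ι → ℝ => x (e j)) 2 μ from memLp_eval v (e j) 2)
  have i2 : Integrable (fun x : ι → ℝ => ∑ i, ∑ j, M i j * (x (e i) * x (e j))) μ :=
    integrable_finsetSum _ fun i _ => integrable_finsetSum _ fun j _ => (i2' i j).const_mul _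
  have hexp : ∀ x : ι → ℝ, (∑ i, ∑ j, M i j * (x (e i) * x (e j)) - s * t) ^ 2 =
      (∑ i, ∑ j, ∑ k, ∑ l, M i j * M k l * (x (e i) * x (e j) * x (e k) * x (e l))) -
        2 * s * t * (∑ i, ∑ j, M i j * (x (e i) * x (e j))) + (s * t) ^ 2 := fun x => by
    have : (∑ i, ∑ j, M i j * (x (e i) * x (e j))) ^ 2 =
        ∑ i, ∑ j, ∑ k, ∑ l, M i j * M k l * (x (e i) * x (e j) * x (e k) * x (e l)) := by
      rw [sq, Finset.sum_mul]
      refine Finset.sum_congr rfl fun i _ => ?_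
      rw [Finset.sum_mul]
      refine Finset.sum_congr rfl fun j _ => ?_
      rw [Finset.mul_sum]
      refine Finset.sum_congr rfl fun k _ => ?_
      rw [Finset.mul_sum]
      exact Finset.sum_congr rfl fun l _ => by ring
    rw [← this]; ring
  have hint := (i4.sub (i2.const_mul (2 * s * t))).add (integrable_const ((s * t) ^ 2))
  simp only [hexp]
  refine ⟨hint, ?_⟩
  -- The three pairings give the squared trace, the squared Frobenius norm and the trace of M². The
  -- first cancels in the variance; the last is at most the second by `e5`, so M need not be
  -- symmetric.
  have e4 : ∫ x, ∑ i, ∑ j, ∑ k, ∑ l, M i j * M k l *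
      (x (e i) * x (e j) * x (e k) * x (e l)) ∂μ =
      s ^ 2 * (t ^ 2 + ∑ i, ∑ j, M i j ^ 2 + ∑ i, ∑ j, M i j * M j i) := by
    rw [integral_finsetSum _ fun i _ => integrable_finsetSum _ fun j _ => integrable_finsetSum _
      fun k _ => integrable_finsetSum _ fun l _ => (integrable_mul_four v _ _ _ _).const_mul _]
    simp_rw [integral_finsetSum _ fun j _ => integrable_finsetSum _
      fun k _ => integrable_finsetSum _ fun l _ => (integrable_mul_four v _ _ _ _).const_mul _]
    simp_rw [integral_finsetSum _
      fun k _ => integrable_finsetSum _ fun l _ => (integrable_mul_four v _ _ _ _).const_mul _]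
    simp_rw [integral_finsetSum _ fun l _ => (integrable_mul_four v _ _ _ _).const_mul _,
      integral_const_mul]
    simp only [integral_eval_mul_four, he.eq_iff, hs, mul_add, Finset.sum_add_distrib]
    simp only [mul_ite, ite_mul, mul_zero, zero_mul, Finset.sum_ite_eq, Finset.mem_univ, if_true,
      Finset.sum_const_zero, Finset.sum_ite_irrel]
    have t1 : t ^ 2 = ∑ i, ∑ j, M i i * M j j := by rw [sq, ht, Finset.sum_mul_sum]
    rw [t1]
    simp only [Finset.mul_sum]
    congr 1
    · congr 1
      · exact Finset.sum_congr rfl fun i _ => Finset.sum_congr rfl fun j _ => by ring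
      · exact Finset.sum_congr rfl fun i _ => Finset.sum_congr rfl fun j _ => by ring
    · exact Finset.sum_congr rfl fun i _ => Finset.sum_congr rfl fun j _ => by ring
  have e2 : ∫ x, ∑ i, ∑ j, M i j * (x (e i) * x (e j)) ∂μ = s * t := by
    have i3 : ∀ i j, Integrable (fun x : ι → ℝ => M i j * (x (e i) * x (e j))) μ := fun i j =>
      (i2' i j).const_mul _
    refine (integral_finsetSum _ fun i _ => integrable_finsetSum _ fun j _ => i3 i j).trans ?_
    simp_rw [integral_finsetSum _ fun j _ => i3 _ j, integral_const_mul]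
    simp only [μ, integral_eval_mul, he.eq_iff, hs, mul_ite, mul_zero, Finset.sum_ite_eq,
      Finset.mem_univ, if_true, ht, Finset.mul_sum]
    exact Finset.sum_congr rfl fun i _ => mul_comm _ _
  have e5 : ∑ i, ∑ j, M i j * M j i ≤ ∑ i, ∑ j, M i j ^ 2 := by
    have h1 : ∑ i, ∑ j, M j i ^ 2 = ∑ i, ∑ j, M i j ^ 2 := Finset.sum_comm
    have h2 : ∑ i, ∑ j, (M i j * M j i) ≤ ∑ i, ∑ j, (M i j ^ 2 / 2 + M j i ^ 2 / 2) :=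
      Finset.sum_le_sum fun i _ => Finset.sum_le_sum fun j _ => by
        nlinarith [sq_nonneg (M i j - M j i)]
    simp only [Finset.sum_add_distrib, ← Finset.sum_div, h1] at h2
    linarith
  have h6 := integral_add (i4.sub (i2.const_mul (2 * s * t))) (integrable_const ((s * t) ^ 2))
  have h7 := integral_sub i4 (i2.const_mul (2 * s * t))
  simp only [Pi.sub_apply] at h6 h7
  rw [h6, h7, e4, integral_const_mul, e2]
  simp only [integral_const, probReal_univ, one_smul]
  nlinarith [sq_nonneg s]

end GaussianTools

/-! ### Nets of the Euclidean unit ball. -/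

section Net

/-- A largest 1-separated subset of the ball of radius 2, scaled by 1/2. The packing bound from the
Besicovitch covering theory limits its size to 5^dim, and a point further than 1/2 from it could be
added to the set. -/
lemma exists_net (E : Type*) [NormedAddCommGroup E] [NormedSpace ℝ E] [FiniteDimensional ℝ E] :
    ∃ N : Finset E, N.card ≤ 5 ^ Module.finrank ℝ E ∧ (∀ u ∈ N, ‖u‖ ≤ 1) ∧
      ∀ u : E, ‖u‖ ≤ 1 → ∃ w ∈ N, ‖u - w‖ ≤ 1 / 2 := by
  classical
  set P : ℕ → Prop := fun k => ∃ s : Finset E, s.card = k ∧ (∀ c ∈ s, ‖c‖ ≤ 2) ∧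
    ∀ c ∈ s, ∀ d ∈ s, c ≠ d → 1 ≤ ‖c - d‖
  have hb : ∀ k, P k → k ≤ 5 ^ Module.finrank ℝ E := by
    rintro k ⟨s, rfl, h1, h2⟩
    exact Besicovitch.card_le_of_separated s h1 h2
  have hP : P (Nat.findGreatest P (5 ^ Module.finrank ℝ E)) :=
    Nat.findGreatest_spec (Nat.zero_le _) ⟨∅, by simp, by simp, by simp⟩
  obtain ⟨s, hs, h1, h2⟩ := hP
  refine ⟨s.image fun c => (1 / 2 : ℝ) • c, Finset.card_image_le.trans (h1 |> fun _ =>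
    Besicovitch.card_le_of_separated s h1 h2), ?_, ?_⟩
  · intro u hu
    obtain ⟨c, hc, rfl⟩ := Finset.mem_image.1 hu
    rw [norm_smul]
    have := h1 c hc
    norm_num; linarith
  · intro u hu
    by_contra! hcon
    have hcon' : ∀ c ∈ s, 1 < ‖(2 : ℝ) • u - c‖ := fun c hc => by
      have h3 := hcon _ (Finset.mem_image_of_mem _ hc)
      have h4 : (2 : ℝ) • u - c = (2 : ℝ) • (u - (1 / 2 : ℝ) • c) := by
        rw [smul_sub, smul_smul]; norm_num
      rw [h4, norm_smul]
      norm_num at h3 ⊢; linarith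
    have hnot : (2 : ℝ) • u ∉ s := fun h => by
      have := hcon' _ h
      simp at this; linarith
    have hins : P (s.card + 1) := by
      refine ⟨insert ((2 : ℝ) • u) s, Finset.card_insert_of_notMem hnot, ?_, ?_⟩
      · intro c hc
        rcases Finset.mem_insert.1 hc with rfl | hc
        · rw [norm_smul]; norm_num; linarith
        · exact h1 c hc
      · intro c hc e he hce
        rcases Finset.mem_insert.1 hc with rfl | hc' <;> rcases Finset.mem_insert.1 he with rfl | he'
        · exact absurd rfl hce
        · exact (hcon' e he').le
        · rw [norm_sub_rev]; exact (hcon' c hc').le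
        · exact h2 c hc' e he' hce
    have := Nat.le_findGreatest (hb _ hins) hins
    omega

/-- The operator norm is controlled by the bilinear form on a net. -/
lemma opB_of_net {d : ℕ} {N : Finset (EuclideanSpace ℝ (Fin d))}
    (hN : ∀ u : EuclideanSpace ℝ (Fin d), ‖u‖ ≤ 1 → ∃ w ∈ N, ‖u - w‖ ≤ 1 / 2)
    {W : Matrix (Fin d) (Fin d) ℝ} {t : ℝ} (ht : 0 ≤ t)
    (h : ∀ u ∈ N, ∀ w ∈ N, ∑ i, ∑ j, u i * w j * W i j ≤ t) : OpB W (4 * t) := by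
  set A := Matrix.toEuclideanCLM (𝕜 := ℝ) W with hA
  have hinner : ∀ u w : EuclideanSpace ℝ (Fin d), inner ℝ u (A w) = ∑ i, ∑ j, u i * w j * W i j := by
    intro u w
    simp only [PiLp.inner_apply, RCLike.inner_apply, conj_trivial, hA,
      Matrix.ofLp_toEuclideanCLM, Matrix.mulVec, dotProduct, Finset.sum_mul]
    exact Finset.sum_congr rfl fun i _ => Finset.sum_congr rfl fun j _ => by ring
  have h1 : ∀ w ∈ N, ‖A w‖ ≤ 2 * t := fun w hw => by
    rcases eq_or_ne (A w) 0 with h0 | h0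
    · rw [h0]; simpa using ht
    have hpos : 0 < ‖A w‖ := norm_pos_iff.2 h0
    set u := ‖A w‖⁻¹ • A w with hu
    have hu1 : ‖u‖ = 1 := norm_smul_inv_norm h0
    obtain ⟨u', hu', hu''⟩ := hN u hu1.le
    have e1 : inner ℝ u (A w) = ‖A w‖ := by
      rw [hu, real_inner_smul_left, real_inner_self_eq_norm_sq]; field_simp
    have e2 : inner ℝ u (A w) = inner ℝ u' (A w) + inner ℝ (u - u') (A w) := by
      rw [← inner_add_left]; simp
    have e3 := real_inner_le_norm (u - u') (A w)
    have e4 : inner ℝ u' (A w) ≤ t := by rw [hinner]; exact h u' hu' w hw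
    nlinarith [norm_nonneg (A w)]
  -- Replacing u by a net point costs half of the norm of A, which is then absorbed on the left. The
  -- same argument on the other side produced `h1`; each use doubles the constant.
  have h2 : ∀ u : EuclideanSpace ℝ (Fin d), ‖u‖ = 1 → ‖A u‖ ≤ 2 * t + ‖A‖ * (1 / 2) := fun u hu => by
    obtain ⟨w, hw, hw'⟩ := hN u hu.le
    have e1 : A u = A w + A (u - w) := by rw [← map_add]; simp
    rw [e1]
    exact (norm_add_le _ _).trans (add_le_add (h1 w hw)
      ((A.le_opNorm _).trans (mul_le_mul_of_nonneg_left hw' (norm_nonneg _))))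
  have h3 : ‖A‖ ≤ 2 * t + ‖A‖ * (1 / 2) := by
    refine ContinuousLinearMap.opNorm_le_of_unit_norm (by positivity) h2
  refine ⟨by linarith, fun w => ?_⟩
  rw [l2_eq_norm, l2_eq_norm]
  have e1 : (WithLp.toLp 2 (W *ᵥ w) : EuclideanSpace ℝ (Fin d)) = A (WithLp.toLp 2 w) := by
    rw [hA, Matrix.toEuclideanCLM_toLp]
  rw [e1]
  exact (A.le_opNorm _).trans (mul_le_mul_of_nonneg_right (by linarith) (norm_nonneg _))

end Net

/-! ### The operator norm of a Gaussian matrix. -/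

section OpNorm
variable {ι : Type*} [Fintype ι] (v : ι → NNReal)

/-- The exponential Markov inequality with `lam` left free. -/
lemma measureReal_linear_ge_le (c : ι → ℝ) {τ : ℝ} (hτ : ∑ p, v p * c p ^ 2 ≤ τ) (t lam : ℝ)
    (hl : 0 ≤ lam) : (Measure.pi fun p => gaussianReal 0 (v p)).real {x | t ≤ ∑ p, c p * x p} ≤
      Real.exp (-lam * t + τ * lam ^ 2 / 2) := by
  have hmap := map_linear_eq_gaussianReal v c
  have h0 : 0 ≤ ∑ p, (v p : ℝ) * c p ^ 2 := Finset.sum_nonneg fun p _ => by positivity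
  have hint : Integrable (fun x => Real.exp (lam * ∑ p, c p * x p))
      (Measure.pi fun p => gaussianReal 0 (v p)) := by
    have := integrable_exp_mul_gaussianReal (μ := 0) (v := (∑ p, v p * c p ^ 2 : ℝ).toNNReal) lam
    rw [← hmap, integrable_map_measure (by fun_prop) (measurable_linear c).aemeasurable] at this
    exact this
  refine (measure_ge_le_exp_mul_mgf t hl hint).trans ?_
  rw [mgf_gaussianReal hmap, ← Real.exp_add, Real.coe_toNNReal _ h0]
  refine Real.exp_le_exp.2 ?_
  nlinarith [sq_nonneg lam]

/-- A `d × d` matrix with independent Gaussian entries of variance `O(1 / d)` has bounded operator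
norm, outside of an event of exponentially small probability. -/
lemma measureReal_not_opB_le {d : ℕ} {e : Fin d × Fin d → ι} (he : Function.Injective e) {s : ℝ}
    (hs0 : 0 ≤ s) (hs : ∀ i, (d : ℝ) * v (e i) ≤ s) :
    (Measure.pi fun p => gaussianReal 0 (v p)).real
      {x | ¬ OpB (Matrix.of fun i j => x (e (i, j))) (4 * (s + 6))} ≤ Real.exp (-d) := by
  classical
  obtain ⟨N, hN, hN1, hN2⟩ := exists_net (EuclideanSpace ℝ (Fin d))
  rw [finrank_euclideanSpace_fin] at hN
  set μ := Measure.pi fun p => gaussianReal 0 (v p)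
  set t := s + 6 with ht
  have hsub : {x : ι → ℝ | ¬ OpB (Matrix.of fun i j => x (e (i, j))) (4 * t)} ⊆
      ⋃ q ∈ N ×ˢ N, {x | t ≤ ∑ i, ∑ j, q.1 i * q.2 j * x (e (i, j))} := by
    intro x hx
    by_contra hcon
    simp only [Set.mem_iUnion, Set.mem_ofPred_eq, not_exists, not_le] at hcon
    exact hx (opB_of_net hN2 (by linarith) fun u hu w hw =>
      (hcon (u, w) (Finset.mem_product.2 ⟨hu, hw⟩)).le)
  have hone : ∀ q ∈ N ×ˢ N, μ.real {x | t ≤ ∑ i, ∑ j, q.1 i * q.2 j * x (e (i, j))} ≤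
      Real.exp (-d * 6) := by
    intro q hq
    rw [Finset.mem_product] at hq
    set c : ι → ℝ := fun p => ∑ i, ∑ j, if e (i, j) = p then q.1 i * q.2 j else 0 with hc
    have hlin : ∀ x : ι → ℝ, ∑ p, c p * x p = ∑ i, ∑ j, q.1 i * q.2 j * x (e (i, j)) := fun x => by
      simp only [hc, Finset.sum_mul, ite_mul, zero_mul]
      rw [Finset.sum_comm]
      refine Finset.sum_congr rfl fun i _ => ?_
      rw [Finset.sum_comm]
      simp
    have hce : ∀ i j, c (e (i, j)) = q.1 i * q.2 j := fun i j => by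
      simp only [hc, he.eq_iff, Prod.mk.injEq]
      rw [Finset.sum_eq_single i _ (by simp)]
      · simp
      · intro k _ hk; simp [hk]
    have hsq : (d : ℝ) * ∑ p, v p * c p ^ 2 ≤ s := by
      have e1 : ∑ p, (v p : ℝ) * c p ^ 2 = ∑ i, ∑ j, v (e (i, j)) * (q.1 i * q.2 j) ^ 2 := by
        have e2 : ∀ p, (v p : ℝ) * c p ^ 2 = c p * (v p * c p) := fun p => by ring
        simp only [e2]
        rw [hlin fun p => v p * c p]
        refine Finset.sum_congr rfl fun i _ => Finset.sum_congr rfl fun j _ => ?_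
        rw [hce]; ring
      have e3 : ∑ i, ∑ j, (q.1 i * q.2 j) ^ 2 ≤ 1 := by
        rw [l2_mul_outer]
        have n1 := hN1 _ hq.1
        have n2 := hN1 _ hq.2
        have m1 : l2 (fun i => q.1 i) = ‖q.1‖ := l2_eq_norm _
        have m2 : l2 (fun i => q.2 i) = ‖q.2‖ := l2_eq_norm _
        rw [m1, m2]
        exact pow_le_one₀ (by positivity) (mul_le_one₀ n1 (norm_nonneg _) n2)
      rw [e1, Finset.mul_sum]
      calc _ = ∑ i, ∑ j, ((d : ℝ) * v (e (i, j))) * (q.1 i * q.2 j) ^ 2 := by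
            simp only [Finset.mul_sum, mul_assoc]
        _ ≤ ∑ i, ∑ j, s * (q.1 i * q.2 j) ^ 2 := by
            gcongr with i _ j _; exact hs _
        _ = s * ∑ i, ∑ j, (q.1 i * q.2 j) ^ 2 := by simp only [Finset.mul_sum]
        _ ≤ s := mul_le_of_le_one_right hs0 e3
    rcases Nat.eq_zero_or_pos d with hd | hd
    · subst hd; simp
    have hd' : (0 : ℝ) < d := by exact_mod_cast hd
    -- With exponent parameter d and variance at most s / d the bound is exp(-d t + s d / 2), at
    -- most exp(-6 d) because t = s + 6.
    have h := measureReal_linear_ge_le v c (τ := s / d)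
      (by rw [le_div_iff₀ hd']; linarith) t d hd'.le
    simp only [hlin] at h
    refine h.trans (Real.exp_le_exp.2 ?_)
    have : s / d * (d : ℝ) ^ 2 / 2 = s * d / 2 := by field_simp
    rw [this, ht]
    nlinarith [mul_nonneg hs0 hd'.le]
  calc μ.real _ ≤ μ.real (⋃ q ∈ N ×ˢ N, {x | t ≤ ∑ i, ∑ j, q.1 i * q.2 j * x (e (i, j))}) :=
        measureReal_mono hsub (measure_ne_top _ _)
    _ ≤ ∑ q ∈ N ×ˢ N, μ.real {x | t ≤ ∑ i, ∑ j, q.1 i * q.2 j * x (e (i, j))} :=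
        measureReal_biUnion_finset_le _ _
    _ ≤ ∑ _q ∈ N ×ˢ N, Real.exp (-d * 6) := Finset.sum_le_sum hone
    _ = (N.card : ℝ) * N.card * Real.exp (-d * 6) := by simp
    _ ≤ (5 ^ d : ℝ) * 5 ^ d * Real.exp (-d * 6) := by
        have : (N.card : ℝ) ≤ 5 ^ d := by exact_mod_cast hN
        gcongr
    -- The 25^d pairs of net points cost at most exp(5 d), as 25 ≤ 2⁵ ≤ e⁵; this is why 6 was
    -- chosen.
    _ ≤ Real.exp (d * 5) * Real.exp (-d * 6) := by
        gcongr
        rw [← mul_pow, Real.exp_nat_mul]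
        gcongr
        have h1 := Real.add_one_le_exp (1 : ℝ)
        have h2 : Real.exp 5 = Real.exp 1 ^ 5 := by rw [← Real.exp_nat_mul]; norm_num
        rw [h2]
        calc (5 * 5 : ℝ) ≤ 2 ^ 5 := by norm_num
          _ ≤ _ := by gcongr; linarith
    _ = _ := by rw [← Real.exp_add]; congr 1; ring

end OpNorm

/-! ### Continuity of Gaussian moments in the covariance. -/

section GaussMoment
open scoped MatrixOrder Topology
open Filter
variable {n : ℕ}

open scoped Matrix.Norms.L2Operator in
lemma continuousOn_matrix_sqrt : ContinuousOn (fun S : Matrix (Fin n) (Fin n) ℝ => CFC.sqrt S)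
    {S | S.PosSemidef} := by
  have h := CFC.continuousOn_sqrt (A := Matrix (Fin n) (Fin n) ℝ)
  simp only [Matrix.nonneg_iff_posSemidef] at h
  exact h

lemma continuousOn_matrix_sqrt_apply (i j : Fin n) :
    ContinuousOn (fun S : Matrix (Fin n) (Fin n) ℝ => CFC.sqrt S i j) {S | S.PosSemidef} :=
  (continuous_id.matrix_elem i j).comp_continuousOn continuousOn_matrix_sqrt

/-- All covariances are realized on one probability space, so that continuity in S becomes dominated
convergence. -/
lemma multivariateGaussian_eq_map (S : Matrix (Fin n) (Fin n) ℝ) :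
    multivariateGaussian 0 S = (Measure.pi fun _ : Fin n => gaussianReal 0 1).map
      fun x => WithLp.toLp 2 (CFC.sqrt S *ᵥ x) := by
  rw [multivariateGaussian, ← map_pi_eq_stdGaussian, Measure.map_map (by fun_prop) (by fun_prop)]
  congr 1
  ext x
  simp [Matrix.toEuclideanCLM_toLp]

lemma gaussMoment_apply (φ : ℝ → ℝ) (hφ : Continuous φ) (S : Matrix (Fin n) (Fin n) ℝ)
    (s t : Fin n) : gaussMoment φ S s t =
      ∫ x, φ ((CFC.sqrt S *ᵥ x) s) * φ ((CFC.sqrt S *ᵥ x) t)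
        ∂(Measure.pi fun _ : Fin n => gaussianReal 0 1) := by
  have hm : Measurable fun x : Fin n → ℝ =>
      (WithLp.toLp 2 (CFC.sqrt S *ᵥ x) : EuclideanSpace ℝ (Fin n)) := by
    unfold Matrix.mulVec dotProduct
    fun_prop
  rw [gaussMoment, Matrix.of_apply, multivariateGaussian_eq_map, integral_map hm.aemeasurable]
  exact (by fun_prop : Continuous fun f : EuclideanSpace ℝ (Fin n) =>
    φ (f s) * φ (f t)).aestronglyMeasurable

lemma continuous_of_abs_sub_le {φ : ℝ → ℝ} {c : ℝ} (hφ : ∀ u v, |φ u - φ v| ≤ c * |u - v|) :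
    Continuous φ :=
  (LipschitzWith.of_dist_le_mul (K := c.toNNReal) fun u v => by
    rw [Real.dist_eq, Real.dist_eq]
    exact (hφ u v).trans (mul_le_mul_of_nonneg_right (Real.le_coe_toNNReal c)
      (abs_nonneg _))).continuous

lemma abs_le_of_abs_sub_le {φ : ℝ → ℝ} {c : ℝ} (hφ : ∀ u v, |φ u - φ v| ≤ c * |u - v|) (u : ℝ) :
    |φ u| ≤ |φ 0| + c * |u| := by
  have h := hφ u 0
  have h2 := abs_sub_abs_le_abs_sub (φ u) (φ 0)
  rw [sub_zero] at h
  linarith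

lemma sq_le_of_abs_sub_le {φ : ℝ → ℝ} {c : ℝ} (hφ : ∀ u v, |φ u - φ v| ≤ c * |u - v|) (u : ℝ) :
    φ u ^ 2 ≤ 2 * φ 0 ^ 2 + 2 * c ^ 2 * u ^ 2 := by
  have h := abs_le_of_abs_sub_le hφ u
  have h1 : φ u ^ 2 ≤ (|φ 0| + c * |u|) ^ 2 := by
    rw [← sq_abs]; exact pow_le_pow_left₀ (abs_nonneg _) h 2
  have h2 := sq_abs (φ 0)
  have h3 := sq_abs u
  nlinarith [sq_nonneg (|φ 0| - c * |u|)]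

lemma integrable_sq_sum (v : Fin n → NNReal) :
    Integrable (fun x : Fin n → ℝ => (∑ k, |x k|) ^ 2) (Measure.pi fun p => gaussianReal 0 (v p)) := by
  have h : MemLp (fun x : Fin n → ℝ => ∑ k, |x k|) 2 (Measure.pi fun p => gaussianReal 0 (v p)) :=
    memLp_finsetSum _ fun k _ => (show MemLp (fun x : Fin n → ℝ => x k) 2
      (Measure.pi fun p => gaussianReal 0 (v p)) from memLp_eval v k 2).abs
  exact h.integrable_sq

/-- The square root is continuous on the positive semidefinite cone, and near S its entries are
bounded. Linear growth of φ then gives an integrable quadratic majorant. -/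
lemma continuousWithinAt_gaussMoment {φ : ℝ → ℝ} {c : ℝ} (hc : 0 ≤ c)
    (hφ : ∀ u v, |φ u - φ v| ≤ c * |u - v|) (s t : Fin n) {S : Matrix (Fin n) (Fin n) ℝ}
    (hS : S.PosSemidef) :
    ContinuousWithinAt (fun S => gaussMoment φ S s t) {S | S.PosSemidef} S := by
  have hφc := continuous_of_abs_sub_le hφ
  simp only [gaussMoment_apply φ hφc]
  have hent : ∀ i j, Tendsto (fun S : Matrix (Fin n) (Fin n) ℝ => CFC.sqrt S i j)
      (𝓝[{S | S.PosSemidef}] S) (𝓝 (CFC.sqrt S i j)) := fun i j =>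
    continuousOn_matrix_sqrt_apply i j S hS
  set M := 1 + ∑ i, ∑ j, |CFC.sqrt S i j| with hM
  have hbound : ∀ᶠ S' : Matrix (Fin n) (Fin n) ℝ in 𝓝[{S | S.PosSemidef}] S, ∀ i j, |CFC.sqrt S' i j| ≤ M := by
    rw [eventually_all]
    intro i
    rw [eventually_all]
    intro j
    have h1 : |CFC.sqrt S i j| < M := by
      have h2 : |CFC.sqrt S i j| ≤ ∑ j, |CFC.sqrt S i j| :=
        Finset.single_le_sum (f := fun j => |CFC.sqrt S i j|) (fun j _ => abs_nonneg _)
          (Finset.mem_univ j)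
      have h3 : ∑ j, |CFC.sqrt S i j| ≤ ∑ i, ∑ j, |CFC.sqrt S i j| :=
        Finset.single_le_sum (f := fun i => ∑ j, |CFC.sqrt S i j|)
          (fun i _ => Finset.sum_nonneg fun j _ => abs_nonneg _) (Finset.mem_univ i)
      linarith
    exact ((hent i j).abs.eventually_lt_const h1).mono fun S' h => h.le
  have hM0 : 0 ≤ M := by positivity
  have hφb : ∀ S' : Matrix (Fin n) (Fin n) ℝ, (∀ i j, |CFC.sqrt S' i j| ≤ M) → ∀ x i,
      |φ ((CFC.sqrt S' *ᵥ x) i)| ≤ |φ 0| + c * (M * ∑ k, |x k|) := fun S' h x i => by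
    refine (abs_le_of_abs_sub_le hφ _).trans ?_
    gcongr
    rw [Matrix.mulVec, dotProduct, Finset.mul_sum]
    refine (Finset.abs_sum_le_sum_abs _ _).trans (Finset.sum_le_sum fun k _ => ?_)
    rw [abs_mul]
    gcongr
    exact h i k
  have : FirstCountableTopology (Matrix (Fin n) (Fin n) ℝ) :=
    inferInstanceAs (FirstCountableTopology (Fin n → Fin n → ℝ))
  refine tendsto_integral_filter_of_dominated_convergence
    (fun x => 2 * φ 0 ^ 2 + 2 * (c * M) ^ 2 * (∑ k, |x k|) ^ 2) ?_ ?_ ?_ ?_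
  · refine Eventually.of_forall fun S' => Continuous.aestronglyMeasurable ?_
    fun_prop
  · filter_upwards [hbound] with S' hS'
    refine Eventually.of_forall fun x => ?_
    rw [Real.norm_eq_abs, abs_mul]
    have h1 := hφb S' hS' x s
    have h2 := hφb S' hS' x t
    have h3 := mul_le_mul h1 h2 (abs_nonneg _) (by positivity)
    have h4 := sq_abs (φ 0)
    nlinarith [sq_nonneg (|φ 0| - c * (M * ∑ k, |x k|))]
  · exact (integrable_const _).add ((integrable_sq_sum fun _ => 1).const_mul _)
  · refine Eventually.of_forall fun x => ?_
    have h1 : ∀ i, Tendsto (fun S : Matrix (Fin n) (Fin n) ℝ => (CFC.sqrt S *ᵥ x) i)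
        (𝓝[{S | S.PosSemidef}] S) (𝓝 ((CFC.sqrt S *ᵥ x) i)) := fun i =>
      tendsto_finsetSum Finset.univ fun k _ => (hent i k).mul_const (x k)
    exact ((hφc.tendsto _).comp (h1 s)).mul ((hφc.tendsto _).comp (h1 t))

lemma exists_abs_gaussMoment_sub_le {φ : ℝ → ℝ} {c : ℝ} (hc : 0 ≤ c)
    (hφ : ∀ u v, |φ u - φ v| ≤ c * |u - v|) {S : Matrix (Fin n) (Fin n) ℝ}
    (hS : S.PosSemidef) {ε : ℝ} (hε : 0 < ε) :
    ∃ δ, 0 < δ ∧ ∀ S' : Matrix (Fin n) (Fin n) ℝ, S'.PosSemidef →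
      (∀ s t, |S' s t - S s t| ≤ δ) → ∀ s t, |gaussMoment φ S' s t - gaussMoment φ S s t| ≤ ε := by
  have h1 : ∀ᶠ S' in 𝓝[{S | S.PosSemidef}] S, ∀ s t,
      |gaussMoment φ S' s t - gaussMoment φ S s t| < ε := by
    rw [eventually_all]
    intro s
    rw [eventually_all]
    intro t
    have h := Metric.tendsto_nhds.1 (continuousWithinAt_gaussMoment hc hφ s t hS) ε hε
    simpa only [Real.dist_eq] using h
  rw [eventually_nhdsWithin_iff] at h1
  have h2 : (𝓝 S).HasBasis (fun δ : ℝ => 0 < δ) fun δ => {S' | ∀ s t, |S' s t - S s t| ≤ δ} := by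
    have h3 : 𝓝 S = 𝓝 (fun s t => S s t : Fin n → Fin n → ℝ) := rfl
    rw [h3]
    refine (Metric.nhds_basis_closedBall (x := (fun s t => S s t : Fin n → Fin n → ℝ))).to_hasBasis
      (fun δ hδ => ⟨δ, hδ, fun S' hS' => ?_⟩) (fun δ hδ => ⟨δ, hδ, fun S' hS' s t => ?_⟩)
    · exact (dist_pi_le_iff hδ.le).2 fun s => (dist_pi_le_iff hδ.le).2 fun t => hS' s t
    · exact (dist_pi_le_iff hδ.le).1 ((dist_pi_le_iff hδ.le).1 hS' s) t
  obtain ⟨δ, hδ, h4⟩ := h2.eventually_iff.1 h1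
  exact ⟨δ, hδ, fun S' hS' h s t => (h4 h hS' s t).le⟩

lemma integrable_mul_of_abs_sub_le {ι : Type*} [Fintype ι] (v : ι → NNReal) {φ : ℝ → ℝ} {c : ℝ}
    (hφ : ∀ u v, |φ u - φ v| ≤ c * |u - v|) (a b : ι → ℝ) :
    Integrable (fun x => φ (∑ p, a p * x p) * φ (∑ p, b p * x p))
      (Measure.pi fun p => gaussianReal 0 (v p)) := by
  have hφc := continuous_of_abs_sub_le hφ
  refine Integrable.mono' (g := fun x => 2 * φ 0 ^ 2 + c ^ 2 * (∑ p, a p * x p) ^ 2 +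
    c ^ 2 * (∑ p, b p * x p) ^ 2) (((integrable_const _).add
      ((integrable_linear_pow v a 2).const_mul _)).add ((integrable_linear_pow v b 2).const_mul _))
    (by fun_prop : Continuous fun x : ι → ℝ =>
      φ (∑ p, a p * x p) * φ (∑ p, b p * x p)).aestronglyMeasurable
    (Eventually.of_forall fun x => ?_)
  rw [Real.norm_eq_abs, abs_mul]
  have h1 := sq_le_of_abs_sub_le hφ (∑ p, a p * x p)
  have h2 := sq_le_of_abs_sub_le hφ (∑ p, b p * x p)
  rw [← sq_abs] at h1 h2
  nlinarith [sq_nonneg (|φ (∑ p, a p * x p)| - |φ (∑ p, b p * x p)|)]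

lemma integral_mul_eq_gaussMoment {ι : Type*} [Fintype ι] (v : ι → NNReal) {φ : ℝ → ℝ}
    (hφ : Continuous φ) (C : Fin n → ι → ℝ) (s t : Fin n) :
    ∫ x, φ (∑ p, C s p * x p) * φ (∑ p, C t p * x p) ∂(Measure.pi fun p => gaussianReal 0 (v p)) =
      gaussMoment φ (Matrix.of fun s t => ∑ p, v p * (C s p * C t p)) s t := by
  rw [gaussMoment, Matrix.of_apply, ← map_linear_eq_multivariateGaussian, integral_map
    (by fun_prop : Measurable _).aemeasurable]
  exact (by fun_prop : Continuous fun f : EuclideanSpace ℝ (Fin n) =>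
    φ (f s) * φ (f t)).aestronglyMeasurable

lemma posSemidef_gaussMoment {φ : ℝ → ℝ} {c : ℝ} (hφ : ∀ u v, |φ u - φ v| ≤ c * |u - v|)
    (S : Matrix (Fin n) (Fin n) ℝ) : (gaussMoment φ S).PosSemidef := by
  have hφc := continuous_of_abs_sub_le hφ
  refine Matrix.PosSemidef.of_dotProduct_mulVec_nonneg ?_ fun x => ?_
  · ext s t
    simp only [Matrix.conjTranspose_apply, star_trivial, gaussMoment, Matrix.of_apply]
    exact integral_congr_ae (Eventually.of_forall fun _ => mul_comm _ _)
  · have hint : ∀ s t, Integrable (fun z : Fin n → ℝ =>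
        φ ((CFC.sqrt S *ᵥ z) s) * φ ((CFC.sqrt S *ᵥ z) t))
        (Measure.pi fun _ : Fin n => gaussianReal 0 1) := fun s t =>
      integrable_mul_of_abs_sub_le (fun _ => 1) hφ (CFC.sqrt S s) (CFC.sqrt S t)
    have h1 : star x ⬝ᵥ (gaussMoment φ S *ᵥ x) =
        ∫ z, (∑ s, x s * φ ((CFC.sqrt S *ᵥ z) s)) ^ 2
          ∂(Measure.pi fun _ : Fin n => gaussianReal 0 1) := by
      have h2 : ∀ z : Fin n → ℝ, (∑ s, x s * φ ((CFC.sqrt S *ᵥ z) s)) ^ 2 =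
          ∑ s, ∑ t, x s * x t * (φ ((CFC.sqrt S *ᵥ z) s) * φ ((CFC.sqrt S *ᵥ z) t)) := fun z => by
        rw [sq, Finset.sum_mul_sum]
        exact Finset.sum_congr rfl fun s _ => Finset.sum_congr rfl fun t _ => by ring
      simp only [h2]
      rw [integral_finsetSum _ fun s _ => integrable_finsetSum _ fun t _ => (hint s t).const_mul _]
      simp_rw [integral_finsetSum _ fun t _ => (hint _ t).const_mul _, integral_const_mul,
        ← gaussMoment_apply φ hφc]
      simp only [dotProduct, Matrix.mulVec, star_trivial, Finset.mul_sum]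
      exact Finset.sum_congr rfl fun s _ => Finset.sum_congr rfl fun t _ => by ring
    rw [h1]
    exact integral_nonneg fun z => sq_nonneg _

lemma posSemidef_preCov {d₀ : ℕ} {σ : ℝ → ℝ} {c : ℝ} (hσ : ∀ u v, |σ u - σ v| ≤ c * |u - v|)
    (σw : ℝ) (X : Fin n → Fin d₀ → ℝ) : ∀ l, (preCov σ σw X l).PosSemidef
  | 0 => by
    have h := posSemidef_gram (fun _ : Fin d₀ => (σw ^ 2 / d₀).toNNReal) X
    have h0 : (0 : ℝ) ≤ σw ^ 2 / d₀ := by positivity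
    simp only [Real.coe_toNNReal _ h0, ← Finset.mul_sum] at h
    exact h
  | l + 1 => (posSemidef_gaussMoment hσ _).smul (sq_nonneg σw)

lemma gaussMoment_symm (φ : ℝ → ℝ) (S : Matrix (Fin n) (Fin n) ℝ) (s t : Fin n) :
    gaussMoment φ S s t = gaussMoment φ S t s :=
  integral_congr_ae (Eventually.of_forall fun _ => mul_comm _ _)

end GaussMoment

/-! ### Moment inequalities and concentration over the units of one layer. -/

lemma measureReal_lt_le_of_integral {Ω : Type*} [MeasurableSpace Ω] {μ : Measure Ω}
    [IsProbabilityMeasure μ] {F : Ω → ℝ} (hF : ∀ x, 0 ≤ F x) (hi : Integrable F μ) {ε b : ℝ}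
    (hε : 0 < ε) (hb : ∫ x, F x ∂μ ≤ b) : μ.real {x | ε < F x} ≤ b / ε := by
  have h := mul_meas_ge_le_integral_of_nonneg (Filter.Eventually.of_forall hF) hi ε
  have h1 : μ.real {x | ε < F x} ≤ μ.real {x | ε ≤ F x} :=
    measureReal_mono (fun x (hx : ε < F x) => hx.le) (measure_ne_top _ _)
  rw [le_div_iff₀ hε]
  nlinarith

lemma integral_sub_sq_le {Ω : Type*} [MeasurableSpace Ω] {μ : Measure Ω} [IsProbabilityMeasure μ]
    {Z : Ω → ℝ} (hZ : AEStronglyMeasurable Z μ) {g : ℝ} (hg : ∫ x, Z x ∂μ = g) :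
    ∫ x, (Z x - g) ^ 2 ∂μ ≤ ∫ x, Z x ^ 2 ∂μ := by
  have h := variance_le_expectation_sq hZ
  rw [variance_eq_integral hZ.aemeasurable, hg] at h
  exact h

section BlockForms
variable {ι κ : Type*} [Fintype ι] [Fintype κ] [DecidableEq ι] {d n : ℕ}

/-- The coefficients of the linear form `∑ i, u i * x (e (i, j))`. -/
def coef (e : κ × Fin d → ι) (u : κ → ℝ) (j : Fin d) (p : ι) : ℝ :=
  ∑ i, if e (i, j) = p then u i else 0

lemma sum_coef (e : κ × Fin d → ι) (u : κ → ℝ) (j : Fin d) (x : ι → ℝ) :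
    ∑ p, coef e u j p * x p = ∑ i, u i * x (e (i, j)) := by
  simp only [coef, Finset.sum_mul, ite_mul, zero_mul]
  rw [Finset.sum_comm]
  simp

omit [Fintype ι] in
lemma coef_apply {e : κ × Fin d → ι} (he : Function.Injective e) (u : κ → ℝ) (i : κ) (j : Fin d) :
    coef e u j (e (i, j)) = u i := by
  classical
  simp [coef, he.eq_iff]

variable {v : ι → NNReal} {e : κ × Fin d → ι} {s : ℝ}

lemma sum_coef_mul (he : Function.Injective e) (hs : ∀ q, (v (e q) : ℝ) = s) (u u' : κ → ℝ)
    (j : Fin d) :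
    ∑ p, v p * (coef e u j p * coef e u' j p) = s * ∑ i, u i * u' i := by
  have h : ∀ p, (v p : ℝ) * (coef e u j p * coef e u' j p) =
      coef e u j p * (v p * coef e u' j p) := fun p => by ring
  simp only [h]
  rw [sum_coef e u j fun p => v p * coef e u' j p, Finset.mul_sum]
  refine Finset.sum_congr rfl fun i _ => ?_
  rw [coef_apply he, hs]; ring

lemma integral_block_pow_four (he : Function.Injective e) (hs : ∀ q, (v (e q) : ℝ) = s)
    (u : κ → ℝ) (j : Fin d) :
    Integrable (fun x => (∑ i, u i * x (e (i, j))) ^ 4) (Measure.pi fun p => gaussianReal 0 (v p)) ∧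
    ∫ x, (∑ i, u i * x (e (i, j))) ^ 4 ∂(Measure.pi fun p => gaussianReal 0 (v p)) =
      3 * (s * ∑ i, u i ^ 2) ^ 2 := by
  have h1 := integral_linear_pow_four v (coef e u j)
  have h2 := integrable_linear_pow v (coef e u j) 4
  have h3 : ∑ p, (v p : ℝ) * coef e u j p ^ 2 = s * ∑ i, u i ^ 2 := by
    simpa only [sq] using sum_coef_mul he hs u u j
  simp only [sum_coef, h3] at h1 h2
  exact ⟨h2, h1⟩

lemma pow_four_le_of_abs_sub_le {φ : ℝ → ℝ} {c : ℝ} (hφ : ∀ u v, |φ u - φ v| ≤ c * |u - v|)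
    (u : ℝ) : φ u ^ 4 ≤ 8 * φ 0 ^ 4 + 8 * c ^ 4 * u ^ 4 := by
  have h := sq_le_of_abs_sub_le hφ u
  have h1 : (φ u ^ 2) ^ 2 ≤ (2 * φ 0 ^ 2 + 2 * c ^ 2 * u ^ 2) ^ 2 :=
    pow_le_pow_left₀ (sq_nonneg _) h 2
  nlinarith [sq_nonneg (φ 0 ^ 2 - c ^ 2 * u ^ 2)]

variable {φ : ℝ → ℝ} {c : ℝ}

lemma integral_comp_block_pow_four_le (he : Function.Injective e) (hs : ∀ q, (v (e q) : ℝ) = s)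
    (hs0 : 0 ≤ s) (hφ : ∀ u v, |φ u - φ v| ≤ c * |u - v|) {u : κ → ℝ} {D : ℝ}
    (hD : s * ∑ i, u i ^ 2 ≤ D) (j : Fin d) :
    Integrable (fun x => φ (∑ i, u i * x (e (i, j))) ^ 4)
      (Measure.pi fun p => gaussianReal 0 (v p)) ∧
    ∫ x, φ (∑ i, u i * x (e (i, j))) ^ 4 ∂(Measure.pi fun p => gaussianReal 0 (v p)) ≤
      8 * φ 0 ^ 4 + 24 * c ^ 4 * D ^ 2 := by
  have hφc := continuous_of_abs_sub_le hφ
  obtain ⟨h1, h2⟩ := integral_block_pow_four he hs u j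
  have h3 : Integrable (fun x => 8 * φ 0 ^ 4 + 8 * c ^ 4 * (∑ i, u i * x (e (i, j))) ^ 4)
      (Measure.pi fun p => gaussianReal 0 (v p)) := (integrable_const _).add (h1.const_mul _)
  have h4 : Integrable (fun x => φ (∑ i, u i * x (e (i, j))) ^ 4)
      (Measure.pi fun p => gaussianReal 0 (v p)) := by
    refine h3.mono' (by fun_prop : Continuous fun x : ι → ℝ =>
      φ (∑ i, u i * x (e (i, j))) ^ 4).aestronglyMeasurable
      (Filter.Eventually.of_forall fun x => ?_)
    rw [Real.norm_eq_abs, abs_of_nonneg (by positivity)]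
    exact pow_four_le_of_abs_sub_le hφ _
  refine ⟨h4, (integral_mono h4 h3 fun x => pow_four_le_of_abs_sub_le hφ _).trans ?_⟩
  rw [integral_add (integrable_const _) (h1.const_mul _), integral_const_mul (8 * c ^ 4), h2]
  simp only [integral_const, probReal_univ, one_smul]
  have h5 : 0 ≤ s * ∑ i, u i ^ 2 := by positivity
  have h6 : (s * ∑ i, u i ^ 2) ^ 2 ≤ D ^ 2 := pow_le_pow_left₀ h5 hD 2
  nlinarith [mul_le_mul_of_nonneg_left h6 (by positivity : 0 ≤ c ^ 4)]

/-- Concentration of the second moments of a layer with independent Gaussian weights. -/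
lemma measureReal_average_sub_gaussMoment_le (he : Function.Injective e)
    (hs : ∀ q, (v (e q) : ℝ) = s) (hs0 : 0 ≤ s) (hφ : ∀ u v, |φ u - φ v| ≤ c * |u - v|)
    (hd : 0 < d) {u : Fin n → κ → ℝ} {D : ℝ} (hD : ∀ α, s * ∑ i, u α i ^ 2 ≤ D) {ε : ℝ}
    (hε : 0 < ε) (α β : Fin n) :
    (Measure.pi fun p => gaussianReal 0 (v p)).real {x | ε < |(d : ℝ)⁻¹ * ∑ j,
      φ (∑ i, u α i * x (e (i, j))) * φ (∑ i, u β i * x (e (i, j))) -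
        gaussMoment φ (Matrix.of fun α β => s * ∑ i, u α i * u β i) α β|} ≤
      (8 * φ 0 ^ 4 + 24 * c ^ 4 * D ^ 2) / d / ε ^ 2 := by
  classical
  have hφc := continuous_of_abs_sub_le hφ
  set μ := Measure.pi fun p => gaussianReal 0 (v p) with hμ
  set g := gaussMoment φ (Matrix.of fun α β => s * ∑ i, u α i * u β i) α β with hg
  set Z : Fin d → (ι → ℝ) → ℝ := fun j x =>
    φ (∑ i, u α i * x (e (i, j))) * φ (∑ i, u β i * x (e (i, j))) with hZ
  have hZi : ∀ j, Integrable (Z j) μ := fun j => by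
    have h := integrable_mul_of_abs_sub_le v hφ (coef e (u α) j) (coef e (u β) j)
    simpa only [sum_coef] using h
  have hZg : ∀ j, ∫ x, Z j x ∂μ = g := fun j => by
    have h := integral_mul_eq_gaussMoment v hφc (fun α => coef e (u α) j) α β
    simpa only [sum_coef, sum_coef_mul he hs] using h
  have hZc : ∀ j, Continuous (Z j) := fun j => by simp only [hZ]; fun_prop
  have hZ4 : ∀ j x, Z j x ^ 2 ≤ 1 / 2 * (φ (∑ i, u α i * x (e (i, j))) ^ 4 +
      φ (∑ i, u β i * x (e (i, j))) ^ 4) := fun j x => by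
    simp only [hZ]
    nlinarith [sq_nonneg (φ (∑ i, u α i * x (e (i, j))) ^ 2 - φ (∑ i, u β i * x (e (i, j))) ^ 2)]
  have hb := fun j => integral_comp_block_pow_four_le he hs hs0 hφ (hD α) j
  have hb' := fun j => integral_comp_block_pow_four_le he hs hs0 hφ (hD β) j
  have hbi : ∀ j, Integrable (fun x => 1 / 2 * (φ (∑ i, u α i * x (e (i, j))) ^ 4 +
      φ (∑ i, u β i * x (e (i, j))) ^ 4)) μ := fun j => ((hb j).1.add (hb' j).1).const_mul _
  have hZ2i : ∀ j, Integrable (fun x => Z j x ^ 2) μ := fun j =>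
    (hbi j).mono' ((hZc j).pow 2).aestronglyMeasurable (Filter.Eventually.of_forall fun x => by
      rw [Real.norm_eq_abs, abs_of_nonneg (sq_nonneg _)]; exact hZ4 j x)
  have hZ2 : ∀ j, ∫ x, Z j x ^ 2 ∂μ ≤ 8 * φ 0 ^ 4 + 24 * c ^ 4 * D ^ 2 := fun j => by
    refine (integral_mono (hZ2i j) (hbi j) (hZ4 j)).trans ?_
    rw [integral_const_mul, integral_add (hb j).1 (hb' j).1]
    linarith [(hb j).2, (hb' j).2]
  have hZL : ∀ j, MemLp (Z j) 2 μ := fun j =>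
    (memLp_two_iff_integrable_sq (hZc j).aestronglyMeasurable).2 (hZ2i j)
  have hYL : ∀ j, MemLp (fun x => Z j x - g) 2 μ := fun j => (hZL j).sub (memLp_const g)
  -- Unit j only reads the weights `e (i, j)`, and these columns are disjoint, so the cross terms
  -- vanish.
  have hsum := integral_sum_sq (fun p => gaussianReal 0 (v p)) (fun j x => Z j x - g)
    (fun j => {p | ∃ i, p = e (i, j)}) hYL (fun j => ((hZc j).measurable.sub_const g))
    (fun j x x' => by
      have : ∀ i, ∃ i', e (i, j) = e (i', j) := fun i => ⟨i, rfl⟩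
      simp [hZ, Set.piecewise, this])
    (fun j k hjk x x' => by
      have : ∀ i, ¬ ∃ i', e (i, k) = e (i', j) := fun i ⟨i', h⟩ =>
        hjk (by have := he h; simp only [Prod.mk.injEq] at this; exact this.2.symm)
      simp [hZ, Set.piecewise, this])
    (fun j => by rw [integral_sub (hZi j) (integrable_const g), hZg]; simp)
  have hd' : (0 : ℝ) < d := by exact_mod_cast hd
  have havg : ∀ x, (d : ℝ)⁻¹ * ∑ j, Z j x - g = (d : ℝ)⁻¹ * ∑ j, (Z j x - g) := fun x => by
    rw [Finset.sum_sub_distrib]; simp; field_simp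
  have hint : Integrable (fun x => ((d : ℝ)⁻¹ * ∑ j, Z j x - g) ^ 2) μ := by
    simp only [havg]
    exact ((memLp_finsetSum Finset.univ fun j _ => hYL j).const_mul _).integrable_sq
  have hfin : ∫ x, ((d : ℝ)⁻¹ * ∑ j, Z j x - g) ^ 2 ∂μ ≤
      (8 * φ 0 ^ 4 + 24 * c ^ 4 * D ^ 2) / d := by
    simp only [havg, mul_pow]
    rw [integral_const_mul, hsum]
    have h1 : ∀ j, ∫ x, (Z j x - g) ^ 2 ∂μ ≤ 8 * φ 0 ^ 4 + 24 * c ^ 4 * D ^ 2 := fun j =>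
      (integral_sub_sq_le (hZc j).aestronglyMeasurable (hZg j)).trans (hZ2 j)
    calc _ ≤ ((d : ℝ)⁻¹) ^ 2 * ∑ _j : Fin d, (8 * φ 0 ^ 4 + 24 * c ^ 4 * D ^ 2) := by
          gcongr with j; exact h1 j
      _ = _ := by simp; field_simp
  have h := measureReal_lt_le_of_integral (fun x => sq_nonneg _) hint (pow_pos hε 2) hfin
  refine le_trans (measureReal_mono (fun x hx => ?_) (measure_ne_top _ _)) h
  simp only [Set.mem_ofPred_eq] at hx ⊢
  rw [← sq_abs ((d : ℝ)⁻¹ * _ - g)]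
  exact pow_lt_pow_left₀ hx hε.le two_ne_zero

/-- Each fourth moment is O(1), so with the normalization d⁻² the expected sum is O(1/d), and
Markov's inequality applies. -/
lemma measureReal_sum_pow_four_le (he : Function.Injective e)
    (hs : ∀ q, (v (e q) : ℝ) = s) (hs0 : 0 ≤ s) (hφ : ∀ u v, |φ u - φ v| ≤ c * |u - v|)
    (hd : 0 < d) {u : κ → ℝ} {D : ℝ} (hD : s * ∑ i, u i ^ 2 ≤ D) {ε : ℝ} (hε : 0 < ε) :
    (Measure.pi fun p => gaussianReal 0 (v p)).real {x | ε < ((d : ℝ)⁻¹) ^ 2 * ∑ j : Fin d,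
      φ (∑ i, u i * x (e (i, j))) ^ 4} ≤ (8 * φ 0 ^ 4 + 24 * c ^ 4 * D ^ 2) / d / ε := by
  have hb := fun j => integral_comp_block_pow_four_le he hs hs0 hφ hD j
  have hd' : (0 : ℝ) < d := by exact_mod_cast hd
  refine measureReal_lt_le_of_integral (fun x => by positivity)
    ((integrable_finsetSum _ fun j _ => (hb j).1).const_mul _) hε ?_
  rw [integral_const_mul, integral_finsetSum _ fun j _ => (hb j).1]
  calc _ ≤ ((d : ℝ)⁻¹) ^ 2 * ∑ _j : Fin d, (8 * φ 0 ^ 4 + 24 * c ^ 4 * D ^ 2) := by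
        gcongr with j; exact (hb j).2
    _ = _ := by simp; field_simp

end BlockForms

/-! ### Mean square error of one diagonal kernel entry. -/

section KernelForms
variable {ι τ : Type*} [Fintype ι] [Fintype τ] {d : ℕ} {v : ι → NNReal} {m : τ → Measure ℝ}
  [∀ p, IsProbabilityMeasure (m p)] {e : Fin d → ι} {e' : Fin d → τ} {s B μ₀ : ℝ}

lemma integral_weighted_sum_sq_le (he' : Function.Injective e')
    (hB : ∀ i, ∀ᵐ a ∂(m (e' i)), |a| ≤ B) (hμ : ∀ i, ∫ a, a ∂(m (e' i)) = μ₀) (w : Fin d → ℝ) :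
    Integrable (fun a => (∑ i, (a (e' i) - μ₀) * w i) ^ 2) (Measure.pi m) ∧
    ∫ a, (∑ i, (a (e' i) - μ₀) * w i) ^ 2 ∂(Measure.pi m) ≤ B ^ 2 * ∑ i, w i ^ 2 := by
  classical
  have hB' : ∀ i, ∀ᵐ a ∂(Measure.pi m), |a (e' i)| ≤ B := fun i =>
    (measurePreserving_eval m (e' i)).quasiMeasurePreserving.ae (hB i)
  have hL : ∀ i, MemLp (fun a : τ → ℝ => a (e' i)) 2 (Measure.pi m) := fun i =>
    MemLp.of_bound (measurable_pi_apply (e' i)).aestronglyMeasurable B (by simpa using hB' i)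
  have hi : ∀ i, Integrable (fun a : τ → ℝ => a (e' i)) (Measure.pi m) := fun i =>
    (hL i).integrable one_le_two
  have hev : ∀ i, ∫ a, a (e' i) ∂(Measure.pi m) = μ₀ := fun i => by
    rw [← hμ i]
    exact integral_comp_eval (μ := m) (i := e' i) (f := fun a => a) (by fun_prop)
  have hYL : ∀ i, MemLp (fun a : τ → ℝ => (a (e' i) - μ₀) * w i) 2 (Measure.pi m) := fun i =>
    ((hL i).sub (memLp_const μ₀)).mul_const (w i)
  refine ⟨(memLp_finsetSum Finset.univ fun i _ => hYL i).integrable_sq, ?_⟩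
  rw [integral_sum_sq m (fun i a => (a (e' i) - μ₀) * w i) (fun i => {e' i}) hYL
    (fun i => by fun_prop) (fun i x x' => by simp [Set.piecewise])
    (fun i k hik x x' => by simp [Set.piecewise, he'.eq_iff, hik.symm])
    (fun i => by
      rw [integral_mul_const, integral_sub (hi i) (integrable_const _), hev]; simp), Finset.mul_sum]
  refine Finset.sum_le_sum fun i _ => ?_
  simp only [mul_pow]
  rw [integral_mul_const]
  refine mul_le_mul_of_nonneg_right ?_ (sq_nonneg _)
  refine (integral_sub_sq_le (hL i).1 (hev i)).trans ?_
  have h3 : ∫ a, a (e' i) ^ 2 ∂(Measure.pi m) ≤ ∫ _, B ^ 2 ∂(Measure.pi m) :=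
    integral_mono_ae (hL i).integrable_sq (integrable_const _) ((hB' i).mono fun a ha => by
      beta_reduce
      rw [← sq_abs]; exact pow_le_pow_left₀ (abs_nonneg _) ha 2)
  simpa using h3

/-- The mean square error of a quadratic form in Gaussian weights plus a weighted average. -/
lemma integral_quadratic_add_average_sub_sq_le (he : Function.Injective e)
    (he' : Function.Injective e') (hs : ∀ i, (v (e i) : ℝ) = s)
    (hB : ∀ i, ∀ᵐ a ∂(m (e' i)), |a| ≤ B) (hμ : ∀ i, ∫ a, a ∂(m (e' i)) = μ₀)
    (M : Matrix (Fin d) (Fin d) ℝ) (w : Fin d → ℝ) (T : ℝ) :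
    Integrable (fun z : (ι → ℝ) × (τ → ℝ) => (∑ i, ∑ j, M i j * (z.1 (e i) * z.1 (e j)) +
      (d : ℝ)⁻¹ * ∑ i, z.2 (e' i) * w i - T) ^ 2)
      ((Measure.pi fun p => gaussianReal 0 (v p)).prod (Measure.pi m)) ∧
    ∫ z : (ι → ℝ) × (τ → ℝ), (∑ i, ∑ j, M i j * (z.1 (e i) * z.1 (e j)) +
      (d : ℝ)⁻¹ * ∑ i, z.2 (e' i) * w i - T) ^ 2
      ∂((Measure.pi fun p => gaussianReal 0 (v p)).prod (Measure.pi m)) ≤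
      3 * (2 * s ^ 2 * ∑ i, ∑ j, M i j ^ 2 + ((d : ℝ)⁻¹) ^ 2 * (B ^ 2 * ∑ i, w i ^ 2) +
        (s * ∑ i, M i i + μ₀ * ((d : ℝ)⁻¹ * ∑ i, w i) - T) ^ 2) := by
  obtain ⟨q1, q2⟩ := integral_quadratic_sub_sq_le v he hs M
  obtain ⟨r1, r2⟩ := integral_weighted_sum_sq_le he' hB hμ w
  set P := Measure.pi fun p => gaussianReal 0 (v p)
  set b := s * ∑ i, M i i + μ₀ * ((d : ℝ)⁻¹ * ∑ i, w i) - T with hb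
  -- Decomposition into the fluctuation of the quadratic form, the fluctuation of the weight terms
  -- and the deterministic bias b, by (x + y + b)² ≤ 3 (x² + y² + b²).
  have hle : ∀ z : (ι → ℝ) × (τ → ℝ), (∑ i, ∑ j, M i j * (z.1 (e i) * z.1 (e j)) +
      (d : ℝ)⁻¹ * ∑ i, z.2 (e' i) * w i - T) ^ 2 ≤
      3 * ((∑ i, ∑ j, M i j * (z.1 (e i) * z.1 (e j)) - s * ∑ i, M i i) ^ 2 +
        ((d : ℝ)⁻¹) ^ 2 * (∑ i, (z.2 (e' i) - μ₀) * w i) ^ 2 + b ^ 2) := fun z => by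
    have h1 : ∑ i, (z.2 (e' i) - μ₀) * w i = ∑ i, z.2 (e' i) * w i - μ₀ * ∑ i, w i := by
      simp only [sub_mul, Finset.sum_sub_distrib, Finset.mul_sum]
    set x := ∑ i, ∑ j, M i j * (z.1 (e i) * z.1 (e j)) - s * ∑ i, M i i with hx
    set y := (d : ℝ)⁻¹ * ∑ i, (z.2 (e' i) - μ₀) * w i with hy
    have h2 : ∑ i, ∑ j, M i j * (z.1 (e i) * z.1 (e j)) +
      (d : ℝ)⁻¹ * ∑ i, z.2 (e' i) * w i - T = x + y + b := by
      rw [hx, hy, hb, h1]; ring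
    rw [h2, ← mul_pow, ← hy]
    nlinarith [sq_nonneg (x - y), sq_nonneg (x - b), sq_nonneg (y - b)]
  have hQ := q1.comp_fst (Measure.pi m)
  have hR := r1.comp_snd P
  have hint := ((hQ.add (hR.const_mul (((d : ℝ)⁻¹) ^ 2))).add
    (integrable_const (b ^ 2))).const_mul 3
  have hmeas : Measurable fun z : (ι → ℝ) × (τ → ℝ) => (∑ i, ∑ j, M i j *
      (z.1 (e i) * z.1 (e j)) + (d : ℝ)⁻¹ * ∑ i, z.2 (e' i) * w i - T) ^ 2 := by fun_prop
  have hF : Integrable (fun z : (ι → ℝ) × (τ → ℝ) => (∑ i, ∑ j, M i j * (z.1 (e i) * z.1 (e j)) +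
      (d : ℝ)⁻¹ * ∑ i, z.2 (e' i) * w i - T) ^ 2) (P.prod (Measure.pi m)) :=
    hint.mono' hmeas.aestronglyMeasurable (Filter.Eventually.of_forall fun z => by
      rw [Real.norm_eq_abs, abs_of_nonneg (sq_nonneg _)]; exact hle z)
  refine ⟨hF, (integral_mono hF hint hle).trans ?_⟩
  have e1 := integral_add (hQ.add (hR.const_mul (((d : ℝ)⁻¹) ^ 2))) (integrable_const (b ^ 2))
  have e2 := integral_add hQ (hR.const_mul (((d : ℝ)⁻¹) ^ 2))
  have e3 := integral_fun_fst (μ := P) (ν := Measure.pi m)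
    fun x => (∑ i, ∑ j, M i j * (x (e i) * x (e j)) - s * ∑ i, M i i) ^ 2
  have e4 := integral_fun_snd (μ := P) (ν := Measure.pi m)
    fun a => (∑ i, (a (e' i) - μ₀) * w i) ^ 2
  simp only [Pi.add_apply] at e1 e2 ⊢
  rw [integral_const_mul, e1, e2, integral_const_mul, e3, e4]
  simp only [integral_const, probReal_univ, one_smul]
  have h5 := mul_le_mul_of_nonneg_left r2 (sq_nonneg ((d : ℝ)⁻¹))
  linarith

end KernelForms

/-! ### Events of high probability and conditioning on all layers but one. -/

instance (L d₀ d : ℕ) (σw : ℝ) : IsProbabilityMeasure (initMeasure L d₀ d σw) := by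
  unfold initMeasure; infer_instance

instance (L d₀ d : ℕ) (ρ : ℕ → Measure ℝ) [∀ l, IsProbabilityMeasure (ρ l)] :
    IsProbabilityMeasure (weightMeasure L d₀ d ρ) := by
  unfold weightMeasure; infer_instance

instance (L d₀ d : ℕ) (σw : ℝ) (ρ : ℕ → Measure ℝ) [∀ l, IsProbabilityMeasure (ρ l)] :
    IsProbabilityMeasure (jointMeasure L d₀ d σw ρ) := by
  unfold jointMeasure; infer_instance

/-- The parameters `x` with those of the layer `k` replaced by those of `z`. -/
def resample {L d₀ d : ℕ} (k : ℕ) (x z : ParamIdx L d₀ d → ℝ) (p : ParamIdx L d₀ d) : ℝ :=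
  if layerOf p = k then z p else x p

lemma resample_of_lt {L d₀ d k : ℕ} (x z : ParamIdx L d₀ d → ℝ) {p : ParamIdx L d₀ d}
    (hp : layerOf p < k) : resample k x z p = x p := if_neg hp.ne

section Whp
variable {L d₀ : ℕ} {σw : ℝ} {ρ : ℕ → Measure ℝ} [∀ l, IsProbabilityMeasure (ρ l)]

/-- The events `E d` have probability tending to one as the width `d` grows. -/
def Whp (σw : ℝ) (ρ : ℕ → Measure ℝ)
    (E : ∀ d, Set ((ParamIdx L d₀ d → ℝ) × (ParamIdx L d₀ d → ℝ))) : Prop :=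
  ∀ δ : ℝ, 0 < δ → ∃ N : ℕ, ∀ d, N ≤ d → (jointMeasure L d₀ d σw ρ).real (E d)ᶜ ≤ δ

variable {E F : ∀ d, Set ((ParamIdx L d₀ d → ℝ) × (ParamIdx L d₀ d → ℝ))}

lemma Whp.mono (hE : Whp σw ρ E) (N₀ : ℕ) (h : ∀ d, N₀ ≤ d → E d ⊆ F d) : Whp σw ρ F := by
  intro δ hδ
  obtain ⟨N, hN⟩ := hE δ hδ
  refine ⟨max N N₀, fun d hd => le_trans (measureReal_mono ?_ (measure_ne_top _ _))
    (hN d (le_of_max_le_left hd))⟩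
  exact Set.compl_subset_compl.2 (h d (le_of_max_le_right hd))

omit [∀ l, IsProbabilityMeasure (ρ l)] in
lemma Whp.inter (hE : Whp σw ρ E) (hF : Whp σw ρ F) : Whp σw ρ fun d => E d ∩ F d := by
  intro δ hδ
  obtain ⟨N, hN⟩ := hE (δ / 2) (half_pos hδ)
  obtain ⟨N', hN'⟩ := hF (δ / 2) (half_pos hδ)
  refine ⟨max N N', fun d hd => ?_⟩
  rw [Set.compl_inter]
  refine (measureReal_union_le _ _).trans ?_
  linarith [hN d (le_of_max_le_left hd), hN' d (le_of_max_le_right hd)]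

omit [∀ l, IsProbabilityMeasure (ρ l)] in
lemma whp_of_forall (N : ℕ) (h : ∀ d, N ≤ d → ∀ ω, ω ∈ E d) : Whp σw ρ E := fun δ hδ =>
  ⟨N, fun d hd => by rw [Set.eq_univ_of_forall (h d hd)]; simpa using hδ.le⟩

lemma whp_forall {τ : Type*} [Finite τ]
    {E : τ → ∀ d, Set ((ParamIdx L d₀ d → ℝ) × (ParamIdx L d₀ d → ℝ))}
    (h : ∀ i, Whp σw ρ (E i)) : Whp σw ρ fun d => {ω | ∀ i, ω ∈ E i d} := by
  classical
  have := Fintype.ofFinite τ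
  have key : ∀ s : Finset τ, Whp σw ρ fun d => {ω | ∀ i ∈ s, ω ∈ E i d} := fun s => by
    induction s using Finset.induction_on with
    | empty => exact whp_of_forall 0 fun d _ ω => by simp
    | insert i s _ ih =>
      refine ((h i).inter ih).mono 0 fun d _ ω hω j hj => ?_
      rcases Finset.mem_insert.1 hj with rfl | hj
      exacts [hω.1, hω.2 j hj]
  exact (key Finset.univ).mono 0 fun d _ ω hω i => hω i (Finset.mem_univ i)

omit [∀ l, IsProbabilityMeasure (ρ l)] in
lemma whp_of_le (b : ℕ → ℝ) (hb : Filter.Tendsto b Filter.atTop (nhds 0)) (N₀ : ℕ)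
    (h : ∀ d, N₀ ≤ d → (jointMeasure L d₀ d σw ρ).real (E d)ᶜ ≤ b d) : Whp σw ρ E := by
  intro δ hδ
  obtain ⟨N, hN⟩ := Filter.eventually_atTop.1 (hb.eventually_le_const hδ)
  exact ⟨max N N₀, fun d hd => (h d (le_of_max_le_right hd)).trans (hN d (le_of_max_le_left hd))⟩

lemma jointMeasure_real_fst (d : ℕ)
    (A : Set (ParamIdx L d₀ d → ℝ)) :
    (jointMeasure L d₀ d σw ρ).real {z | z.1 ∈ A} = (initMeasure L d₀ d σw).real A := by
  have h : {z : (ParamIdx L d₀ d → ℝ) × (ParamIdx L d₀ d → ℝ) | z.1 ∈ A} = A ×ˢ Set.univ := by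
    ext z; simp
  have h0 : IsProbabilityMeasure (weightMeasure L d₀ d ρ) := inferInstance
  have : SFinite (weightMeasure L d₀ d ρ) := inferInstance
  rw [h, measureReal_def, jointMeasure, Measure.prod_prod]
  simp [measureReal_def]

/-- A union bound, conditionally on the layers other than the `k`-th. -/
lemma measureReal_compl_le_of_resample (k d : ℕ)
    {G E : Set ((ParamIdx L d₀ d → ℝ) × (ParamIdx L d₀ d → ℝ))} (hG : MeasurableSet G)
    (hE : MeasurableSet E)
    (hinv : ∀ x x' y y', (resample k x x', resample k y y') ∈ G → (x, y) ∈ G) {b : ℝ} (hb : 0 ≤ b)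
    (h : ∀ x y, (x, y) ∈ G → (jointMeasure L d₀ d σw ρ).real
        {z | (resample k x z.1, resample k y z.2) ∉ E} ≤ b) :
    (jointMeasure L d₀ d σw ρ).real Eᶜ ≤ (jointMeasure L d₀ d σw ρ).real Gᶜ + b := by
  classical
  have hp : ∀ (x z : ParamIdx L d₀ d → ℝ)
      [∀ p, Decidable (p ∈ ({p | layerOf p = k} : Set (ParamIdx L d₀ d)))],
      ({p | layerOf p = k} : Set (ParamIdx L d₀ d)).piecewise z x = resample k x z := fun x z _ => by
    ext p; simp [resample, Set.piecewise]
  have h1 : (jointMeasure L d₀ d σw ρ).real (G ∩ Eᶜ) ≤ b := by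
    refine measureReal_inter_le_of_resample _ _ {p | layerOf p = k} {p | layerOf p = k}
      (hG.inter hE.compl) hb (fun x x' y y' h => hinv x x' y y' ?_) (fun x y hxy => ?_)
    · simpa only [hp] using h
    · simp only [hp]
      exact h x y hxy
  have h2 : Eᶜ ⊆ Gᶜ ∪ (G ∩ Eᶜ) := fun ω hω => by
    by_cases hg : ω ∈ G
    · exact Or.inr ⟨hg, hω⟩
    · exact Or.inl hg
  refine (measureReal_mono h2 (measure_ne_top _ _)).trans ((measureReal_union_le _ _).trans ?_)
  linarith

/-- To show an event with high probability, one may condition on the layers other than the `k`-th,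
which are on an event with high probability. -/
lemma whp_of_resample (k : ℕ) (hE : ∀ d, MeasurableSet (E d))
    (h : ∀ δ : ℝ, 0 < δ → ∃ G : ∀ d, Set ((ParamIdx L d₀ d → ℝ) × (ParamIdx L d₀ d → ℝ)),
      Whp σw ρ G ∧ (∀ d, MeasurableSet (G d)) ∧
      (∀ d x x' y y', (resample k x x', resample k y y') ∈ G d → (x, y) ∈ G d) ∧
      ∃ N : ℕ, ∀ d, N ≤ d → ∀ x y, (x, y) ∈ G d → (jointMeasure L d₀ d σw ρ).real
        {z | (resample k x z.1, resample k y z.2) ∉ E d} ≤ δ) :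
    Whp σw ρ E := by
  intro δ hδ
  obtain ⟨G, hG, hGm, hinv, N, hN⟩ := h (δ / 2) (half_pos hδ)
  obtain ⟨N', hN'⟩ := hG (δ / 2) (half_pos hδ)
  refine ⟨max N N', fun d hd => (measureReal_compl_le_of_resample k d (hGm d) (hE d) (hinv d)
    (half_pos hδ).le (hN d (le_of_max_le_left hd))).trans ?_⟩
  linarith [hN' d (le_of_max_le_right hd)]

end Whp

/-! ### Which layers each quantity depends on; continuity in the parameters. -/

section Layers
variable {L d₀ d n : ℕ}

lemma mid_congr {θ θ' : ParamIdx L d₀ d → ℝ} {l : ℕ}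
    (h : ∀ p : ParamIdx L d₀ d, layerOf p = l + 2 → θ p = θ' p) : mid θ l = mid θ' l := by
  ext i j
  by_cases hl : l < L - 2
  · rw [mid_apply hl, mid_apply hl, h _ rfl]
  · simp [mid, hl]

lemma first_congr {θ θ' : ParamIdx L d₀ d → ℝ}
    (h : ∀ p : ParamIdx L d₀ d, layerOf p = 1 → θ p = θ' p) : first θ = first θ' := by
  ext i j; exact h _ rfl

lemma pre_congr (σ : ℝ → ℝ) {θ θ' : ParamIdx L d₀ d → ℝ} (x : Fin d₀ → ℝ) :
    ∀ {l : ℕ}, (∀ p : ParamIdx L d₀ d, layerOf p ≤ l + 1 → θ p = θ' p) →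
      pre σ θ x l = pre σ θ' x l
  | 0, h => by rw [pre, pre, first_congr fun p hp => h p hp.le]
  | l + 1, h => by
    rw [pre, pre, pre_congr σ x (fun p hp => h p (hp.trans (Nat.le_succ _))),
      mid_congr fun p hp => h p hp.le]

lemma kern_congr (σ : ℝ → ℝ) {a a' θ θ' : ParamIdx L d₀ d → ℝ} (x x' : Fin d₀ → ℝ) :
    ∀ {l : ℕ}, (∀ p : ParamIdx L d₀ d, layerOf p ≤ l + 1 → θ p = θ' p) →
      (∀ p : ParamIdx L d₀ d, layerOf p ≤ l + 1 → a p = a' p) →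
      kern σ a θ x x' l = kern σ a' θ' x x' l
  | 0, h, h' => by rw [kern, kern, first_congr fun p hp => h' p hp.le]
  | l + 1, h, h' => by
    have h1 : ∀ p : ParamIdx L d₀ d, layerOf p ≤ l + 1 → θ p = θ' p := fun p hp =>
      h p (hp.trans (Nat.le_succ _))
    rw [kern, kern, kern_congr σ x x' h1 fun p hp => h' p (hp.trans (Nat.le_succ _)),
      mid_congr fun p hp => h p hp.le, mid_congr fun p hp => h' p hp.le, pre_congr σ x h1,
      pre_congr σ x' h1]
    simp only [act, pre_congr σ x h1, pre_congr σ x' h1]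

variable {σ : ℝ → ℝ} {c : ℝ}

lemma Smooth.continuous_deriv (hσ : Smooth σ c) : Continuous (deriv σ) :=
  continuous_of_abs_sub_le hσ.lip

lemma continuous_pre (hσ : Smooth σ c) (x : Fin d₀ → ℝ) (l : ℕ) (j : Fin d) :
    Continuous fun θ : ParamIdx L d₀ d → ℝ => pre σ θ x l j :=
  (differentiable_pre hσ.diff x l j).continuous

lemma continuous_mid (l : ℕ) (i j : Fin d) :
    Continuous fun θ : ParamIdx L d₀ d → ℝ => mid θ l i j := by
  simp only [mid, Matrix.of_apply]
  split_ifs <;> fun_prop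

lemma continuous_kern (hσ : Smooth σ c) (x x' : Fin d₀ → ℝ) (l : ℕ) (i j : Fin d) :
    Continuous fun ω : (ParamIdx L d₀ d → ℝ) × (ParamIdx L d₀ d → ℝ) =>
      kern σ ω.2 ω.1 x x' l i j := by
  have hσ' := hσ.continuous_deriv
  have hσc := hσ.diff.continuous
  induction l generalizing i j with
  | zero =>
    simp only [kern, Matrix.diagonal_apply, first, Matrix.of_apply]
    split_ifs <;> fun_prop
  | succ l ih =>
    have h1 := fun x j => (continuous_pre (L := L) (d := d) hσ x l j).comp continuous_fst
      (X := (ParamIdx L d₀ d → ℝ) × (ParamIdx L d₀ d → ℝ))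
    have h2 := fun i j => (continuous_mid (L := L) (d₀ := d₀) (d := d) l i j).comp continuous_fst
      (X := (ParamIdx L d₀ d → ℝ) × (ParamIdx L d₀ d → ℝ))
    have h3 := fun i j => (continuous_mid (L := L) (d₀ := d₀) (d := d) l i j).comp continuous_snd
      (X := (ParamIdx L d₀ d → ℝ) × (ParamIdx L d₀ d → ℝ))
    simp only [Function.comp_def] at h1 h2 h3
    simp only [kern, Matrix.add_apply, Matrix.mul_apply, Matrix.transpose_apply, act]
    refine Continuous.add ?_ ?_
    · simp only [Matrix.diagonal_apply, ite_mul, zero_mul, mul_ite, mul_zero, Finset.sum_ite_eq,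
        Finset.sum_ite_eq', Finset.mem_univ, if_true]
      fun_prop
    · simp only [Matrix.diagonal_apply]
      split_ifs <;> fun_prop

lemma isClosed_opB {Ω : Type*} [TopologicalSpace Ω] {ι κ : Type*} [Fintype ι] [Fintype κ]
    {M : Ω → Matrix ι κ ℝ} (hM : ∀ i j, Continuous fun ω => M ω i j) (K : ℝ) :
    IsClosed {ω | OpB (M ω) K} := by
  have h : {ω | OpB (M ω) K} = {_ω | 0 ≤ K} ∩ ⋂ v : κ → ℝ, {ω | l2 (M ω *ᵥ v) ≤ K * l2 v} := by
    ext ω; simp [OpB]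
  rw [h]
  refine isClosed_const.inter (isClosed_iInter fun v => isClosed_le ?_ continuous_const)
  simp only [l2, Matrix.mulVec, dotProduct]
  fun_prop

/-- The covariance of the pre-activations of a hidden layer given the layers below. -/
def empCov (σ : ℝ → ℝ) (σw : ℝ) (X : Fin n → Fin d₀ → ℝ) (θ : ParamIdx L d₀ d → ℝ) :
    ℕ → Matrix (Fin n) (Fin n) ℝ
  | 0 => preCov σ σw X 0
  | l + 1 => Matrix.of fun α β => σw ^ 2 * ((d : ℝ)⁻¹ * ∑ i, act σ θ (X α) l i * act σ θ (X β) l i)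

lemma empCov_congr (σ : ℝ → ℝ) (σw : ℝ) (X : Fin n → Fin d₀ → ℝ) {θ θ' : ParamIdx L d₀ d → ℝ} :
    ∀ {l : ℕ}, (∀ p : ParamIdx L d₀ d, layerOf p ≤ l → θ p = θ' p) →
      empCov σ σw X θ l = empCov σ σw X θ' l
  | 0, _ => rfl
  | l + 1, h => by simp only [empCov, act, pre_congr σ _ h]

lemma continuous_empCov (hσ : Smooth σ c) (σw : ℝ) (X : Fin n → Fin d₀ → ℝ) (α β : Fin n) :
    ∀ l, Continuous fun θ : ParamIdx L d₀ d → ℝ => empCov σ σw X θ l α β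
  | 0 => continuous_const
  | l + 1 => by
    have h1 := fun x j => continuous_pre (L := L) (d₀ := d₀) (d := d) hσ x l j
    have hσc := hσ.diff.continuous
    simp only [empCov, Matrix.of_apply, act]
    fun_prop

lemma posSemidef_empCov (hσ : Smooth σ c) (σw : ℝ) (X : Fin n → Fin d₀ → ℝ)
    (θ : ParamIdx L d₀ d → ℝ) : ∀ l, (empCov σ σw X θ l).PosSemidef
  | 0 => posSemidef_preCov hσ.abs_sub_le σw X 0
  | l + 1 => by
    have h := posSemidef_gram (fun _ : Fin d => (σw ^ 2 * (d : ℝ)⁻¹).toNNReal)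
      fun α => act σ θ (X α) l
    have h0 : (0 : ℝ) ≤ σw ^ 2 * (d : ℝ)⁻¹ := by positivity
    simp only [Real.coe_toNNReal _ h0, ← Finset.mul_sum, mul_assoc] at h
    exact h

/-- Given the layers below, the pre-activations are linear in independent Gaussian weights. -/
lemma exists_block (σ : ℝ → ℝ) (σw : ℝ) (X : Fin n → Fin d₀ → ℝ) (x : ParamIdx L d₀ d → ℝ) {l : ℕ}
    (hl : l ≤ L - 2) :
    ∃ (k : ℕ) (e : Fin k × Fin d → ParamIdx L d₀ d) (u : Fin n → Fin k → ℝ) (s : ℝ),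
      Function.Injective e ∧ 0 ≤ s ∧
      (∀ q, ((Real.toNNReal (σw ^ 2 / fanIn (e q)) : NNReal) : ℝ) = s) ∧
      (∀ z α j, pre σ (resample (l + 1) x z) (X α) l j =
        ∑ i, u α i * z (e (i, j))) ∧
      ∀ α β, s * ∑ i, u α i * u β i = empCov σ σw X x l α β := by
  cases l with
  | zero =>
    -- In the first layer the coefficients are the inputs and the conditional covariance is exactly
    -- the limiting one.
    refine ⟨d₀, Sum.inl, X, σw ^ 2 / d₀, Sum.inl_injective, by positivity,
      fun q => Real.coe_toNNReal _ (by positivity), fun z α j => ?_, fun α β => rfl⟩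
    simp [pre, Matrix.vecMul, dotProduct, first, resample, layerOf]
  | succ l =>
    have hl' : l < L - 2 := hl
    refine ⟨d, fun q => .inr (.inl (⟨l, hl'⟩, q)), fun α => act σ x (X α) l, σw ^ 2 / d,
      fun q q' h => by simpa using h, by positivity, fun q => Real.coe_toNNReal _ (by positivity),
      fun z α j => ?_, fun α β => by simp [empCov]; ring⟩
    have h1 : act σ (resample (l + 1 + 1) x z) (X α) l =
        act σ x (X α) l := by
      unfold act
      rw [pre_congr σ (X α) fun p hp => resample_of_lt x z (Nat.lt_succ_of_le hp)]
    rw [pre_succ, h1]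
    simp [Matrix.vecMul, dotProduct, mid_apply hl', resample, layerOf]

end Layers

lemma exists_nat_div_le (M : ℝ) {δ : ℝ} (hδ : 0 < δ) :
    ∃ N : ℕ, 0 < N ∧ ∀ d : ℕ, N ≤ d → M / d ≤ δ := by
  obtain ⟨N, hN⟩ := exists_nat_gt (M / δ)
  refine ⟨N + 1, N.succ_pos, fun d hd => ?_⟩
  have hd' : (N : ℝ) + 1 ≤ d := by exact_mod_cast hd
  have hd0 : (0 : ℝ) < d := by linarith [N.cast_nonneg (α := ℝ)]
  rw [div_lt_iff₀ hδ] at hN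
  rw [div_le_iff₀ hd0]
  nlinarith

/-! ### Convergence of the layer moments and high-probability bounds on weights and activations. -/

section Moments
variable {L d₀ n : ℕ} {σw : ℝ} {ρ : ℕ → Measure ℝ} [∀ l, IsProbabilityMeasure (ρ l)]
  {σ : ℝ → ℝ} {c : ℝ} (X : Fin n → Fin d₀ → ℝ)

lemma isClosed_empCov_close (hσ : Smooth σ c) (d l : ℕ) (ε : ℝ) :
    IsClosed {ω : (ParamIdx L d₀ d → ℝ) × (ParamIdx L d₀ d → ℝ) |
      ∀ α β, |empCov σ σw X ω.1 l α β - preCov σ σw X l α β| ≤ ε} := by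
  simp only [Set.ofPred_forall]
  refine isClosed_iInter fun α => isClosed_iInter fun β => isClosed_le ?_ continuous_const
  exact (((continuous_empCov hσ σw X α β l).comp continuous_fst).sub continuous_const).abs

/-- Given the layers below, the average concentrates at the Gaussian moment for the empirical
covariance, and continuity of the moment replaces it by the limiting covariance. Closeness of the
covariances is a hypothesis because `whp_empCov` uses this lemma in its induction. -/
lemma whp_moment (hσ : Smooth σ c) {φ : ℝ → ℝ} {c' : ℝ} (hc' : 0 ≤ c')
    (hφ : ∀ u v, |φ u - φ v| ≤ c' * |u - v|) {l : ℕ} (hl : l ≤ L - 2)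
    (hcov : ∀ ε : ℝ, 0 < ε → Whp (L := L) σw ρ fun d =>
      {ω | ∀ α β, |empCov σ σw X ω.1 l α β - preCov σ σw X l α β| ≤ ε})
    {ε : ℝ} (hε : 0 < ε) (α β : Fin n) :
    Whp (L := L) σw ρ fun d => {ω | |(d : ℝ)⁻¹ * ∑ j : Fin d, φ (pre σ ω.1 (X α) l j) *
      φ (pre σ ω.1 (X β) l j) - gaussMoment φ (preCov σ σw X l) α β| ≤ ε} := by
  have hφc := continuous_of_abs_sub_le hφ
  refine whp_of_resample (l + 1) (fun d => (isClosed_le ?_ continuous_const).measurableSet) ?_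
  · have h1 := fun x j => (continuous_pre (L := L) (d₀ := d₀) (d := d) hσ x l j).comp continuous_fst
      (X := (ParamIdx L d₀ d → ℝ) × (ParamIdx L d₀ d → ℝ))
    simp only [Function.comp_def] at h1
    fun_prop
  intro δ hδ
  obtain ⟨δ₁, hδ₁, hcont⟩ := exists_abs_gaussMoment_sub_le hc' hφ
    (posSemidef_preCov hσ.abs_sub_le σw X l) (half_pos hε)
  -- A bound for the empirical variances, which are within 1 of the limiting ones on the
  -- conditioning event.
  set D := ∑ α, |preCov σ σw X l α α| + 1 with hD
  obtain ⟨N, hN0, hN⟩ := exists_nat_div_le ((8 * φ 0 ^ 4 + 24 * c' ^ 4 * D ^ 2) / (ε / 2) ^ 2) hδ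
  refine ⟨_, hcov (min δ₁ 1) (lt_min hδ₁ one_pos),
    fun d => (isClosed_empCov_close X hσ d l _).measurableSet, fun d x x' y y' h => ?_,
    N, fun d hd x y h => ?_⟩
  · simp only [Set.mem_ofPred_eq] at h ⊢
    rwa [empCov_congr σ σw X fun p hp => resample_of_lt x x' (Nat.lt_succ_of_le hp)] at h
  · simp only [Set.mem_ofPred_eq] at h
    obtain ⟨k, e, u, s, he, hs0, hs, hpre, hemp⟩ := exists_block σ σw X x hl
    have hmat : (Matrix.of fun α β => s * ∑ i, u α i * u β i) = empCov σ σw X x l := by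
      ext α β; exact hemp α β
    have hDb : ∀ α, s * ∑ i, u α i ^ 2 ≤ D := fun α => by
      have h1 := hemp α α
      have h2 := (abs_le.1 ((h α α).trans (min_le_right _ _))).2
      have h3 := Finset.single_le_sum (f := fun α => |preCov σ σw X l α α|)
        (fun _ _ => abs_nonneg _) (Finset.mem_univ α)
      have h4 := le_abs_self (preCov σ σw X l α α)
      simp only [← sq] at h1
      rw [h1]; linarith
    have hbound := measureReal_average_sub_gaussMoment_le
      (v := fun p : ParamIdx L d₀ d => Real.toNNReal (σw ^ 2 / fanIn p)) he hs hs0 hφ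
      (hN0.trans_le hd) hDb (half_pos hε) α β
    rw [hmat] at hbound
    have hg := hcont (empCov σ σw X x l) (posSemidef_empCov hσ σw X x l)
      (fun α β => (h α β).trans (min_le_left _ _)) α β
    calc _ = (jointMeasure L d₀ d σw ρ).real {z | z.1 ∈ {z : ParamIdx L d₀ d → ℝ | ¬
          |(d : ℝ)⁻¹ * ∑ j : Fin d, φ (pre σ (resample (l + 1) x z) (X α) l j) *
          φ (pre σ (resample (l + 1) x z) (X β) l j) -
            gaussMoment φ (preCov σ σw X l) α β| ≤ ε}} := rfl
      _ ≤ _ := by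
        rw [jointMeasure_real_fst]
        refine (measureReal_mono (fun z hz => ?_) (measure_ne_top _ _)).trans hbound
        simp only [Set.mem_ofPred_eq, hpre, not_le] at hz ⊢
        have h5 := abs_sub_le ((d : ℝ)⁻¹ * ∑ j : Fin d, φ (∑ i, u α i * z (e (i, j))) *
          φ (∑ i, u β i * z (e (i, j)))) (gaussMoment φ (empCov σ σw X x l) α β)
          (gaussMoment φ (preCov σ σw X l) α β)
        linarith
      _ = _ := div_right_comm _ _ _
      _ ≤ δ := hN d hd

lemma whp_act_pow_four (hσ : Smooth σ c) {l : ℕ} (hl : l ≤ L - 2)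
    (hcov : ∀ ε : ℝ, 0 < ε → Whp (L := L) σw ρ fun d =>
      {ω | ∀ α β, |empCov σ σw X ω.1 l α β - preCov σ σw X l α β| ≤ ε})
    {ε : ℝ} (hε : 0 < ε) (α : Fin n) :
    Whp (L := L) σw ρ fun d =>
      {ω | ((d : ℝ)⁻¹) ^ 2 * ∑ j : Fin d, σ (pre σ ω.1 (X α) l j) ^ 4 ≤ ε} := by
  have hσc := hσ.diff.continuous
  refine whp_of_resample (l + 1) (fun d => (isClosed_le ?_ continuous_const).measurableSet) ?_
  · have h1 := fun x j => (continuous_pre (L := L) (d₀ := d₀) (d := d) hσ x l j).comp continuous_fst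
      (X := (ParamIdx L d₀ d → ℝ) × (ParamIdx L d₀ d → ℝ))
    simp only [Function.comp_def] at h1
    fun_prop
  intro δ hδ
  set D := preCov σ σw X l α α + 1 with hD
  obtain ⟨N, hN0, hN⟩ := exists_nat_div_le ((8 * σ 0 ^ 4 + 24 * c ^ 4 * D ^ 2) / ε) hδ
  refine ⟨_, hcov 1 one_pos,
    fun d => (isClosed_empCov_close X hσ d l _).measurableSet, fun d x x' y y' h => ?_,
    N, fun d hd x y h => ?_⟩
  · simp only [Set.mem_ofPred_eq] at h ⊢
    rwa [empCov_congr σ σw X fun p hp => resample_of_lt x x' (Nat.lt_succ_of_le hp)] at h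
  · simp only [Set.mem_ofPred_eq] at h
    obtain ⟨k, e, u, s, he, hs0, hs, hpre, hemp⟩ := exists_block σ σw X x hl
    have hDb : s * ∑ i, u α i ^ 2 ≤ D := by
      have h1 := hemp α α
      have h2 := (abs_le.1 (h α α)).2
      simp only [← sq] at h1
      rw [h1]; linarith
    have hbound := measureReal_sum_pow_four_le
      (v := fun p : ParamIdx L d₀ d => Real.toNNReal (σw ^ 2 / fanIn p)) he hs hs0 hσ.abs_sub_le
      (hN0.trans_le hd) hDb hε
    calc _ = (jointMeasure L d₀ d σw ρ).real {z | z.1 ∈ {z : ParamIdx L d₀ d → ℝ | ¬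
          ((d : ℝ)⁻¹) ^ 2 * ∑ j : Fin d, σ (pre σ (resample (l + 1) x z) (X α) l j) ^ 4 ≤ ε}} := rfl
      _ ≤ _ := by
        rw [jointMeasure_real_fst]
        refine (measureReal_mono (fun z hz => ?_) (measure_ne_top _ _)).trans hbound
        simpa only [Set.mem_ofPred_eq, hpre, not_le] using hz
      _ = _ := div_right_comm _ _ _
      _ ≤ δ := hN d hd

/-- The second moments of the activations at one layer are, up to σ_w², the covariance at the next.
-/
lemma whp_empCov (hσ : Smooth σ c) : ∀ {l : ℕ}, l ≤ L - 2 → ∀ ε : ℝ, 0 < ε →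
    Whp (L := L) σw ρ fun d =>
      {ω | ∀ α β, |empCov σ σw X ω.1 l α β - preCov σ σw X l α β| ≤ ε}
  | 0, _, ε, hε => whp_of_forall 0 fun _ _ ω α β => by simpa [empCov] using hε.le
  | l + 1, hl, ε, hε => by
    have hε' : 0 < ε / (σw ^ 2 + 1) := by positivity
    have h := whp_forall fun α => whp_forall fun β => whp_moment (ρ := ρ) X hσ hσ.nonneg
      hσ.abs_sub_le (Nat.le_of_succ_le hl) (whp_empCov hσ (Nat.le_of_succ_le hl)) hε' α β
    refine h.mono 0 fun d _ ω hω α β => ?_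
    have h1 := hω α β
    simp only [Set.mem_ofPred_eq] at h1
    simp only [empCov, preCov, Matrix.of_apply, Matrix.smul_apply, smul_eq_mul, act]
    rw [← mul_sub, abs_mul, abs_of_nonneg (sq_nonneg σw)]
    rw [le_div_iff₀ (by positivity)] at h1
    nlinarith [abs_nonneg ((d : ℝ)⁻¹ * ∑ i : Fin d, σ (pre σ ω.1 (X α) l i) *
      σ (pre σ ω.1 (X β) l i) - gaussMoment σ (preCov σ σw X l) α β)]

lemma whp_weight {B : ℝ} (hρ : ∀ l, ∀ᵐ a ∂(ρ l), |a| ≤ B) :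
    Whp (L := L) (d₀ := d₀) σw ρ fun d => {ω | ∀ p, |ω.2 p| ≤ B} := by
  intro δ hδ
  refine ⟨0, fun d _ => ?_⟩
  have h1 : ∀ᵐ a ∂(weightMeasure L d₀ d ρ), ∀ p, |a p| ≤ B := by
    rw [Filter.eventually_all]
    exact fun p => (measurePreserving_eval (fun p : ParamIdx L d₀ d => ρ (layerOf p))
      p).quasiMeasurePreserving.ae (hρ _)
  have h2 : ∀ᵐ ω ∂(jointMeasure L d₀ d σw ρ), ∀ p, |ω.2 p| ≤ B :=
    Measure.quasiMeasurePreserving_snd.ae h1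
  rw [measureReal_def, show (jointMeasure L d₀ d σw ρ) {ω | ∀ p, |ω.2 p| ≤ B}ᶜ = 0 from h2]
  simpa using hδ.le

lemma whp_opB_mid : Whp (L := L) (d₀ := d₀) σw ρ fun d =>
    {ω | ∀ m, m < L - 2 → OpB (mid ω.1 m) (4 * (σw ^ 2 + 6))} := by
  have h : ∀ m : Fin (L - 2), Whp (L := L) (d₀ := d₀) σw ρ fun d =>
      {ω | OpB (mid ω.1 m) (4 * (σw ^ 2 + 6))} := fun m => by
    refine whp_of_le (fun d => Real.exp (-d)) ?_ 1 fun d hd => ?_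
    · exact (Real.tendsto_exp_neg_atTop_nhds_zero).comp tendsto_natCast_atTop_atTop
    have hd' : (0 : ℝ) < d := by exact_mod_cast hd
    have h1 := measureReal_not_opB_le
      (fun p : ParamIdx L d₀ d => Real.toNNReal (σw ^ 2 / fanIn p)) (s := σw ^ 2)
      (e := fun q : Fin d × Fin d => .inr (.inl (m, q))) (fun q q' h => by simpa using h)
      (sq_nonneg σw) fun q => by
        rw [Real.coe_toNNReal _ (by positivity)]
        simp only [fanIn]
        rw [mul_div_cancel₀ _ hd'.ne']
    calc _ = (jointMeasure L d₀ d σw ρ).real {z | z.1 ∈ {z : ParamIdx L d₀ d → ℝ |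
          ¬ OpB (mid z m) (4 * (σw ^ 2 + 6))}} := rfl
      _ = (initMeasure L d₀ d σw).real {z : ParamIdx L d₀ d → ℝ |
          ¬ OpB (mid z m) (4 * (σw ^ 2 + 6))} := jointMeasure_real_fst _ _
      _ ≤ _ := by
        refine le_trans (le_of_eq ?_) h1
        have hm : ∀ z : ParamIdx L d₀ d → ℝ, mid z m =
            Matrix.of fun i j => z (.inr (.inl (m, i, j))) := fun z => by
          ext i j; rw [mid_apply m.2]; rfl
        simp only [hm]; rfl
  exact (whp_forall h).mono 0 fun d _ ω hω m hm => hω ⟨m, hm⟩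

lemma exists_whp_act (hσ : Smooth σ c) : ∃ K : ℝ, 0 ≤ K ∧ Whp (L := L) σw ρ fun d =>
    {ω | ∀ l ≤ L - 2, ∀ α, (d : ℝ)⁻¹ * ∑ i, act σ ω.1 (X α) l i ^ 2 ≤ K} := by
  refine ⟨∑ l : Fin (L - 2 + 1), ∑ α, |gaussMoment σ (preCov σ σw X l) α α| + 1, by positivity, ?_⟩
  refine (whp_forall fun l : Fin (L - 2 + 1) => whp_forall fun α => whp_moment (L := L) (σw := σw)
    (ρ := ρ) X hσ hσ.nonneg hσ.abs_sub_le (Nat.lt_succ_iff.1 l.2)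
    (whp_empCov X hσ (Nat.lt_succ_iff.1 l.2)) one_pos α α).mono 0 fun d _ ω hω l hl α => ?_
  have h1 := hω ⟨l, Nat.lt_succ_of_le hl⟩ α
  simp only [Set.mem_ofPred_eq, ← sq] at h1
  have h2 := (abs_le.1 h1).2
  have h3 := Finset.single_le_sum (f := fun α => |gaussMoment σ (preCov σ σw X l) α α|)
    (fun _ _ => abs_nonneg _) (Finset.mem_univ α)
  have h4 := Finset.single_le_sum (f := fun l : Fin (L - 2 + 1) =>
    ∑ α, |gaussMoment σ (preCov σ σw X l) α α|)
    (fun _ _ => Finset.sum_nonneg fun _ _ => abs_nonneg _)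
    (Finset.mem_univ (⟨l, Nat.lt_succ_of_le hl⟩ : Fin (L - 2 + 1)))
  have h5 := le_abs_self (gaussMoment σ (preCov σ σw X l) α α)
  simp only [act] at h3 h4 ⊢
  linarith

end Moments

/-! ### Operator norm of the layer kernels. -/

section Kernel
variable {L d₀ d n : ℕ} {σw : ℝ} {ρ : ℕ → Measure ℝ} [∀ l, IsProbabilityMeasure (ρ l)]
  {σ : ℝ → ℝ} {c : ℝ} (X : Fin n → Fin d₀ → ℝ)

lemma abs_mid_le {a : ParamIdx L d₀ d → ℝ} {B : ℝ} (hB : 0 ≤ B) (ha : ∀ p, |a p| ≤ B) (l : ℕ)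
    (i j : Fin d) : |mid a l i j| ≤ B := by
  by_cases h : l < L - 2
  · rw [mid_apply h]; exact ha _
  · simpa [mid, h] using hB

lemma abs_average_mul_le {w u u' : Fin d → ℝ} {B K : ℝ} (hB : 0 ≤ B) (hw : ∀ i, |w i| ≤ B)
    (hu : (d : ℝ)⁻¹ * ∑ i, u i ^ 2 ≤ K) (hu' : (d : ℝ)⁻¹ * ∑ i, u' i ^ 2 ≤ K) :
    |(d : ℝ)⁻¹ * ∑ i, w i * (u i * u' i)| ≤ B * K := by
  have h0 : (0 : ℝ) ≤ (d : ℝ)⁻¹ := by positivity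
  have h1 : |∑ i, w i * (u i * u' i)| ≤ B * (1 / 2 * (∑ i, u i ^ 2 + ∑ i, u' i ^ 2)) := by
    refine (Finset.abs_sum_le_sum_abs _ _).trans ?_
    rw [← Finset.sum_add_distrib, Finset.mul_sum, Finset.mul_sum]
    refine Finset.sum_le_sum fun i _ => ?_
    rw [abs_mul, abs_mul]
    refine mul_le_mul (hw i) ?_ (by positivity) hB
    rw [← sq_abs (u i), ← sq_abs (u' i)]
    nlinarith [sq_nonneg (|u i| - |u' i|)]
  rw [abs_mul, abs_of_nonneg h0]
  calc _ ≤ (d : ℝ)⁻¹ * (B * (1 / 2 * (∑ i, u i ^ 2 + ∑ i, u' i ^ 2))) := by gcongr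
    _ = B * (1 / 2 * ((d : ℝ)⁻¹ * ∑ i, u i ^ 2 + (d : ℝ)⁻¹ * ∑ i, u' i ^ 2)) := by ring
    _ ≤ B * K := by gcongr; linarith

lemma abs_average_first_le {a : ParamIdx L d₀ d → ℝ} {B : ℝ} (ha : ∀ p, |a p| ≤ B)
    (x x' : Fin d₀ → ℝ) (j : Fin d) :
    |(d : ℝ)⁻¹ * ∑ i, first a i j * (x i * x' i)| ≤ (d : ℝ)⁻¹ * (B * ∑ i, |x i * x' i|) := by
  rw [abs_mul, abs_of_nonneg (by positivity : (0 : ℝ) ≤ (d : ℝ)⁻¹)]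
  refine mul_le_mul_of_nonneg_left ?_ (by positivity)
  refine (Finset.abs_sum_le_sum_abs _ _).trans ?_
  rw [Finset.mul_sum]
  refine Finset.sum_le_sum fun i _ => ?_
  rw [abs_mul]
  exact mul_le_mul_of_nonneg_right (ha _) (abs_nonneg _)

/-- One step of the kernel recursion multiplies by matrices of bounded operator norm and adds a
bounded diagonal. This controls the off-diagonal entries, whose limits never need to be found. -/
lemma exists_whp_opB_kern (hσ : Smooth σ c) {B : ℝ} (hB : 0 ≤ B)
    (hρ : ∀ l, ∀ᵐ a ∂(ρ l), |a| ≤ B) : ∀ {l : ℕ}, l ≤ L - 2 →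
    ∃ K : ℝ, Whp (L := L) σw ρ fun d =>
      {ω | ∀ α β, OpB (kern σ ω.2 ω.1 (X α) (X β) l) K}
  | 0, _ => by
    refine ⟨B * ∑ α, ∑ β, ∑ i, |X α i * X β i|, (whp_weight hρ).mono 1 fun d hd ω hω α β => ?_⟩
    refine opB_diagonal (by positivity) fun j => ?_
    refine (abs_average_first_le hω (X α) (X β) j).trans ?_
    have h1 := Finset.single_le_sum (f := fun β => ∑ i, |X α i * X β i|)
      (fun _ _ => by positivity) (Finset.mem_univ β)
    have h2 := Finset.single_le_sum (f := fun α => ∑ β, ∑ i, |X α i * X β i|)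
      (fun _ _ => by positivity) (Finset.mem_univ α)
    have h3 : (d : ℝ)⁻¹ ≤ 1 := inv_le_one_of_one_le₀ (by exact_mod_cast hd)
    have h4 : 0 ≤ B * ∑ i, |X α i * X β i| := by positivity
    calc _ ≤ 1 * (B * ∑ i, |X α i * X β i|) := by gcongr
      _ ≤ _ := by rw [one_mul]; gcongr; exact h1.trans h2
  | l + 1, hl => by
    obtain ⟨K, hK⟩ := exists_whp_opB_kern hσ hB hρ (Nat.le_of_succ_le hl)
    obtain ⟨K', hK'0, hK'⟩ := exists_whp_act (L := L) (σw := σw) (ρ := ρ) X hσ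
    refine ⟨4 * (σw ^ 2 + 6) * (c * K * c) * (4 * (σw ^ 2 + 6)) + B * K',
      (((whp_weight hρ).inter hK).inter (hK'.inter whp_opB_mid)).mono 0 fun d _ ω hω α β => ?_⟩
    obtain ⟨⟨h1, h2⟩, h3, h4⟩ := hω
    have h5 := h4 l hl
    refine ((h5.transpose.mul (((opB_diagonal hσ.nonneg fun i => hσ.bound _).mul (h2 α β)).mul
      (opB_diagonal hσ.nonneg fun i => hσ.bound _))).mul h5).add
      (opB_diagonal (mul_nonneg hB hK'0) fun j => ?_)
    exact abs_average_mul_le hB (fun i => abs_mid_le hB h1 l i j)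
      (h3 l (Nat.le_of_succ_le hl) α) (h3 l (Nat.le_of_succ_le hl) β)

end Kernel

/-! ### Convergence of the diagonal of the layer kernels. -/

section KernelLimit
variable {L d₀ d n : ℕ} {σw : ℝ} {ρ : ℕ → Measure ℝ} {σ : ℝ → ℝ} {c : ℝ} {X : Fin n → Fin d₀ → ℝ}

/-- The moments and the kernel of the hidden layer `l` are close to their limits, and the kernel is
bounded. -/
structure Good (σ : ℝ → ℝ) (σw : ℝ) (ρ : ℕ → Measure ℝ) (X : Fin n → Fin d₀ → ℝ) (l : ℕ) (ε K : ℝ)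
    (a θ : ParamIdx L d₀ d → ℝ) : Prop where
  opB : ∀ α β, OpB (kern σ a θ (X α) (X β) l) K
  moment : ∀ α β, |(d : ℝ)⁻¹ * ∑ j : Fin d, σ (pre σ θ (X α) l j) * σ (pre σ θ (X β) l j) -
    gaussMoment σ (preCov σ σw X l) α β| ≤ ε
  moment_deriv : ∀ α β, |(d : ℝ)⁻¹ * ∑ j : Fin d, deriv σ (pre σ θ (X α) l j) *
    deriv σ (pre σ θ (X β) l j) - gaussMoment (deriv σ) (preCov σ σw X l) α β| ≤ ε
  act_pow_four : ∀ α, ((d : ℝ)⁻¹) ^ 2 * ∑ j : Fin d, σ (pre σ θ (X α) l j) ^ 4 ≤ ε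
  kernel : ∀ α β, (d : ℝ)⁻¹ * ∑ j, (kern σ a θ (X α) (X β) l j j -
    analyticKernel σ σw ρ X l α β) ^ 2 ≤ ε

lemma Good.congr {l : ℕ} {ε K : ℝ} {a a' θ θ' : ParamIdx L d₀ d → ℝ}
    (h : Good σ σw ρ X l ε K a θ) (hθ : ∀ p : ParamIdx L d₀ d, layerOf p ≤ l + 1 → θ p = θ' p)
    (ha : ∀ p : ParamIdx L d₀ d, layerOf p ≤ l + 1 → a p = a' p) : Good σ σw ρ X l ε K a' θ' := by
  obtain ⟨h1, h2, h3, h4, h5⟩ := h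
  simp only [kern_congr σ _ _ hθ ha, pre_congr σ _ hθ] at h1 h2 h3 h4 h5
  exact ⟨h1, h2, h3, h4, h5⟩

lemma isClosed_good (hσ : Smooth σ c) (d l : ℕ) (ε K : ℝ) :
    IsClosed {ω : (ParamIdx L d₀ d → ℝ) × (ParamIdx L d₀ d → ℝ) |
      Good σ σw ρ X l ε K ω.2 ω.1} := by
  have h1 := fun x j => (continuous_pre (L := L) (d₀ := d₀) (d := d) hσ x l j).comp continuous_fst
    (X := (ParamIdx L d₀ d → ℝ) × (ParamIdx L d₀ d → ℝ))
  have h2 := fun x x' i j => continuous_kern (L := L) (d₀ := d₀) (d := d) hσ x x' l i j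
  have hσ' := hσ.continuous_deriv
  have hσc := hσ.diff.continuous
  simp only [Function.comp_def] at h1
  have h : {ω : (ParamIdx L d₀ d → ℝ) × (ParamIdx L d₀ d → ℝ) | Good σ σw ρ X l ε K ω.2 ω.1} =
      {ω | ∀ α β, OpB (kern σ ω.2 ω.1 (X α) (X β) l) K} ∩
      {ω | ∀ α β, |(d : ℝ)⁻¹ * ∑ j : Fin d, σ (pre σ ω.1 (X α) l j) * σ (pre σ ω.1 (X β) l j) -
        gaussMoment σ (preCov σ σw X l) α β| ≤ ε} ∩
      {ω | ∀ α β, |(d : ℝ)⁻¹ * ∑ j : Fin d, deriv σ (pre σ ω.1 (X α) l j) *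
        deriv σ (pre σ ω.1 (X β) l j) - gaussMoment (deriv σ) (preCov σ σw X l) α β| ≤ ε} ∩
      {ω | ∀ α, ((d : ℝ)⁻¹) ^ 2 * ∑ j : Fin d, σ (pre σ ω.1 (X α) l j) ^ 4 ≤ ε} ∩
      {ω | ∀ α β, (d : ℝ)⁻¹ * ∑ j, (kern σ ω.2 ω.1 (X α) (X β) l j j -
        analyticKernel σ σw ρ X l α β) ^ 2 ≤ ε} := by
    ext ω
    exact ⟨fun h => ⟨⟨⟨⟨h.1, h.2⟩, h.3⟩, h.4⟩, h.5⟩, fun h =>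
      ⟨h.1.1.1.1, h.1.1.1.2, h.1.1.2, h.1.2, h.2⟩⟩
  rw [h]
  simp only [Set.ofPred_forall]
  refine ((((isClosed_iInter fun α => isClosed_iInter fun β => isClosed_opB (h2 _ _) K).inter
    (isClosed_iInter fun α => isClosed_iInter fun β => isClosed_le ?_ continuous_const)).inter
    (isClosed_iInter fun α => isClosed_iInter fun β => isClosed_le ?_ continuous_const)).inter
    (isClosed_iInter fun α => isClosed_le ?_ continuous_const)).inter
    (isClosed_iInter fun α => isClosed_iInter fun β => isClosed_le ?_ continuous_const) <;> fun_prop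

/-- The kernel of a layer, as seen by the units of the next one. -/
def dkern (σ : ℝ → ℝ) (a θ : ParamIdx L d₀ d → ℝ) (x x' : Fin d₀ → ℝ) (l : ℕ) :
    Matrix (Fin d) (Fin d) ℝ :=
  Matrix.diagonal (fun i => deriv σ (pre σ θ x l i)) * kern σ a θ x x' l *
    Matrix.diagonal (fun i => deriv σ (pre σ θ x' l i))

lemma dkern_apply (σ : ℝ → ℝ) (a θ : ParamIdx L d₀ d → ℝ) (x x' : Fin d₀ → ℝ) (l : ℕ)
    (i k : Fin d) : dkern σ a θ x x' l i k =
      deriv σ (pre σ θ x l i) * kern σ a θ x x' l i k * deriv σ (pre σ θ x' l k) := by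
  rw [dkern, Matrix.mul_diagonal, Matrix.diagonal_mul]

/-- Given the layers below, this is a quadratic form in the j-th column of fresh weights plus an
average of fresh weight terms, as the mean square estimate requires. -/
lemma kern_succ_apply_self (σ : ℝ → ℝ) (a θ : ParamIdx L d₀ d → ℝ) (x x' : Fin d₀ → ℝ) (l : ℕ)
    (j : Fin d) : kern σ a θ x x' (l + 1) j j =
      ∑ i, ∑ k, dkern σ a θ x x' l i k * (mid θ l i j * mid θ l k j) +
        (d : ℝ)⁻¹ * ∑ i, mid a l i j * (act σ θ x l i * act σ θ x' l i) := by
  rw [kern, Matrix.add_apply, Matrix.diagonal_apply_eq, ← dkern, Matrix.mul_apply]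
  congr 1
  simp only [Matrix.mul_apply, Matrix.transpose_apply, Finset.sum_mul]
  rw [Finset.sum_comm]
  exact Finset.sum_congr rfl fun i _ => Finset.sum_congr rfl fun k _ => by ring

/-- The expected square error of the kernel of the next layer, given the layers up to `l`. -/
def kernError (σ : ℝ → ℝ) (σw : ℝ) (ρ : ℕ → Measure ℝ) (X : Fin n → Fin d₀ → ℝ) (B : ℝ) (l : ℕ)
    (a θ : ParamIdx L d₀ d → ℝ) (α β : Fin n) : ℝ :=
  3 * (2 * (σw ^ 2 / d) ^ 2 * ∑ i, ∑ j, dkern σ a θ (X α) (X β) l i j ^ 2 +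
    ((d : ℝ)⁻¹) ^ 2 * (B ^ 2 * ∑ i, (act σ θ (X α) l i * act σ θ (X β) l i) ^ 2) +
    (σw ^ 2 / d * ∑ i, dkern σ a θ (X α) (X β) l i i + (∫ a, a ∂(ρ (l + 2))) *
      ((d : ℝ)⁻¹ * ∑ i, act σ θ (X α) l i * act σ θ (X β) l i) -
      analyticKernel σ σw ρ X (l + 1) α β) ^ 2)

/-- The variance of the quadratic form is O(1/d), since a bounded operator has squared Frobenius
norm O(d). The weight terms are handled by the fourth moments of the activations, and the bias by
the three convergences recorded in `Good`. -/
lemma exists_kernError_le (hσ : Smooth σ c) (B : ℝ) (l : ℕ) (K : ℝ) (α β : Fin n) :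
    ∃ C : ℝ, 0 ≤ C ∧ ∀ {d : ℕ} {a θ : ParamIdx L d₀ d → ℝ} {ε : ℝ}, 0 < d → 0 < ε → ε ≤ 1 →
      Good σ σw ρ X l ε K a θ → kernError σ σw ρ X B l a θ α β ≤ C * ((d : ℝ)⁻¹ + ε) := by
  set A := analyticKernel σ σw ρ X l α β with hA
  set μ := ∫ a, a ∂(ρ (l + 2)) with hμ
  set C₁ := σw ^ 2 * |A| + σw ^ 2 * c ^ 2 + |μ| with hC₁
  have hc := hσ.nonneg
  refine ⟨3 * (2 * σw ^ 4 * (c * K * c) ^ 2 + B ^ 2 + C₁ ^ 2), by positivity,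
    fun {d a θ ε} hd hε hε1 h => ?_⟩
  have hd' : (0 : ℝ) < d := by exact_mod_cast hd
  have b1 : 2 * (σw ^ 2 / d) ^ 2 * ∑ i, ∑ j, dkern σ a θ (X α) (X β) l i j ^ 2 ≤
      2 * σw ^ 4 * (c * K * c) ^ 2 * (d : ℝ)⁻¹ := by
    have h1 : OpB (dkern σ a θ (X α) (X β) l) (c * K * c) :=
      ((opB_diagonal hc fun i => hσ.bound _).mul (h.opB α β)).mul
        (opB_diagonal hc fun i => hσ.bound _)
    have h2 := h1.sum_sq_le
    rw [Fintype.card_fin] at h2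
    calc _ ≤ 2 * (σw ^ 2 / d) ^ 2 * (d * (c * K * c) ^ 2) := by gcongr
      _ = _ := by field_simp
  have b2 : ((d : ℝ)⁻¹) ^ 2 * (B ^ 2 * ∑ i, (act σ θ (X α) l i * act σ θ (X β) l i) ^ 2) ≤
      B ^ 2 * ε := by
    have h1 : ∑ i, (act σ θ (X α) l i * act σ θ (X β) l i) ^ 2 ≤
        1 / 2 * (∑ i, act σ θ (X α) l i ^ 4 + ∑ i, act σ θ (X β) l i ^ 4) := by
      rw [← Finset.sum_add_distrib, Finset.mul_sum]
      refine Finset.sum_le_sum fun i _ => ?_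
      nlinarith [sq_nonneg (act σ θ (X α) l i ^ 2 - act σ θ (X β) l i ^ 2)]
    have h2 := h.act_pow_four α
    have h3 := h.act_pow_four β
    calc _ = B ^ 2 * (((d : ℝ)⁻¹) ^ 2 * ∑ i, (act σ θ (X α) l i * act σ θ (X β) l i) ^ 2) := by ring
      _ ≤ B ^ 2 * (((d : ℝ)⁻¹) ^ 2 *
          (1 / 2 * (∑ i, act σ θ (X α) l i ^ 4 + ∑ i, act σ θ (X β) l i ^ 4))) := by gcongr
      _ ≤ B ^ 2 * ε := by
        refine mul_le_mul_of_nonneg_left ?_ (sq_nonneg B)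
        simp only [act]
        linarith
  have hsε : ε ≤ √ε := Real.le_sqrt_of_sq_le (by nlinarith)
  have b3 : |σw ^ 2 / d * ∑ i, dkern σ a θ (X α) (X β) l i i + μ *
      ((d : ℝ)⁻¹ * ∑ i, act σ θ (X α) l i * act σ θ (X β) l i) -
      analyticKernel σ σw ρ X (l + 1) α β| ≤ C₁ * √ε := by
    set g' := gaussMoment (deriv σ) (preCov σ σw X l) α β with hg'
    set g := gaussMoment σ (preCov σ σw X l) α β with hg
    set p := fun i => deriv σ (pre σ θ (X α) l i) * deriv σ (pre σ θ (X β) l i) with hp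
    set k := fun i => kern σ a θ (X α) (X β) l i i - A with hk
    have hT : analyticKernel σ σw ρ X (l + 1) α β = A * (σw ^ 2 * g') + μ * g := by
      simp [analyticKernel, hA, hg', hg, hμ]; ring
    have hdk : ∑ i, dkern σ a θ (X α) (X β) l i i = A * ∑ i, p i + ∑ i, p i * k i := by
      rw [Finset.mul_sum, ← Finset.sum_add_distrib]
      exact Finset.sum_congr rfl fun i _ => by rw [dkern_apply]; simp only [hp, hk]; ring
    -- The kernel is close to its limit only in mean square, so Cauchy–Schwarz yields √ε; the square
    -- of the bias is again O(ε).
    have e1 : |(d : ℝ)⁻¹ * ∑ i, p i * k i| ≤ c ^ 2 * √ε := by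
      have hpc : ∀ i, |p i| ≤ c ^ 2 := fun i => by
        simp only [hp]
        rw [abs_mul, sq]
        exact mul_le_mul (hσ.bound _) (hσ.bound _) (abs_nonneg _) hc
      rw [← Real.sqrt_sq_eq_abs]
      refine Real.sqrt_le_iff.2 ⟨by positivity, ?_⟩
      rw [mul_pow, mul_pow, Real.sq_sqrt hε.le]
      have h1 := Finset.sum_mul_sq_le_sq_mul_sq Finset.univ p k
      have h2 : ∑ i, p i ^ 2 ≤ d * (c ^ 2) ^ 2 := by
        refine (Finset.sum_le_sum fun i _ => (?_ : p i ^ 2 ≤ (c ^ 2) ^ 2)).trans (by simp)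
        rw [← sq_abs]; exact pow_le_pow_left₀ (abs_nonneg _) (hpc i) 2
      have h3 := h.kernel α β
      calc _ ≤ ((d : ℝ)⁻¹) ^ 2 * ((∑ i, p i ^ 2) * ∑ i, k i ^ 2) := by gcongr
        _ ≤ ((d : ℝ)⁻¹) ^ 2 * ((d * (c ^ 2) ^ 2) * ∑ i, k i ^ 2) := by gcongr
        _ = (c ^ 2) ^ 2 * ((d : ℝ)⁻¹ * ∑ i, k i ^ 2) := by field_simp
        _ ≤ (c ^ 2) ^ 2 * ε := by gcongr
    have e2 := h.moment_deriv α β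
    have e3 := h.moment α β
    rw [hT, hdk]
    have e4 : σw ^ 2 / d * (A * ∑ i, p i + ∑ i, p i * k i) + μ *
        ((d : ℝ)⁻¹ * ∑ i, act σ θ (X α) l i * act σ θ (X β) l i) - (A * (σw ^ 2 * g') + μ * g) =
        σw ^ 2 * A * ((d : ℝ)⁻¹ * ∑ i, p i - g') + σw ^ 2 * ((d : ℝ)⁻¹ * ∑ i, p i * k i) +
        μ * ((d : ℝ)⁻¹ * ∑ i, act σ θ (X α) l i * act σ θ (X β) l i - g) := by ring
    rw [e4]
    refine (abs_add_three _ _ _).trans ?_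
    rw [abs_mul (σw ^ 2 * A), abs_mul (σw ^ 2) A, abs_mul (σw ^ 2) ((d : ℝ)⁻¹ * _), abs_mul μ,
      abs_of_nonneg (sq_nonneg σw)]
    have e5 := mul_le_mul_of_nonneg_left (e2.trans hsε)
      (mul_nonneg (sq_nonneg σw) (abs_nonneg A))
    have e6 := mul_le_mul_of_nonneg_left e1 (sq_nonneg σw)
    have e7 := mul_le_mul_of_nonneg_left (e3.trans hsε) (abs_nonneg μ)
    simp only [act] at e7 ⊢
    rw [hC₁]
    linarith
  have b4 := pow_le_pow_left₀ (abs_nonneg _) b3 2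
  rw [sq_abs, mul_pow, Real.sq_sqrt hε.le] at b4
  have hdi : (0 : ℝ) ≤ (d : ℝ)⁻¹ := by positivity
  rw [kernError]
  have p1 : 0 ≤ 2 * σw ^ 4 * (c * K * c) ^ 2 := by positivity
  nlinarith [mul_nonneg p1 hε.le, mul_nonneg (sq_nonneg B) hdi, mul_nonneg (sq_nonneg C₁) hdi]

variable [∀ l, IsProbabilityMeasure (ρ l)]

/-- `K` does not depend on ε. This is needed because the tolerance ε is chosen afterwards in terms
of `K`. -/
lemma exists_whp_good (hσ : Smooth σ c) {B : ℝ} (hB : 0 ≤ B)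
    (hρ : ∀ l, ∀ᵐ a ∂(ρ l), |a| ≤ B) {l : ℕ} (hl : l ≤ L - 2)
    (hk : ∀ ε : ℝ, 0 < ε → ∀ α β, Whp (L := L) σw ρ fun d => {ω | (d : ℝ)⁻¹ *
      ∑ j, (kern σ ω.2 ω.1 (X α) (X β) l j j - analyticKernel σ σw ρ X l α β) ^ 2 ≤ ε}) :
    ∃ K : ℝ, ∀ ε : ℝ, 0 < ε → Whp (L := L) σw ρ fun d => {ω | Good σ σw ρ X l ε K ω.2 ω.1} := by
  obtain ⟨K, hK⟩ := exists_whp_opB_kern (L := L) (σw := σw) X hσ hB hρ hl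
  refine ⟨K, fun ε hε => ?_⟩
  have hcov := fun ε hε => whp_empCov (L := L) (σw := σw) (ρ := ρ) X hσ hl ε hε
  refine (((hK.inter (whp_forall fun α => whp_forall fun β =>
    whp_moment X hσ hσ.nonneg hσ.abs_sub_le hl hcov hε α β)).inter
    ((whp_forall fun α => whp_forall fun β =>
      whp_moment X hσ hσ.nonneg hσ.lip hl hcov hε α β).inter
      (whp_forall fun α => whp_act_pow_four X hσ hl hcov hε α))).inter
    (whp_forall fun α => whp_forall fun β => hk ε hε α β)).mono 0 fun d _ ω hω => ?_
  exact ⟨hω.1.1.1, hω.1.1.2, hω.1.2.1, hω.1.2.2, hω.2⟩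

omit [∀ l, IsProbabilityMeasure (ρ l)] in
lemma exists_kernError_small (hσ : Smooth σ c) (B : ℝ) (l : ℕ) (K : ℝ) (α β : Fin n) {η : ℝ}
    (hη : 0 < η) : ∃ ε : ℝ, 0 < ε ∧ ∃ N : ℕ, 0 < N ∧ ∀ {d : ℕ} {a θ : ParamIdx L d₀ d → ℝ}, N ≤ d →
      Good σ σw ρ X l ε K a θ → kernError σ σw ρ X B l a θ α β ≤ η := by
  obtain ⟨C, hC, h⟩ := exists_kernError_le (L := L) (σw := σw) (ρ := ρ) (X := X) hσ B l K α β
  obtain ⟨N, hN0, hN⟩ := exists_nat_div_le C (half_pos hη)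
  refine ⟨min 1 (η / (2 * (C + 1))), lt_min one_pos (by positivity), N, hN0,
    fun {d a θ} hd hg => (h (hN0.trans_le hd) (lt_min one_pos (by positivity))
      (min_le_left _ _) hg).trans ?_⟩
  have h1 : C * min 1 (η / (2 * (C + 1))) ≤ η / 2 := by
    refine (mul_le_mul_of_nonneg_left (min_le_right _ _) hC).trans ?_
    rw [mul_div_assoc', div_le_iff₀ (by positivity)]
    nlinarith
  have h2 := hN d hd
  rw [div_eq_mul_inv] at h2
  linarith

/-- Induction on the layers. The first kernel is O(1/d), hence the limit 0; afterwards the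
conditional expectation of the average squared error is `kernError`-small and Markov's inequality
applies. -/
lemma whp_kern (hσ : Smooth σ c) {B : ℝ} (hB : 0 ≤ B) (hρ : ∀ l, ∀ᵐ a ∂(ρ l), |a| ≤ B) :
    ∀ {l : ℕ}, l ≤ L - 2 → ∀ ε : ℝ, 0 < ε → ∀ α β, Whp (L := L) σw ρ fun d => {ω | (d : ℝ)⁻¹ *
      ∑ j, (kern σ ω.2 ω.1 (X α) (X β) l j j - analyticKernel σ σw ρ X l α β) ^ 2 ≤ ε}
  | 0, _, ε, hε, α, β => by
    obtain ⟨N, hN0, hN⟩ := exists_nat_div_le (B * ∑ i, |X α i * X β i|) (Real.sqrt_pos.2 hε)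
    refine (whp_weight hρ).mono N fun d hd ω hω => ?_
    have hd' : (0 : ℝ) < d := by exact_mod_cast hN0.trans_le hd
    have h1 : ∀ j, (kern σ ω.2 ω.1 (X α) (X β) 0 j j - analyticKernel σ σw ρ X 0 α β) ^ 2 ≤ ε := by
      intro j
      have h2 : _ ≤ √ε := (abs_average_first_le hω (X α) (X β) j).trans
        ((inv_mul_eq_div _ _).trans_le (hN d hd))
      have h3 := pow_le_pow_left₀ (abs_nonneg _) h2 2
      rw [sq_abs, Real.sq_sqrt hε.le] at h3
      simpa [kern, analyticKernel] using h3
    simp only [Set.mem_ofPred_eq]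
    calc _ ≤ (d : ℝ)⁻¹ * ∑ _j : Fin d, ε := by gcongr with j; exact h1 j
      _ = ε := by simp; field_simp
  | l + 1, hl, ε, hε, α, β => by
    have hl' : l < L - 2 := hl
    obtain ⟨K, hK⟩ := exists_whp_good (L := L) (σw := σw) (X := X) hσ hB hρ hl'.le
      (whp_kern hσ hB hρ hl'.le)
    refine whp_of_resample (l + 2) (fun d => (isClosed_le ?_ continuous_const).measurableSet) ?_
    · have h2 := fun x x' i j => continuous_kern (L := L) (d₀ := d₀) (d := d) hσ x x' (l + 1) i j
      fun_prop
    intro δ hδ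
    -- The tolerance is ε · δ because Markov's inequality divides by ε.
    obtain ⟨ε', hε', N, hN0, hN⟩ := exists_kernError_small (L := L) (σw := σw) (ρ := ρ) (X := X)
      hσ B l K α β (mul_pos hε hδ)
    refine ⟨_, hK ε' hε', fun d => (isClosed_good hσ d l _ _).measurableSet,
      fun d x x' y y' h => ?_, N, fun d hd x y h => ?_⟩
    · exact Good.congr h (fun p hp => resample_of_lt x x' (Nat.lt_succ_of_le hp))
        fun p hp => resample_of_lt y y' (Nat.lt_succ_of_le hp)
    · have hd' : (0 : ℝ) < d := by exact_mod_cast hN0.trans_le hd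
      set e : Fin d → Fin d → ParamIdx L d₀ d := fun j i => .inr (.inl (⟨l, hl'⟩, i, j)) with he
      have hkern : ∀ (z : (ParamIdx L d₀ d → ℝ) × (ParamIdx L d₀ d → ℝ)) j,
          kern σ (resample (l + 2) y z.2) (resample (l + 2) x z.1) (X α) (X β) (l + 1) j j =
          ∑ i, ∑ k, dkern σ y x (X α) (X β) l i k * (z.1 (e j i) * z.1 (e j k)) +
          (d : ℝ)⁻¹ * ∑ i, z.2 (e j i) * (act σ x (X α) l i * act σ x (X β) l i) := fun z j => by
        have c1 : ∀ p : ParamIdx L d₀ d, layerOf p ≤ l + 1 → resample (l + 2) x z.1 p = x p :=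
          fun p hp => resample_of_lt x z.1 (Nat.lt_succ_of_le hp)
        have c2 : ∀ p : ParamIdx L d₀ d, layerOf p ≤ l + 1 → resample (l + 2) y z.2 p = y p :=
          fun p hp => resample_of_lt y z.2 (Nat.lt_succ_of_le hp)
        have m1 : ∀ (u w : ParamIdx L d₀ d → ℝ) i, mid (resample (l + 2) u w) l i j = w (e j i) :=
          fun u w i => by rw [mid_apply hl']; simp [resample, layerOf, he]
        rw [kern_succ_apply_self]
        simp only [dkern, act, kern_congr σ _ _ c1 c2, pre_congr σ _ c1, m1]
      have hj := fun j => integral_quadratic_add_average_sub_sq_le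
        (v := fun p : ParamIdx L d₀ d => Real.toNNReal (σw ^ 2 / fanIn p))
        (m := fun p : ParamIdx L d₀ d => ρ (layerOf p)) (e := e j) (e' := e j) (s := σw ^ 2 / d)
        (B := B) (μ₀ := ∫ a, a ∂(ρ (l + 2))) (fun i i' h => by simpa [he] using h)
        (fun i i' h => by simpa [he] using h) (fun i => Real.coe_toNNReal _ (by positivity))
        (fun i => hρ _) (fun i => rfl) (dkern σ y x (X α) (X β) l)
        (fun i => act σ x (X α) l i * act σ x (X β) l i) (analyticKernel σ σw ρ X (l + 1) α β)
      have hint : Integrable (fun z : (ParamIdx L d₀ d → ℝ) × (ParamIdx L d₀ d → ℝ) =>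
          (d : ℝ)⁻¹ * ∑ j, (kern σ (resample (l + 2) y z.2) (resample (l + 2) x z.1)
            (X α) (X β) (l + 1) j j - analyticKernel σ σw ρ X (l + 1) α β) ^ 2)
          (jointMeasure L d₀ d σw ρ) := by
        simp only [hkern]
        exact (integrable_finsetSum _ fun j _ => (hj j).1).const_mul _
      have hle : ∫ z, (d : ℝ)⁻¹ * ∑ j, (kern σ (resample (l + 2) y z.2) (resample (l + 2) x z.1)
            (X α) (X β) (l + 1) j j - analyticKernel σ σw ρ X (l + 1) α β) ^ 2
          ∂(jointMeasure L d₀ d σw ρ) ≤ ε * δ := by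
        simp only [hkern]
        rw [integral_const_mul]
        refine (mul_le_mul_of_nonneg_left ((integral_finsetSum _ fun j _ => (hj j).1).trans_le
          (Finset.sum_le_sum fun j _ => ((hj j).2.trans (hN hd h)))) (by positivity)).trans_eq ?_
        simp; field_simp
      have hM := measureReal_lt_le_of_integral (fun z => by positivity) hint hε hle
      rw [mul_div_cancel_left₀ _ hε.ne'] at hM
      refine le_trans (measureReal_mono (fun z hz => ?_) (measure_ne_top _ _)) hM
      simpa only [Set.mem_ofPred_eq, not_le] using hz

end KernelLimit

/-! ### Boundedness in probability. -/

section Tight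
variable {L d₀ : ℕ} {σw : ℝ} {ρ : ℕ → Measure ℝ} [∀ l, IsProbabilityMeasure (ρ l)]

/-- The random variables `F d` are bounded in probability, from above. -/
def Tight (σw : ℝ) (ρ : ℕ → Measure ℝ)
    (F : ∀ d, (ParamIdx L d₀ d → ℝ) × (ParamIdx L d₀ d → ℝ) → ℝ) : Prop :=
  ∀ δ : ℝ, 0 < δ → ∃ R : ℝ, ∃ N : ℕ, ∀ d, N ≤ d →
    (jointMeasure L d₀ d σw ρ).real {ω | F d ω ≤ R}ᶜ ≤ δ

omit [∀ l, IsProbabilityMeasure (ρ l)] in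
lemma tight_zero : Tight (L := L) (d₀ := d₀) σw ρ fun _ _ => 0 := fun δ hδ =>
  ⟨0, 0, fun d _ => by simpa using hδ.le⟩

variable {F F' : ∀ d, (ParamIdx L d₀ d → ℝ) × (ParamIdx L d₀ d → ℝ) → ℝ}

lemma Tight.mono (hF : Tight σw ρ F) (h : ∀ d ω, F' d ω ≤ F d ω) : Tight σw ρ F' := by
  intro δ hδ
  obtain ⟨R, N, hN⟩ := hF δ hδ
  refine ⟨R, N, fun d hd => (measureReal_mono (Set.compl_subset_compl.2 fun ω hω => ?_)
    (measure_ne_top _ _)).trans (hN d hd)⟩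
  exact (h d ω).trans hω

lemma Tight.add (hF : Tight σw ρ F) (hF' : Tight σw ρ F') :
    Tight σw ρ fun d ω => F d ω + F' d ω := by
  intro δ hδ
  obtain ⟨R, N, hN⟩ := hF (δ / 2) (half_pos hδ)
  obtain ⟨R', N', hN'⟩ := hF' (δ / 2) (half_pos hδ)
  refine ⟨R + R', max N N', fun d hd => ?_⟩
  have h : {ω | F d ω + F' d ω ≤ R + R'}ᶜ ⊆ {ω | F d ω ≤ R}ᶜ ∪ {ω | F' d ω ≤ R'}ᶜ := by
    rw [← Set.compl_inter]
    exact Set.compl_subset_compl.2 fun ω hω =>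
      show F d ω + F' d ω ≤ R + R' from add_le_add hω.1 hω.2
  refine (measureReal_mono h (measure_ne_top _ _)).trans ((measureReal_union_le _ _).trans ?_)
  linarith [hN d (le_of_max_le_left hd), hN' d (le_of_max_le_right hd)]

lemma tight_sum {τ : Type*} (s : Finset τ)
    {F : τ → ∀ d, (ParamIdx L d₀ d → ℝ) × (ParamIdx L d₀ d → ℝ) → ℝ}
    (h : ∀ i, Tight σw ρ (F i)) : Tight σw ρ fun d ω => ∑ i ∈ s, F i d ω := by
  classical
  induction s using Finset.induction_on with
  | empty => simpa using tight_zero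
  | insert i s hi ih =>
    simp only [Finset.sum_insert hi]
    exact (h i).add ih

lemma last_resample {L d₀ d : ℕ} (x z : ParamIdx L d₀ d → ℝ) :
    last (resample L x z) = last z := by
  ext i; simp [last, resample, layerOf]

/-- Fourth moments of linear functions of the output weights, with coefficients that depend on the
layers below. -/
lemma tight_last_pow_four {k : ℕ → ℕ} {r : ℕ → ℝ} (hr : ∀ d, 0 ≤ r d)
    {M : ∀ d, (ParamIdx L d₀ d → ℝ) × (ParamIdx L d₀ d → ℝ) → Matrix (Fin (k d)) (Fin d) ℝ}
    (hMc : ∀ d i j, Continuous fun ω => M d ω i j)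
    (hM : ∀ d x x' y y', M d (resample L x x', resample L y y') = M d (x, y)) {K : ℝ}
    (hK : Whp σw ρ fun d => {ω | r d * ∑ j, (∑ i, M d ω j i ^ 2) ^ 2 ≤ K * (d : ℝ) ^ 2}) :
    Tight σw ρ fun d ω => r d * ∑ j, (∑ i, M d ω j i * last ω.1 i) ^ 4 := by
  intro δ hδ
  obtain ⟨N, hN⟩ := hK (δ / 2) (half_pos hδ)
  set R := (3 * σw ^ 4 * |K| + 1) / (δ / 2) with hR
  have hR0 : 0 < R := by positivity
  refine ⟨R, max N 1, fun d hd => ?_⟩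
  have hd' : (0 : ℝ) < d := by exact_mod_cast le_of_max_le_right hd
  have hMc' := hMc d
  refine (measureReal_compl_le_of_resample L d (b := δ / 2)
    (G := {ω | r d * ∑ j, (∑ i, M d ω j i ^ 2) ^ 2 ≤ K * (d : ℝ) ^ 2})
    (isClosed_le (by fun_prop) continuous_const).measurableSet
    (isClosed_le (by unfold last; fun_prop) continuous_const).measurableSet
    (fun x x' y y' h => ?_) (half_pos hδ).le fun x y h => ?_).trans
      (by linarith [hN d (le_of_max_le_left hd)])
  · simpa only [Set.mem_ofPred_eq, hM] using h
  · simp only [Set.mem_ofPred_eq] at h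
    -- The output layer is a block with a single column, hence `Fin 1`.
    have hj := fun j => integral_block_pow_four
      (v := fun p : ParamIdx L d₀ d => Real.toNNReal (σw ^ 2 / fanIn p))
      (e := fun q : Fin d × Fin 1 => .inr (.inr q.1)) (s := σw ^ 2 / d)
      (fun q q' h => Prod.ext (by simpa using h) (Subsingleton.elim _ _))
      (fun q => Real.coe_toNNReal _ (by positivity)) (M d (x, y) j) 0
    have hint : Integrable (fun z => r d * ∑ j, (∑ i, M d (x, y) j i * last z i) ^ 4)
        (initMeasure L d₀ d σw) :=
      (integrable_finsetSum _ fun j _ => (hj j).1).const_mul _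
    have hle : ∫ z, r d * ∑ j, (∑ i, M d (x, y) j i * last z i) ^ 4 ∂(initMeasure L d₀ d σw) ≤
        3 * σw ^ 4 * |K| + 1 := by
      rw [integral_const_mul]
      refine (mul_le_mul_of_nonneg_left ((integral_finsetSum _ fun j _ => (hj j).1).trans_le
        (Finset.sum_le_sum fun j _ => (hj j).2.le)) (hr d)).trans ?_
      have e1 : r d * ∑ j, 3 * (σw ^ 2 / d * ∑ i, M d (x, y) j i ^ 2) ^ 2 =
          3 * (σw ^ 2 / d) ^ 2 * (r d * ∑ j, (∑ i, M d (x, y) j i ^ 2) ^ 2) := by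
        simp only [Finset.mul_sum]
        exact Finset.sum_congr rfl fun j _ => by rw [← Finset.mul_sum]; ring
      rw [e1]
      calc _ ≤ 3 * (σw ^ 2 / d) ^ 2 * (K * (d : ℝ) ^ 2) := by gcongr
        _ = 3 * σw ^ 4 * K := by field_simp
        _ ≤ 3 * σw ^ 4 * |K| := by gcongr; exact le_abs_self K
        _ ≤ _ := by linarith
    have hMk := measureReal_lt_le_of_integral
      (fun z => mul_nonneg (hr d) (Finset.sum_nonneg fun j _ => by positivity)) hint hR0 hle
    have hRd : (3 * σw ^ 4 * |K| + 1) / R = δ / 2 := by rw [hR]; field_simp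
    rw [hRd] at hMk
    calc _ = (jointMeasure L d₀ d σw ρ).real {z | z.1 ∈ {z : ParamIdx L d₀ d → ℝ |
          R < r d * ∑ j, (∑ i, M d (x, y) j i * last z i) ^ 4}} := by
            simp only [Set.mem_ofPred_eq, hM, last_resample, not_le]
      _ ≤ _ := (jointMeasure_real_fst _ _).trans_le hMk

end Tight

/-! ### Fourth powers of the backward quantities and of the outputs. -/

section Backward
variable {L d₀ d n : ℕ} {σ : ℝ → ℝ} {c : ℝ}

/-- The matrix that propagates the output weights to the layer `k` layers below the top one. -/
def bmat (σ : ℝ → ℝ) (θ : ParamIdx L d₀ d → ℝ) (x : Fin d₀ → ℝ) : ℕ → Matrix (Fin d) (Fin d) ℝ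
  | 0 => 1
  | k + 1 => mid θ (L - 2 - (k + 1)) *
      (Matrix.diagonal (fun j => deriv σ (pre σ θ x (L - 2 - k) j)) * bmat σ θ x k)

lemma bwd_eq (σ : ℝ → ℝ) (θ : ParamIdx L d₀ d → ℝ) (x : Fin d₀ → ℝ) :
    ∀ k, bwd σ θ x k = bmat σ θ x k *ᵥ last θ
  | 0 => by simp [bwd, bmat]
  | k + 1 => by
    rw [bwd, bmat, ← Matrix.mulVec_mulVec, ← Matrix.mulVec_mulVec, ← bwd_eq σ θ x k]
    congr 1
    ext j; rw [Matrix.mulVec_diagonal]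

lemma bmat_congr (hL : 2 ≤ L) (σ : ℝ → ℝ) {θ θ' : ParamIdx L d₀ d → ℝ} (x : Fin d₀ → ℝ)
    (h : ∀ p : ParamIdx L d₀ d, layerOf p < L → θ p = θ' p) :
    ∀ {k : ℕ}, k ≤ L - 2 → bmat σ θ x k = bmat σ θ' x k
  | 0, _ => rfl
  | k + 1, hk => by
    rw [bmat, bmat, bmat_congr hL σ x h (Nat.le_of_succ_le hk),
      mid_congr fun p hp => h p (by omega), pre_congr σ x fun p hp => h p (by omega)]

lemma continuous_bmat (hσ : Smooth σ c) (x : Fin d₀ → ℝ) (k : ℕ) (i j : Fin d) :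
    Continuous fun θ : ParamIdx L d₀ d → ℝ => bmat σ θ x k i j := by
  have hσ' := hσ.continuous_deriv
  induction k generalizing i j with
  | zero => simp only [bmat]; fun_prop
  | succ k ih =>
    have h1 := continuous_pre (L := L) (d := d) hσ x (L - 2 - k)
    have h2 := continuous_mid (L := L) (d₀ := d₀) (d := d) (L - 2 - (k + 1))
    simp only [bmat, Matrix.mul_apply, Matrix.diagonal_apply, ite_mul, zero_mul,
      Finset.sum_ite_eq, Finset.mem_univ, if_true]
    fun_prop

lemma opB_one {ι : Type*} [Fintype ι] [DecidableEq ι] : OpB (1 : Matrix ι ι ℝ) 1 :=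
  ⟨zero_le_one, fun v => by simp⟩

lemma opB_bmat (hσ : Smooth σ c) {θ : ParamIdx L d₀ d → ℝ} {K : ℝ}
    (hθ : ∀ m, m < L - 2 → OpB (mid θ m) K) (x : Fin d₀ → ℝ) :
    ∀ {k : ℕ}, k ≤ L - 2 → OpB (bmat σ θ x k) ((K * c) ^ k)
  | 0, _ => by simpa [bmat] using opB_one
  | k + 1, hk => by
    have h := (hθ (L - 2 - (k + 1)) (by omega)).mul ((opB_diagonal hσ.nonneg fun j =>
      hσ.bound (pre σ θ x (L - 2 - k) j)).mul (opB_bmat hσ hθ x (Nat.le_of_succ_le hk)))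
    rw [pow_succ', mul_assoc]
    exact h

lemma vee_eq (σ : ℝ → ℝ) (θ : ParamIdx L d₀ d → ℝ) (x : Fin d₀ → ℝ) (l : ℕ) :
    vee σ θ x l = bmat σ θ x (L - 2 - l) *ᵥ last θ := bwd_eq σ θ x _

lemma kern_dlt_eq (σ : ℝ → ℝ) (a θ : ParamIdx L d₀ d → ℝ) (x x' : Fin d₀ → ℝ) (l : ℕ) :
    kern σ a θ x x' l *ᵥ dlt σ θ x' l = (kern σ a θ x x' l *
      (Matrix.diagonal (fun j => deriv σ (pre σ θ x' l j)) * bmat σ θ x' (L - 2 - l))) *ᵥ last θ := by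
  rw [← Matrix.mulVec_mulVec, ← Matrix.mulVec_mulVec, ← vee_eq]
  congr 1
  ext j; rw [Matrix.mulVec_diagonal, dlt]

lemma OpB.sum_row_sq_sq_le {W : Matrix (Fin d) (Fin d) ℝ} {K : ℝ} (h : OpB W K) :
    (d : ℝ) * ∑ j, (∑ i, W j i ^ 2) ^ 2 ≤ K ^ 4 * (d : ℝ) ^ 2 := by
  have h1 : ∑ j, (∑ i, W j i ^ 2) ^ 2 ≤ ∑ _j : Fin d, K ^ 4 := by
    refine Finset.sum_le_sum fun j _ => ?_
    have := pow_le_pow_left₀ (Finset.sum_nonneg fun i _ => sq_nonneg (W j i)) (h.sum_row_sq_le j) 2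
    linarith
  calc _ ≤ (d : ℝ) * ∑ _j : Fin d, K ^ 4 := by gcongr
    _ = _ := by simp; ring

variable {σw : ℝ} {ρ : ℕ → Measure ℝ} [∀ l, IsProbabilityMeasure (ρ l)] {X : Fin n → Fin d₀ → ℝ}

lemma resample_of_lt' {L d₀ d : ℕ} (x z : ParamIdx L d₀ d → ℝ) (p : ParamIdx L d₀ d)
    (hp : layerOf p < L) : resample L x z p = x p := resample_of_lt x z hp

/-- Given the hidden layers, the backward vector is a matrix of bounded norm applied to the Gaussian
output weights of variance O(1/d). Each coordinate then has fourth moment O(d⁻²), which is the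
required spreading. -/
lemma tight_vee (hL : 2 ≤ L) (hσ : Smooth σ c) (α : Fin n) (l : ℕ) :
    Tight (L := L) σw ρ fun d ω => (d : ℝ) * ∑ j, vee σ ω.1 (X α) l j ^ 4 := by
  have h := tight_last_pow_four (L := L) (d₀ := d₀) (σw := σw) (ρ := ρ) (k := fun d => d)
    (r := fun d => (d : ℝ)) (fun d => Nat.cast_nonneg d)
    (M := fun d ω => bmat σ ω.1 (X α) (L - 2 - l))
    (fun d i j => (continuous_bmat hσ (X α) _ i j).comp continuous_fst)
    (fun d x x' y y' => bmat_congr hL σ (X α) (resample_of_lt' x x') (Nat.sub_le _ _))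
    (whp_opB_mid.mono 0 fun d _ ω hω =>
      (opB_bmat hσ hω (X α) (Nat.sub_le (L - 2) l)).sum_row_sq_sq_le)
  refine h.mono fun d ω => ?_
  simp only [vee_eq, Matrix.mulVec, dotProduct, le_refl]

/-- The same mechanism as for `tight_vee`: the layer kernel does not involve the output weights, so
it only contributes another bounded matrix factor. -/
lemma tight_kern_dlt (hL : 2 ≤ L) (hσ : Smooth σ c) {B : ℝ} (hB : 0 ≤ B)
    (hρ : ∀ l, ∀ᵐ a ∂(ρ l), |a| ≤ B) (α β : Fin n) {l : ℕ} (hl : l ≤ L - 2) :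
    Tight (L := L) σw ρ fun d ω => (d : ℝ) *
      ∑ j, (kern σ ω.2 ω.1 (X α) (X β) l *ᵥ dlt σ ω.1 (X β) l) j ^ 4 := by
  obtain ⟨K, hK⟩ := exists_whp_opB_kern (L := L) (σw := σw) X hσ hB hρ hl
  have hσ' := hσ.continuous_deriv
  have h := tight_last_pow_four (L := L) (d₀ := d₀) (σw := σw) (ρ := ρ) (k := fun d => d)
    (r := fun d => (d : ℝ)) (fun d => Nat.cast_nonneg d)
    (M := fun d ω => kern σ ω.2 ω.1 (X α) (X β) l *
      (Matrix.diagonal (fun j => deriv σ (pre σ ω.1 (X β) l j)) * bmat σ ω.1 (X β) (L - 2 - l)))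
    (fun d i j => by
      have h1 := continuous_kern (L := L) (d := d) hσ (X α) (X β) l
      have h2 := fun i j => (continuous_bmat (L := L) hσ (X β) (L - 2 - l) i j).comp continuous_fst
        (X := (ParamIdx L d₀ d → ℝ) × (ParamIdx L d₀ d → ℝ))
      have h3 := fun j => (continuous_pre (L := L) hσ (X β) l j).comp continuous_fst
        (X := (ParamIdx L d₀ d → ℝ) × (ParamIdx L d₀ d → ℝ))
      simp only [Function.comp_def] at h2 h3
      simp only [Matrix.mul_apply, Matrix.diagonal_apply, ite_mul, zero_mul,
        Finset.sum_ite_eq, Finset.mem_univ, if_true]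
      fun_prop)
    (fun d x x' y y' => by
      have c1 := fun p (hp : layerOf p ≤ l + 1) => resample_of_lt' x x' p (by omega)
      have c2 := fun p (hp : layerOf p ≤ l + 1) => resample_of_lt' y y' p (by omega)
      simp only [kern_congr σ _ _ c1 c2, pre_congr σ _ c1,
        bmat_congr hL σ (X β) (resample_of_lt' x x') (Nat.sub_le (L - 2) l)])
    ((hK.inter whp_opB_mid).mono 0 fun d _ ω hω => ((hω.1 α β).mul
      ((opB_diagonal hσ.nonneg fun j => hσ.bound _).mul
        (opB_bmat hσ hω.2 (X β) (Nat.sub_le (L - 2) l)))).sum_row_sq_sq_le)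
  refine h.mono fun d ω => ?_
  rw [kern_dlt_eq]
  rfl

lemma tight_network (hL : 2 ≤ L) (hσ : Smooth σ c) (α : Fin n) :
    Tight (L := L) σw ρ fun _ ω => network σ ω.1 (X α) ^ 4 := by
  obtain ⟨K, hK0, hK⟩ := exists_whp_act (L := L) (σw := σw) (ρ := ρ) X hσ
  have hσc := hσ.diff.continuous
  have h := tight_last_pow_four (L := L) (d₀ := d₀) (σw := σw) (ρ := ρ) (k := fun _ => 1)
    (r := fun _ => 1) (fun d => zero_le_one) (K := K ^ 2)
    (M := fun d ω => Matrix.of fun _ i => act σ ω.1 (X α) (L - 2) i)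
    (fun d i j => by
      have h3 := fun j => (continuous_pre (L := L) hσ (X α) (L - 2) j).comp continuous_fst
        (X := (ParamIdx L d₀ d → ℝ) × (ParamIdx L d₀ d → ℝ))
      simp only [Function.comp_def] at h3
      simp only [Matrix.of_apply, act]
      fun_prop)
    (fun d x x' y y' => by
      have c1 := fun p (hp : layerOf p ≤ L - 2 + 1) => resample_of_lt' x x' p (by omega)
      simp only [act, pre_congr σ _ c1])
    (hK.mono 1 fun d hd ω hω => by
      have hd' : (0 : ℝ) < d := by exact_mod_cast hd
      have h1 := hω (L - 2) le_rfl α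
      rw [inv_mul_le_iff₀ hd'] at h1
      have h2 := pow_le_pow_left₀ (Finset.sum_nonneg fun i _ => sq_nonneg _) h1 2
      simp only [Set.mem_ofPred_eq, Matrix.of_apply, Finset.univ_unique, Finset.sum_singleton,
        one_mul]
      linarith)
  refine h.mono fun d ω => ?_
  simp [network_eq]

end Backward

/-! ### Convergence of the tangent kernel at initialization. -/

section TangentKernel
variable {L d₀ n : ℕ} {σw : ℝ} {ρ : ℕ → Measure ℝ} {σ : ℝ → ℝ} {c : ℝ} {X : Fin n → Fin d₀ → ℝ}

lemma wntk_eq_dkern (hσ : Smooth σ c) {d : ℕ} (a θ : ParamIdx L d₀ d → ℝ) (α β : Fin n) :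
    wntk σ X a θ α β = ∑ i, ∑ k, dkern σ a θ (X α) (X β) (L - 2) i k * (last θ i * last θ k) +
      (d : ℝ)⁻¹ * ∑ i, last a i * (act σ θ (X α) (L - 2) i * act σ θ (X β) (L - 2) i) := by
  rw [wntk_eq hσ.diff]
  congr 1
  refine Finset.sum_congr rfl fun i _ => ?_
  simp only [Matrix.mulVec, dotProduct, dlt, vee_top, dkern_apply, Finset.mul_sum]
  exact Finset.sum_congr rfl fun k _ => by ring

variable [∀ l, IsProbabilityMeasure (ρ l)]

/-- By `wntk_eq_dkern` the tangent kernel is one more step of the kernel recursion, with the output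
weights as the only column; the mean square estimate is used once more. -/
lemma whp_wntk (hL : 2 ≤ L) (hσ : Smooth σ c) {B : ℝ} (hB : 0 ≤ B)
    (hρ : ∀ l, ∀ᵐ a ∂(ρ l), |a| ≤ B) {ε : ℝ} (hε : 0 < ε) (α β : Fin n) :
    Whp (L := L) σw ρ fun d => {ω |
      |wntk σ X ω.2 ω.1 α β - analyticWNTK L σ σw ρ X α β| ≤ ε} := by
  obtain ⟨K, hK⟩ := exists_whp_good (L := L) (σw := σw) (X := X) hσ hB hρ le_rfl
    (whp_kern hσ hB hρ le_rfl)
  have hL2 : L - 2 + 2 = L := Nat.sub_add_cancel hL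
  have hL1 : L - 1 = L - 2 + 1 := by omega
  simp only [wntk_eq_dkern hσ, analyticWNTK, hL1]
  refine whp_of_resample L (fun d => (isClosed_le ?_ continuous_const).measurableSet) ?_
  · have h2 := fun x x' i j => continuous_kern (L := L) (d₀ := d₀) (d := d) hσ x x' (L - 2) i j
    have h1 := fun x j => (continuous_pre (L := L) (d₀ := d₀) (d := d) hσ x (L - 2) j).comp
      continuous_fst (X := (ParamIdx L d₀ d → ℝ) × (ParamIdx L d₀ d → ℝ))
    have hσ' := hσ.continuous_deriv
    have hσc := hσ.diff.continuous
    simp only [Function.comp_def] at h1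
    simp only [dkern_apply, act, last]
    fun_prop
  intro δ hδ
  obtain ⟨ε', hε', N, hN0, hN⟩ := exists_kernError_small (L := L) (σw := σw) (ρ := ρ) (X := X)
    hσ B (L - 2) K α β (mul_pos (pow_pos hε 2) hδ)
  refine ⟨_, hK ε' hε', fun d => (isClosed_good hσ d _ _ _).measurableSet,
    fun d x x' y y' h => ?_, N, fun d hd x y h => ?_⟩
  · exact Good.congr h (fun p hp => resample_of_lt x x' (by omega))
      fun p hp => resample_of_lt y y' (by omega)
  · have hdk : ∀ z : (ParamIdx L d₀ d → ℝ) × (ParamIdx L d₀ d → ℝ),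
        dkern σ (resample L y z.2) (resample L x z.1) (X α) (X β) (L - 2) =
        dkern σ y x (X α) (X β) (L - 2) ∧
        ∀ x', pre σ (resample L x z.1) x' (L - 2) = pre σ x x' (L - 2) := fun z => by
      have c1 : ∀ p : ParamIdx L d₀ d, layerOf p ≤ L - 2 + 1 → resample L x z.1 p = x p :=
        fun p hp => resample_of_lt x z.1 (by omega)
      have c2 : ∀ p : ParamIdx L d₀ d, layerOf p ≤ L - 2 + 1 → resample L y z.2 p = y p :=
        fun p hp => resample_of_lt y z.2 (by omega)
      exact ⟨by simp only [dkern, kern_congr σ _ _ c1 c2, pre_congr σ _ c1],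
        fun x' => pre_congr σ _ c1⟩
    have hj := integral_quadratic_add_average_sub_sq_le
      (v := fun p : ParamIdx L d₀ d => Real.toNNReal (σw ^ 2 / fanIn p))
      (m := fun p : ParamIdx L d₀ d => ρ (layerOf p)) (e := fun i => .inr (.inr i))
      (e' := fun i => .inr (.inr i)) (s := σw ^ 2 / d)
      (B := B) (μ₀ := ∫ a, a ∂(ρ (L - 2 + 2))) (fun i i' h => by simpa using h)
      (fun i i' h => by simpa using h) (fun i => Real.coe_toNNReal _ (by positivity))
      (fun i => hρ _) (fun i => by rw [hL2]; rfl) (dkern σ y x (X α) (X β) (L - 2))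
      (fun i => act σ x (X α) (L - 2) i * act σ x (X β) (L - 2) i)
      (analyticKernel σ σw ρ X (L - 2 + 1) α β)
    have hM := measureReal_lt_le_of_integral (fun z => sq_nonneg _) hj.1 (pow_pos hε 2)
      (hj.2.trans (hN hd h))
    rw [mul_div_cancel_left₀ _ (pow_pos hε 2).ne'] at hM
    refine le_trans (measureReal_mono (fun z hz => ?_) (measure_ne_top _ _)) hM
    simp only [Set.mem_ofPred_eq, hdk, act, last_resample, not_le] at hz ⊢
    have hz2 := pow_lt_pow_left₀ hz hε.le two_ne_zero
    rw [sq_abs] at hz2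
    exact hz2

end TangentKernel

/-! ### All bounds at initialization on one event. -/

section Initialization
variable {L d₀ n : ℕ} {σw : ℝ} {ρ : ℕ → Measure ℝ} [∀ l, IsProbabilityMeasure (ρ l)]
  {σ : ℝ → ℝ} {c : ℝ}

lemma exists_init_bound (hL : 2 ≤ L) (hσ : Smooth σ c) {B : ℝ} (hB : 0 ≤ B)
    (hρ : ∀ l, ∀ᵐ a ∂(ρ l), |a| ≤ B) (X : Fin n → Fin d₀ → ℝ) (Y : Fin n → ℝ) {δ : ℝ}
    (hδ : 0 < δ) :
    ∃ K R : ℝ, 1 ≤ K ∧ 0 ≤ R ∧ ∃ N : ℕ, ∀ d, N ≤ d → (jointMeasure L d₀ d σw ρ).real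
      {ω | Init σ X B K (√√((d : ℝ)⁻¹)) ω.2 ω.1 ∧
        l2 (fun s => network σ ω.1 (X s) - Y s) ≤ R}ᶜ ≤ δ := by
  obtain ⟨Ka, hKa0, hKa⟩ := exists_whp_act (L := L) (σw := σw) (ρ := ρ) X hσ
  obtain ⟨N₁, hN₁⟩ := ((whp_weight (L := L) (d₀ := d₀) (σw := σw) hρ).inter
    (hKa.inter whp_opB_mid)) (δ / 2) (half_pos hδ)
  -- All summands are nonnegative, so a single bound R₁ on the total controls each of them.
  have hT := ((tight_sum (ρ := ρ) (σw := σw) Finset.univ fun s : Fin n =>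
      tight_sum Finset.univ fun l : Fin (L - 2 + 1) =>
      tight_vee (L := L) (X := X) hL hσ s l).add
    (tight_sum Finset.univ fun s : Fin n => tight_sum Finset.univ fun t : Fin n =>
      tight_sum Finset.univ fun l : Fin (L - 2 + 1) =>
      tight_kern_dlt (L := L) (X := X) hL hσ hB hρ s t (Nat.lt_succ_iff.1 l.2))).add
    (tight_sum Finset.univ fun s : Fin n => tight_network (L := L) (X := X) hL hσ s)
  obtain ⟨R₁, N₂, hN₂⟩ := hT (δ / 2) (half_pos hδ)
  set K := 1 + |R₁| + Ka + 4 * (σw ^ 2 + 6) + ∑ s, l2 (X s) with hK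
  have hX0 : 0 ≤ ∑ s, l2 (X s) := Finset.sum_nonneg fun s _ => l2_nonneg _
  have hK1 : 1 ≤ K := by
    have := abs_nonneg R₁
    nlinarith [sq_nonneg σw]
  have hKR : R₁ ≤ K ^ 4 := by
    have h1 : K ≤ K ^ 4 := le_self_pow₀ hK1 (by norm_num)
    have h2 := le_abs_self R₁
    nlinarith [sq_nonneg σw]
  refine ⟨K, ∑ s, (1 + |R₁| + |Y s|), hK1, by positivity, max (max N₁ N₂) 1, fun d hd => ?_⟩
  have hd1 : 1 ≤ d := le_of_max_le_right hd
  have hd0 : (0 : ℝ) < d := by exact_mod_cast hd1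
  have h1 := hN₁ d (le_of_max_le_left (le_of_max_le_left hd))
  have h2 := hN₂ d (le_of_max_le_right (le_of_max_le_left hd))
  refine le_trans ?_ ((measureReal_union_le _ _).trans ((add_le_add h1 h2).trans_eq (add_halves δ)))
  refine measureReal_mono ?_ (measure_ne_top _ _)
  rw [← Set.compl_inter]
  refine Set.compl_subset_compl.2 fun ω hω => ?_
  obtain ⟨⟨hw, ha, hm⟩, hsum⟩ := hω
  simp only [Set.mem_ofPred_eq] at hw ha hm hsum
  have p1 : ∀ s, ∀ l : Fin (L - 2 + 1), 0 ≤ (d : ℝ) * ∑ j, vee σ ω.1 (X s) l j ^ 4 :=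
    fun s l => by positivity
  have p2 : ∀ s t, ∀ l : Fin (L - 2 + 1), 0 ≤ (d : ℝ) *
      ∑ j, (kern σ ω.2 ω.1 (X s) (X t) l *ᵥ dlt σ ω.1 (X t) l) j ^ 4 := fun s t l => by positivity
  have p3 : ∀ s, 0 ≤ network σ ω.1 (X s) ^ 4 := fun s => by positivity
  have q1 := Finset.sum_nonneg fun s (_ : s ∈ Finset.univ) =>
    Finset.sum_nonneg fun l (_ : l ∈ Finset.univ) => p1 s l
  have q2 := Finset.sum_nonneg fun s (_ : s ∈ Finset.univ) =>
    Finset.sum_nonneg fun t (_ : t ∈ Finset.univ) =>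
    Finset.sum_nonneg fun l (_ : l ∈ Finset.univ) => p2 s t l
  have q3 := Finset.sum_nonneg fun s (_ : s ∈ Finset.univ) => p3 s
  have r1 : ∀ s, ∀ l ≤ L - 2, (d : ℝ) * ∑ j, vee σ ω.1 (X s) l j ^ 4 ≤ R₁ := fun s l hl => by
    have e1 := Finset.single_le_sum (fun l _ => p1 s l)
      (Finset.mem_univ (⟨l, Nat.lt_succ_of_le hl⟩ : Fin (L - 2 + 1)))
    have e2 := Finset.single_le_sum (fun s (_ : s ∈ Finset.univ) =>
      Finset.sum_nonneg fun l (_ : l ∈ Finset.univ) => p1 s l) (Finset.mem_univ s)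
    beta_reduce at e1 e2
    linarith
  have r2 : ∀ s t, ∀ l ≤ L - 2, (d : ℝ) *
      ∑ j, (kern σ ω.2 ω.1 (X s) (X t) l *ᵥ dlt σ ω.1 (X t) l) j ^ 4 ≤ R₁ := fun s t l hl => by
    have e1 := Finset.single_le_sum (fun l _ => p2 s t l)
      (Finset.mem_univ (⟨l, Nat.lt_succ_of_le hl⟩ : Fin (L - 2 + 1)))
    have e2 := Finset.single_le_sum (fun t (_ : t ∈ Finset.univ) =>
      Finset.sum_nonneg fun l (_ : l ∈ Finset.univ) => p2 s t l) (Finset.mem_univ t)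
    have e3 := Finset.single_le_sum (fun s (_ : s ∈ Finset.univ) =>
      Finset.sum_nonneg fun t (_ : t ∈ Finset.univ) =>
      Finset.sum_nonneg fun l (_ : l ∈ Finset.univ) => p2 s t l) (Finset.mem_univ s)
    beta_reduce at e1 e2 e3
    linarith
  have r3 : ∀ s, network σ ω.1 (X s) ^ 4 ≤ R₁ := fun s => by
    have e1 := Finset.single_le_sum (fun s _ => p3 s) (Finset.mem_univ s)
    beta_reduce at e1
    linarith
  have hε2 : √√((d : ℝ)⁻¹) ^ 2 = √((d : ℝ)⁻¹) := Real.sq_sqrt (Real.sqrt_nonneg _)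
  have hε4 : √√((d : ℝ)⁻¹) ^ 4 = (d : ℝ)⁻¹ := by
    rw [show (4 : ℕ) = 2 * 2 from rfl, pow_mul, hε2, Real.sq_sqrt (by positivity)]
  have hpow : ∀ T : ℝ, (d : ℝ) * T ≤ R₁ → T ≤ (K * √√((d : ℝ)⁻¹)) ^ 4 := fun T hT => by
    rw [mul_pow, hε4, ← div_eq_mul_inv, le_div_iff₀ hd0]
    linarith
  refine ⟨⟨Real.sqrt_pos.2 (Real.sqrt_pos.2 (inv_pos.2 hd0)), ?_, ?_, hw, hK1, fun s => ?_,
    fun l hl => (hm l hl).mono ?_, fun s l hl => ?_, fun s l hl => hpow _ (r1 s l hl),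
    fun s t l hl => hpow _ (r2 s t l hl)⟩, ?_⟩
  · refine Real.sqrt_le_one.2 (Real.sqrt_le_one.2 (inv_le_one_of_one_le₀ (by exact_mod_cast hd1)))
  · rw [hε4]; field_simp
  · have := Finset.single_le_sum (fun s _ => l2_nonneg (X s)) (Finset.mem_univ s)
    have h3 := abs_nonneg R₁
    nlinarith [sq_nonneg σw]
  · have h3 := abs_nonneg R₁
    linarith
  · have h3 : (√√((d : ℝ)⁻¹) ^ 2 * l2 (act σ ω.1 (X s) l)) ^ 2 ≤ K ^ 2 := by
      rw [mul_pow, hε2, Real.sq_sqrt (by positivity), l2_sq]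
      refine (ha l hl s).trans ?_
      have h4 : K ≤ K ^ 2 := le_self_pow₀ hK1 (by norm_num)
      have h3 := abs_nonneg R₁
      nlinarith [sq_nonneg σw]
    exact (pow_le_pow_iff_left₀ (mul_nonneg (sq_nonneg _) (l2_nonneg _)) (by linarith)
      two_ne_zero).1 h3
  · refine (l2_le_sum_abs _).trans (Finset.sum_le_sum fun s _ => ?_)
    -- A crude consequence of the fourth-power bound, as |f| ≤ f⁴ once |f| ≥ 1.
    have h3 : |network σ ω.1 (X s)| ≤ 1 + |R₁| := by
      by_contra! hcon
      have h4 : 1 ≤ |network σ ω.1 (X s)| := by linarith [abs_nonneg R₁]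
      have h5 : |network σ ω.1 (X s)| ≤ |network σ ω.1 (X s)| ^ 4 := le_self_pow₀ h4 (by norm_num)
      have h6 : |network σ ω.1 (X s)| ^ 4 = network σ ω.1 (X s) ^ 4 := by
        rw [← abs_pow, abs_of_nonneg (p3 s)]
      linarith [r3 s, le_abs_self R₁]
    exact (abs_sub _ _).trans (by linarith)

end Initialization

/-! ### Contraction of a gradient step for a positive definite kernel. -/

section Spectrum
variable {ι : Type*} [Fintype ι]

lemma opB_of_abs_le {W : Matrix ι ι ℝ} {ε : ℝ} (hε : 0 ≤ ε) (h : ∀ i j, |W i j| ≤ ε) :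
    OpB W (Fintype.card ι * ε) := by
  refine opB_of_sum_sq_le (by positivity) ?_
  calc ∑ i, ∑ j, W i j ^ 2 ≤ ∑ _i : ι, ∑ _j : ι, ε ^ 2 := Finset.sum_le_sum fun i _ =>
        Finset.sum_le_sum fun j _ => sq_le_sq' (abs_le.1 (h i j)).1 (abs_le.1 (h i j)).2
    _ = _ := by simp; ring

lemma frobenius_norm_le_of_abs_le {W : Matrix ι ι ℝ} {ε : ℝ} (hε : 0 ≤ ε)
    (h : ∀ i j, |W i j| ≤ ε) : ‖W‖ ≤ Fintype.card ι * ε := by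
  rw [Matrix.frobenius_norm_def, ← Real.sqrt_eq_rpow]
  refine Real.sqrt_le_iff.2 ⟨by positivity, ?_⟩
  calc ∑ i, ∑ j, ‖W i j‖ ^ (2 : ℝ) ≤ ∑ _i : ι, ∑ _j : ι, ε ^ 2 := Finset.sum_le_sum fun i _ =>
        Finset.sum_le_sum fun j _ => by
          rw [Real.rpow_two, Real.norm_eq_abs]
          exact pow_le_pow_left₀ (abs_nonneg _) (h i j) 2
    _ = _ := by simp; ring

variable [DecidableEq ι] {A M : Matrix ι ι ℝ}

lemma l2_sub_smul_mulVec_le (hA : A.IsHermitian) {η q : ℝ} (hq : 0 ≤ q)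
    (h : ∀ i, |1 - η * hA.eigenvalues i| ≤ q) (v : ι → ℝ) :
    l2 (v - η • (A *ᵥ v)) ≤ q * l2 v := by
  have hin : ∀ i, inner ℝ (hA.eigenvectorBasis i) (WithLp.toLp 2 (v - η • (A *ᵥ v))) =
      (1 - η * hA.eigenvalues i) * inner ℝ (hA.eigenvectorBasis i) (WithLp.toLp 2 v) := fun i => by
    have hT : Aᵀ = A := by
      rwa [Matrix.IsHermitian, Matrix.conjTranspose_eq_transpose_of_trivial] at hA
    have h1 : (A *ᵥ v) ⬝ᵥ ⇑(hA.eigenvectorBasis i) =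
        hA.eigenvalues i * (v ⬝ᵥ ⇑(hA.eigenvectorBasis i)) := by
      rw [← Matrix.vecMul_transpose, hT, ← Matrix.dotProduct_mulVec, hA.mulVec_eigenvectorBasis,
        dotProduct_smul, smul_eq_mul]
    simp only [EuclideanSpace.inner_eq_star_dotProduct, star_trivial, sub_dotProduct,
      smul_dotProduct, h1, smul_eq_mul]
    ring
  refine (pow_le_pow_iff_left₀ (l2_nonneg _) (mul_nonneg hq (l2_nonneg _)) two_ne_zero).1 ?_
  rw [mul_pow, l2_eq_norm, l2_eq_norm, ← hA.eigenvectorBasis.sum_sq_inner_right,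
    ← hA.eigenvectorBasis.sum_sq_inner_right, Finset.mul_sum]
  refine Finset.sum_le_sum fun i _ => ?_
  rw [hin, mul_pow]
  exact mul_le_mul_of_nonneg_right (sq_le_sq' (abs_le.1 (h i)).1 (abs_le.1 (h i)).2) (sq_nonneg _)

/-- Gradient steps along a matrix close to a positive definite one contract, for a step size below
`2 / (lmin + lmax)`. -/
lemma l2_sub_smul_mulVec_le_of_abs_sub_le (hA : A.IsHermitian) {lmin lmax η : ℝ}
    (hmin : IsLeast (spectrum ℝ A) lmin) (hmax : IsGreatest (spectrum ℝ A) lmax) (hpos : 0 < lmin)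
    (hη : 0 < η) (hηlt : η < 2 / (lmin + lmax)) {ε : ℝ} (hε0 : 0 ≤ ε)
    (hε : Fintype.card ι * ε ≤ lmin / 2) (h : ∀ i j, |M i j - A i j| ≤ ε) (v : ι → ℝ) :
    l2 (v - η • (M *ᵥ v)) ≤ (1 - η * lmin / 2) * l2 v := by
  have hlm : lmin ≤ lmax := hmin.2 hmax.1
  have hη2 : η * (lmin + lmax) < 2 := (lt_div_iff₀ (by linarith)).1 hηlt
  have h1 : l2 (v - η • (A *ᵥ v)) ≤ (1 - η * lmin) * l2 v := by
    refine l2_sub_smul_mulVec_le hA (by nlinarith) (fun i => ?_) v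
    have hi := hA.eigenvalues_mem_spectrum_real i
    have := hmin.2 hi
    have := hmax.2 hi
    -- The critical learning rate enters here: ηλ ≤ η · lmax < 2 - η · lmin keeps 1 - ηλ above -(1 -
    -- η · lmin).
    exact abs_le.2 ⟨by nlinarith, by nlinarith⟩
  have h2 := (opB_of_abs_le (W := M - A) hε0 h).2 v
  have h3 : v - η • (M *ᵥ v) = (v - η • (A *ᵥ v)) - η • ((M - A) *ᵥ v) := by
    rw [Matrix.sub_mulVec, smul_sub]; abel
  rw [h3]
  refine (l2_sub_le _ _).trans ?_
  rw [l2_smul, abs_of_pos hη]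
  have h4 := mul_le_mul_of_nonneg_left (h2.trans (mul_le_mul_of_nonneg_right hε (l2_nonneg v))) hη.le
  linarith

end Spectrum

/-! ### Symmetry and sign of the analytic kernel. -/

section AnalyticKernel
variable {d₀ n : ℕ} {σ : ℝ → ℝ} {σw : ℝ} {ρ : ℕ → Measure ℝ} {X : Fin n → Fin d₀ → ℝ}

lemma isHermitian_analyticKernel : ∀ l, (analyticKernel σ σw ρ X l).IsHermitian
  | 0 => Matrix.isHermitian_zero
  | l + 1 => by
    have h := isHermitian_analyticKernel l
    ext i j
    have hij : analyticKernel σ σw ρ X l j i = analyticKernel σ σw ρ X l i j := by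
      simpa using h.apply i j
    simp [analyticKernel, Matrix.conjTranspose_apply, hij, gaussMoment_symm _ _ j i]

/-- Diagonal Gaussian moments are expectations of squares, so the recursion preserves the sign when
no mean is positive. -/
lemma analyticKernel_diag_nonpos (i : Fin n) : ∀ l,
    (∀ k < l, ∫ a, a ∂(ρ (k + 2)) ≤ 0) → analyticKernel σ σw ρ X l i i ≤ 0
  | 0, _ => le_rfl
  | l + 1, h => by
    have ih := analyticKernel_diag_nonpos i l fun k hk => h k (by omega)
    have hm : ∀ φ : ℝ → ℝ, 0 ≤ gaussMoment φ (preCov σ σw X l) i i := fun φ =>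
      integral_nonneg fun f => mul_self_nonneg _
    simp only [analyticKernel, Matrix.add_apply, Matrix.hadamard_apply, Matrix.smul_apply,
      smul_eq_mul]
    exact add_nonpos (mul_nonpos_of_nonpos_of_nonneg ih (mul_nonneg (sq_nonneg _) (hm _)))
      (mul_nonpos_of_nonpos_of_nonneg (h l l.lt_succ_self) (hm _))

/-- If the analytic kernel is positive definite, one of the layers `2, …, L` has weight terms of
positive mean. -/
lemma exists_integral_pos {L : ℕ} {lmin : ℝ} (hn : 0 < n)
    (hmin : IsLeast (spectrum ℝ (analyticWNTK L σ σw ρ X)) lmin) (hpos : 0 < lmin) :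
    ∃ k < L - 1, 0 < ∫ a, a ∂(ρ (k + 2)) := by
  have hA : (analyticWNTK L σ σw ρ X).IsHermitian := isHermitian_analyticKernel _
  have hP : (analyticWNTK L σ σw ρ X).PosDef := hA.posDef_iff_eigenvalues_pos.2 fun i =>
    hpos.trans_le (hmin.2 (hA.eigenvalues_mem_spectrum_real i))
  by_contra! hcon
  exact (hP.diag_pos (i := ⟨0, hn⟩)).not_ge (analyticKernel_diag_nonpos _ _ hcon)

end AnalyticKernel

/-! ### A lower bound for the largest weight term. -/

section WeightTerms
variable {L d₀ : ℕ} {σw : ℝ} {ρ : ℕ → Measure ℝ} [∀ l, IsProbabilityMeasure (ρ l)]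

lemma jointMeasure_real_snd (d : ℕ) (A : Set (ParamIdx L d₀ d → ℝ)) :
    (jointMeasure L d₀ d σw ρ).real {z | z.2 ∈ A} = (weightMeasure L d₀ d ρ).real A := by
  have h : {z : (ParamIdx L d₀ d → ℝ) × (ParamIdx L d₀ d → ℝ) | z.2 ∈ A} = Set.univ ×ˢ A := by
    ext z; simp
  have h0 : IsProbabilityMeasure (weightMeasure L d₀ d ρ) := inferInstance
  have : SFinite (weightMeasure L d₀ d ρ) := inferInstance
  rw [h, measureReal_def, jointMeasure, Measure.prod_prod]
  simp [measureReal_def]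

lemma exists_injective_layerOf {k d : ℕ} (hk : k < L - 1) :
    ∃ e : Fin d → ParamIdx L d₀ d, Function.Injective e ∧ ∀ i, layerOf (e i) = k + 2 := by
  rcases Nat.lt_or_ge k (L - 2) with h | h
  · exact ⟨fun i => .inr (.inl (⟨k, h⟩, i, i)), fun i j hij => by simpa using hij, fun i => rfl⟩
  · exact ⟨fun i => .inr (.inr i), fun i j hij => by simpa using hij,
      fun i => by simp only [layerOf]; omega⟩

/-- The maximum dominates the average of d weight terms of the layer k + 2, and this average
concentrates at the positive mean by Chebyshev's inequality. -/
lemma whp_le_iSup {B : ℝ} (hρ : ∀ l, ∀ᵐ a ∂(ρ l), |a| ≤ B) {k : ℕ} (hk : k < L - 1)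
    (hpos : 0 < ∫ a, a ∂(ρ (k + 2))) :
    Whp (L := L) (d₀ := d₀) σw ρ fun _ => {ω | (∫ a, a ∂(ρ (k + 2))) / 2 ≤ ⨆ p, ω.2 p} := by
  set μ := ∫ a, a ∂(ρ (k + 2)) with hμ
  intro δ hδ
  obtain ⟨N, hN0, hN⟩ := exists_nat_div_le (B ^ 2 / (μ / 2) ^ 2) hδ
  refine ⟨N, fun d hd => ?_⟩
  have hd0 : (0 : ℝ) < d := by exact_mod_cast hN0.trans_le hd
  obtain ⟨e, he, hel⟩ := exists_injective_layerOf (L := L) (d₀ := d₀) (d := d) hk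
  have hI := integral_weighted_sum_sq_le (m := fun p : ParamIdx L d₀ d => ρ (layerOf p))
    (B := B) (μ₀ := μ) he (fun i => hρ _) (fun i => by rw [hel]) fun _ => (d : ℝ)⁻¹
  have hM := measureReal_lt_le_of_integral (fun z => sq_nonneg _) hI.1
    (pow_pos (half_pos hpos) 2) hI.2
  have hr : B ^ 2 * ∑ _i : Fin d, ((d : ℝ)⁻¹) ^ 2 / 1 = B ^ 2 / d := by
    simp; field_simp
  simp only [div_one] at hr
  rw [hr, div_right_comm] at hM
  refine le_trans ?_ (hM.trans (hN d hd))
  refine le_trans (le_of_eq ?_) (le_trans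
    (jointMeasure_real_snd (σw := σw) d {a | (⨆ p, a p) < μ / 2}).le
    (measureReal_mono (fun a ha => ?_) (measure_ne_top _ _)))
  · congr 1; ext ω; simp
  · have hle : ∀ i, a (e i) ≤ ⨆ p, a p := fun i => le_ciSup (Set.finite_range a).bddAbove (e i)
    have ha' : (⨆ p, a p) < μ / 2 := ha
    have hs : ∑ i, (a (e i) - μ) * (d : ℝ)⁻¹ ≤ ∑ _i : Fin d, ((⨆ p, a p) - μ) * (d : ℝ)⁻¹ :=
      Finset.sum_le_sum fun i _ => mul_le_mul_of_nonneg_right (by linarith [hle i])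
        (inv_nonneg.2 hd0.le)
    have hs' : ∑ _i : Fin d, ((⨆ p, a p) - μ) * (d : ℝ)⁻¹ = (⨆ p, a p) - μ := by
      simp; field_simp
    rw [hs'] at hs
    show (μ / 2) ^ 2 < _
    nlinarith

end WeightTerms

end WNTK

end

/-! ### The theorem. -/

theorem theorem2 (L d₀ n : ℕ) (hL : 2 ≤ L) (hd₀ : 0 < d₀) (hn : 0 < n)
    -- the activation function: bounded and Lipschitz derivative
    (σ : ℝ → ℝ) (hσ : Differentiable ℝ σ) (hσ₁ : ∃ C : ℝ, ∀ u, |deriv σ u| ≤ C)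
    (hσ₂ : ∃ C : ℝ, ∀ u v, |deriv σ u - deriv σ v| ≤ C * |u - v|)
    (σw : ℝ) (hσw : 0 < σw)
    -- the layer-wise distributions of the weight terms, with bounded support
    (ρ : ℕ → Measure ℝ) [∀ l, IsProbabilityMeasure (ρ l)]
    (hρ : ∃ B : ℝ, ∀ l, ∀ᵐ a ∂(ρ l), |a| ≤ B)
    -- the training set, with distinct inputs
    (X : Fin n → Fin d₀ → ℝ) (hX : Function.Injective X) (Y : Fin n → ℝ)
    -- the extreme eigenvalues of the analytic WNTK, which is positive definite
    (lmin lmax : ℝ) (hmin : IsLeast (spectrum ℝ (WNTK.analyticWNTK L σ σw ρ X)) lmin)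
    (hmax : IsGreatest (spectrum ℝ (WNTK.analyticWNTK L σ σw ρ X)) lmax) (hpos : 0 < lmin)
    (η₀ : ℝ) (hη₀ : 0 < η₀) (hη₀_lt : η₀ < 2 / (lmin + lmax))
    (δ₀ : ℝ) (hδ₀ : 0 < δ₀) :
    ∃ R₀ : ℝ, 0 < R₀ ∧ ∃ N : ℕ, ∃ K : ℝ, 1 < K ∧ ∀ d : ℕ, N ≤ d →
      ENNReal.ofReal (1 - δ₀) ≤ WNTK.jointMeasure L d₀ d σw ρ
        {ω | ∀ t : ℕ,
          ‖WNTK.wntk σ X ω.2 ω.1 - WNTK.wntk σ X ω.2 (WNTK.gradDescent σ X Y η₀ ω.2 ω.1 t)‖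
            ≤ 6 * K ^ 3 * R₀ * (⨆ p, ω.2 p) ^ 2 / (lmin * √(d : ℝ))} := by
  classical
  obtain ⟨c₁, hc₁⟩ := hσ₁
  obtain ⟨c₂, hc₂⟩ := hσ₂
  obtain ⟨B, hB⟩ := hρ
  have hS : WNTK.Smooth σ (max c₁ c₂) :=
    ⟨(abs_nonneg _).trans ((hc₁ 0).trans (le_max_left _ _)), hσ,
      fun u => (hc₁ u).trans (le_max_left _ _),
      fun u v => (hc₂ u v).trans (mul_le_mul_of_nonneg_right (le_max_right _ _) (abs_nonneg _))⟩
  have hB' : ∀ l, ∀ᵐ a ∂(ρ l), |a| ≤ max B 0 := fun l =>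
    (hB l).mono fun a ha => ha.trans (le_max_left _ _)
  have hB0 : (0 : ℝ) ≤ max B 0 := le_max_right _ _
  have hn' : (0 : ℝ) < n := by exact_mod_cast hn
  have hA : (WNTK.analyticWNTK L σ σw ρ X).IsHermitian := WNTK.isHermitian_analyticKernel _
  have hlm : lmin ≤ lmax := hmin.2 hmax.1
  have hη2 : η₀ * (lmin + lmax) < 2 := (lt_div_iff₀ (by linarith)).1 hη₀_lt
  obtain ⟨k, hk, hμ⟩ := WNTK.exists_integral_pos hn hmin hpos
  set μ := ∫ a, a ∂(ρ (k + 2)) with hμ_def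
  obtain ⟨K, R, hK1, hR, N₁, hN₁⟩ := WNTK.exists_init_bound (σw := σw) hL hS hB0 hB' X Y
    (δ := δ₀ / 2) (half_pos hδ₀)
  obtain ⟨C, hC, ε₀, hε₀, hstab⟩ := WNTK.exists_stability hS L n (max B 0) K R η₀
    (1 - η₀ * lmin / 2) hK1 hB0 hR hη₀.le (by nlinarith) (by nlinarith)
  -- Entrywise closeness lmin / (2n) costs at most lmin / 2 in operator norm, so the contraction
  -- factor is 1 - η₀ · lmin / 2.
  obtain ⟨N₂, hN₂⟩ := ((WNTK.whp_forall fun α => WNTK.whp_forall fun β => WNTK.whp_wntk (σw := σw)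
    (X := X) hL hS hB0 hB' (ε := lmin / (2 * n)) (by positivity) α β).inter
    (WNTK.whp_le_iSup hB' hk hμ)) (δ₀ / 2) (half_pos hδ₀)
  obtain ⟨N₃, hN₃0, hN₃⟩ := WNTK.exists_nat_div_le 1 (pow_pos hε₀ 4)
  -- Chosen so that 6 · 2³ · R₀ · (μ/2)² = (n C + 1) · lmin; the 1 keeps R₀ positive when C = 0. The
  -- witness 2 is unrelated to the constant `K` of the initialization bounds.
  refine ⟨(n * C + 1) * lmin / (12 * μ ^ 2), by positivity, max (max N₁ N₂) N₃, 2, by norm_num,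
    fun d hd => ?_⟩
  have hd1 : 0 < d := hN₃0.trans_le (le_of_max_le_right hd)
  have hd0 : (0 : ℝ) < d := by exact_mod_cast hd1
  have h1 := hN₁ d (le_of_max_le_left (le_of_max_le_left hd))
  have h2 := hN₂ d (le_of_max_le_right (le_of_max_le_left hd))
  have h3 := hN₃ d (le_of_max_le_right hd)
  have hε : √√((d : ℝ)⁻¹) ≤ ε₀ := by
    refine Real.sqrt_le_iff.2 ⟨hε₀.le, Real.sqrt_le_iff.2 ⟨sq_nonneg _, ?_⟩⟩
    rw [← pow_mul, ← one_div]
    exact h3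
  have hε2 : √√((d : ℝ)⁻¹) ^ 2 = (√(d : ℝ))⁻¹ := by
    rw [Real.sq_sqrt (Real.sqrt_nonneg _), Real.sqrt_inv]
  set P := WNTK.jointMeasure L d₀ d σw ρ
  set G : Set ((WNTK.ParamIdx L d₀ d → ℝ) × (WNTK.ParamIdx L d₀ d → ℝ)) := {ω | ∀ t : ℕ,
    ‖WNTK.wntk σ X ω.2 ω.1 - WNTK.wntk σ X ω.2 (WNTK.gradDescent σ X Y η₀ ω.2 ω.1 t)‖
      ≤ 6 * 2 ^ 3 * ((n * C + 1) * lmin / (12 * μ ^ 2)) * (⨆ p, ω.2 p) ^ 2 / (lmin * √(d : ℝ))}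
    with hG
  have hGc : P.real Gᶜ ≤ δ₀ := by
    refine le_trans ?_ ((measureReal_union_le _ _).trans
      ((add_le_add h1 h2).trans_eq (add_halves δ₀)))
    refine measureReal_mono ?_ (measure_ne_top _ _)
    rw [← Set.compl_inter]
    refine Set.compl_subset_compl.2 fun ω hω t => ?_
    obtain ⟨⟨hI, hY⟩, hw, hm⟩ := hω
    simp only [Set.mem_ofPred_eq] at hw hm
    have hcon := WNTK.l2_sub_smul_mulVec_le_of_abs_sub_le (M := WNTK.wntk σ X ω.2 ω.1) hA hmin hmax
      hpos hη₀ hη₀_lt (ε := lmin / (2 * n)) (by positivity)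
      (by rw [Fintype.card_fin]; exact le_of_eq (by field_simp)) hw
    have hst := hstab hI hε hY hcon t
    refine (WNTK.frobenius_norm_le_of_abs_le (ε := C * √√((d : ℝ)⁻¹) ^ 2) (by positivity)
      fun i j => by rw [Matrix.sub_apply]; exact hst i j).trans ?_
    have hsd : 0 < √(d : ℝ) := Real.sqrt_pos.2 hd0
    have hm2 : (μ / 2) ^ 2 ≤ (⨆ p, ω.2 p) ^ 2 := pow_le_pow_left₀ (by positivity) hm 2
    rw [hε2, Fintype.card_fin]
    calc (n : ℝ) * (C * (√(d : ℝ))⁻¹) ≤ (n * C + 1) * (√(d : ℝ))⁻¹ := by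
          rw [← mul_assoc]
          exact mul_le_mul_of_nonneg_right (by linarith) (inv_nonneg.2 hsd.le)
      _ = 6 * 2 ^ 3 * ((n * C + 1) * lmin / (12 * μ ^ 2)) * (μ / 2) ^ 2 / (lmin * √(d : ℝ)) := by
          field_simp; norm_num
      _ ≤ _ := by gcongr
  -- Subadditivity suffices, so measurability of `G` is not needed.
  have hone : 1 ≤ P.real G + P.real Gᶜ := by
    have := measureReal_union_le (μ := P) G Gᶜ
    rwa [Set.union_compl_self, probReal_univ] at this
  rw [ENNReal.ofReal_le_iff_le_toReal (measure_ne_top _ _)]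
  exact (by linarith : 1 - δ₀ ≤ P.real G)
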